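/- The complex Lie algebras $sl(4,\mathbb C)$ (traceless $4\times4$ matrices) and $o(6,\mathbb C)$ (skew-symmetric $6\times 6$ matrices) are isomorphic, and the following holds for them. Conventions, for a finite-dimensional complex Lie algebra $L$. A grading is a decomposition $L=\bigoplus_{j\in J}L_j$ into nonzero subspaces such that each $[L_j,L_k]$ is contained in some $L_l$. It is a group grading if $J$ can be taken to be a subset of an abelian group such that $[L_j,L_k]\neq 0$ implies $[L_j,L_k]\subseteq L_{jk}$, and a fine group grading if moreover no group grading refines it properly. Two gradings are equivalent if an automorphism of $L$ carries the subspaces of one to those of the other. A MAD-group is a set $\mathcal G\subseteq \operatorname{Aut} L$ of commuting diagonalizable automorphisms that contains every diagonalizable automorphism commuting with all of its elements; two such sets are conjugate if $h\mathcal G_1h^{-1}=\mathcal G_2$ for some $h\in\operatorname{Aut}L$. $\operatorname{Gr}(\mathcal G)$ denotes the decomposition of $L$ into the nonzero simultaneous eigenspaces of the elements of $\mathcal G$. There are MAD-groups $\mathcal G_1,\dots,\mathcal G_8$ in $\operatorname{Aut} sl(4,\mathbb C)$, no two of which are conjugate, such that every MAD-group is conjugate to one of them. The decompositions $\Gamma_i=\operatorname{Gr}(\mathcal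 G_i)$ are fine group gradings, no two of them are equivalent, and every fine group grading of $sl(4,\mathbb C)$ is equivalent to one of them. So there are exactly eight MAD-groups up to conjugacy and exactly eight fine group gradings up to equivalence. The groups can be chosen and numbered so that: 1. $\Gamma_1$ is the Cartan grading (the root space decomposition with respect to a Cartan subalgebra): one subspace of dimension 3 and twelve of dimension 1. 2. $\Gamma_2$ is the Pauli grading, with subspaces $\mathbb C\,Q^aP^b$, $0\le a,b\le 3$, $(a,b)\ne(0,0)$, where $P=\operatorname{diag}(1,i,-1,-i)$ and $Q=E_{12}+E_{23}+E_{34}+E_{41}$: fifteen subspaces of dimension 1. 3. $\Gamma_3$ is the orthogonal grading, with subspaces the traceless diagonal matrices, $\mathbb C(E_{ij}+E_{ji})$ and $\mathbb C(E_{ij}-E_{ji})$ for $i<j$; distinct subspaces are orthogonal with respect to $\operatorname{tr}(AB^{+})$, where $B^+$ is the conjugate transpose of $B$: one subspace of dimension 3 and twelve of dimension 1. 4. $\Gamma_4,\Gamma_5,\Gamma_8$: one subspace of dimension 2 and thirteen of dimension 1. 5. $\Gamma_6,\Gamma_7$: fifteen subspaces of dimension 1. For every isomorphism $f: sl(4,\mathbb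 C)\to o(6,\mathbb C)$, the groups $f\mathcal G_if^{-1}$ and the decompositions $\operatorname{Gr}(f\mathcal G_if^{-1})$ are in the same way complete lists without repetition of the MAD-groups and the fine group gradings of $o(6,\mathbb C)$; the first grading is again the Cartan grading, and the dimensions are those above. -/

import Mathlib

open scoped Matrix

namespace LieGrading

section General

variable {L : Type*} [LieRing L] [LieAlgebra ℂ L]
variable {L' : Type*} [LieRing L'] [LieAlgebra ℂ L']

/-- The inclusion `[U, V] ⊆ W` for subspaces of a Lie algebra. -/
def BracketLE (U V W : Submodule ℂ L) : Prop :=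
  ∀ u ∈ U, ∀ v ∈ V, ⁅u, v⁆ ∈ W

/-- A grading of `L`, given by the set of its grading subspaces: nonzero subspaces of which `L` is
the direct sum, such that the bracket of any two of them lies in one of them. (The subspaces of a
direct sum decomposition into nonzero subspaces are pairwise distinct, so that the set of subspaces
carries the same information as the family, up to renaming the indices.) -/
structure IsGrading (Γ : Set (Submodule ℂ L)) : Prop where
  ne_bot : ∀ U ∈ Γ, U ≠ ⊥
  indep : sSupIndep Γ
  sSup_eq_top : sSup Γ = ⊤
  bracket : ∀ U ∈ Γ, ∀ V ∈ Γ, ∃ W ∈ Γ, BracketLE U V W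

/-- A group grading: a grading whose subspaces are indexed by pairwise distinct elements of some
abelian group such that `[L_j, L_k] ≠ 0` implies `[L_j, L_k] ⊆ L_{j * k}`. (The group may be taken
to be generated by the finitely many indices when `L` has finite dimension, so that the universe of
`G` is no restriction.) -/
def IsGroupGrading (Γ : Set (Submodule ℂ L)) : Prop :=
  IsGrading Γ ∧
    ∃ (G : Type) (_ : CommGroup G) (deg : Submodule ℂ L → G), Set.InjOn deg Γ ∧
      ∀ U ∈ Γ, ∀ V ∈ Γ, ¬ BracketLE U V ⊥ →
        ∃ W ∈ Γ, deg W = deg U * deg V ∧ BracketLE U V W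

/-- `Δ` is a refinement of `Γ`: the subspaces of `Γ` are the (direct) sums of groups of subspaces
of `Δ`. -/
def IsRefinement (Δ Γ : Set (Submodule ℂ L)) : Prop :=
  (∀ V ∈ Δ, ∃ U ∈ Γ, V ≤ U) ∧ ∀ U ∈ Γ, sSup {V ∈ Δ | V ≤ U} = U

/-- A fine group grading: a group grading without proper refinements that are group gradings. -/
def IsFineGroupGrading (Γ : Set (Submodule ℂ L)) : Prop :=
  IsGroupGrading Γ ∧ ∀ Δ, IsGroupGrading Δ → IsRefinement Δ Γ → Δ = Γ

/-- The image of a set of subspaces under an isomorphism of Lie algebras. -/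
def image (h : L ≃ₗ⁅ℂ⁆ L') (Γ : Set (Submodule ℂ L)) : Set (Submodule ℂ L') :=
  (fun U => U.map (h.toLinearEquiv : L →ₗ[ℂ] L')) '' Γ

/-- Two gradings are equivalent if some automorphism carries the subspaces of the first
(bijectively) to those of the second. -/
def Equivalent (Γ Δ : Set (Submodule ℂ L)) : Prop :=
  ∃ h : L ≃ₗ⁅ℂ⁆ L, image h Γ = Δ

/-- The eigenspace of an automorphism for the value `c` (which is `0` if `c` is no eigenvalue). -/
def eigenspace (g : L ≃ₗ⁅ℂ⁆ L) (c : ℂ) : Submodule ℂ L :=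
  Module.End.eigenspace (g.toLinearEquiv : L →ₗ[ℂ] L) c

/-- An automorphism is diagonalizable if `L` is the sum of its eigenspaces. -/
def IsDiagonalizable (g : L ≃ₗ⁅ℂ⁆ L) : Prop :=
  ⨆ c : ℂ, eigenspace g c = ⊤

/-- The maximal abelian sets (hence groups) of diagonalizable automorphisms. -/
structure IsMADGroup (𝒢 : Set (L ≃ₗ⁅ℂ⁆ L)) : Prop where
  diag : ∀ g ∈ 𝒢, IsDiagonalizable g
  comm : ∀ f ∈ 𝒢, ∀ g ∈ 𝒢, ∀ x, f (g x) = g (f x)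
  maximal : ∀ h : L ≃ₗ⁅ℂ⁆ L, IsDiagonalizable h → (∀ g ∈ 𝒢, ∀ x, h (g x) = g (h x)) → h ∈ 𝒢

/-- The set `f 𝒢 f⁻¹`. -/
def conj (f : L ≃ₗ⁅ℂ⁆ L') (𝒢 : Set (L ≃ₗ⁅ℂ⁆ L)) : Set (L' ≃ₗ⁅ℂ⁆ L') :=
  (fun g => (f.symm.trans g).trans f) '' 𝒢

/-- Conjugacy of sets of automorphisms in the automorphism group. -/
def Conjugate (𝒢 ℋ : Set (L ≃ₗ⁅ℂ⁆ L)) : Prop :=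
  ∃ h : L ≃ₗ⁅ℂ⁆ L, conj h 𝒢 = ℋ

/-- The decomposition `Gr(𝒢)` into the nonzero simultaneous eigenspaces of the elements of `𝒢`. -/
def Gr (𝒢 : Set (L ≃ₗ⁅ℂ⁆ L)) : Set (Submodule ℂ L) :=
  {V | V ≠ ⊥ ∧ ∃ c : (L ≃ₗ⁅ℂ⁆ L) → ℂ, V = ⨅ g ∈ 𝒢, eigenspace g (c g)}

/-- The members of `𝒢` are MAD-groups, no two of them are conjugate, and each MAD-group is
conjugate to one of them. -/
structure IsCompleteMADList {n : ℕ} (𝒢 : Fin n → Set (L ≃ₗ⁅ℂ⁆ L)) : Prop where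
  isMAD : ∀ i, IsMADGroup (𝒢 i)
  not_conjugate : ∀ i j, i ≠ j → ¬ Conjugate (𝒢 i) (𝒢 j)
  complete : ∀ ℋ, IsMADGroup ℋ → ∃ i, Conjugate ℋ (𝒢 i)

/-- The members of `Γ` are fine group gradings, no two of them are equivalent, and each fine group
grading is equivalent to one of them. -/
structure IsCompleteFineList {n : ℕ} (Γ : Fin n → Set (Submodule ℂ L)) : Prop where
  isFine : ∀ i, IsFineGroupGrading (Γ i)
  not_equivalent : ∀ i j, i ≠ j → ¬ Equivalent (Γ i) (Γ j)
  complete : ∀ Δ, IsFineGroupGrading Δ → ∃ i, Equivalent Δ (Γ i)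

/-- The multiset of dimensions of the grading subspaces is `m`. -/
def HasDims (Γ : Set (Submodule ℂ L)) (m : Multiset ℕ) : Prop :=
  ∀ d : ℕ, {U ∈ Γ | Module.finrank ℂ U = d}.encard = m.count d

/-- The Cartan grading: the root space decomposition (including the root space of `0`) with
respect to some Cartan subalgebra. -/
def IsCartanGrading (Γ : Set (Submodule ℂ L)) : Prop :=
  ∃ (H : LieSubalgebra ℂ L) (_ : H.IsCartanSubalgebra),
    Γ = {V | V ≠ ⊥ ∧ ∃ χ : H → ℂ, V = (LieAlgebra.rootSpace H χ).toSubmodule}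

end General

section SpecialLinear

attribute [local instance] LieRing.ofAssociativeRing

/-- The subspace of the traceless matrices in a subspace of matrices, as a subspace of
`sl(m, ℂ)`. -/
def inSl {m : ℕ} (W : Submodule ℂ (Matrix (Fin m) (Fin m) ℂ)) :
    Submodule ℂ (LieAlgebra.SpecialLinear.sl (Fin m) ℂ) :=
  W.comap ((LieAlgebra.SpecialLinear.sl (Fin m) ℂ).incl :
    LieAlgebra.SpecialLinear.sl (Fin m) ℂ →ₗ[ℂ] Matrix (Fin m) (Fin m) ℂ)

/-- The generalized Pauli matrix `diag(1, ω, …, ω ^ (m - 1))`, `ω = exp(2πi / m)`. -/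
noncomputable def pauliP (m : ℕ) : Matrix (Fin m) (Fin m) ℂ :=
  Matrix.diagonal fun k => Complex.exp (2 * Real.pi * Complex.I / m) ^ (k : ℕ)

/-- The generalized Pauli matrix with ones on the superdiagonal and in the lower left corner. -/
def pauliQ (m : ℕ) : Matrix (Fin m) (Fin m) ℂ :=
  Matrix.of fun i j => if (j : ℕ) = ((i : ℕ) + 1) % m then 1 else 0

/-- The Pauli grading of `sl(m, ℂ)`: the lines spanned by the `Q ^ a * P ^ b`,
`0 ≤ a, b < m`, `(a, b) ≠ (0, 0)`. -/
def pauliGrading (m : ℕ) : Set (Submodule ℂ (LieAlgebra.SpecialLinear.sl (Fin m) ℂ)) :=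
  {V | ∃ a b : ℕ, a < m ∧ b < m ∧ (a, b) ≠ (0, 0) ∧
    V = inSl (Submodule.span ℂ {pauliQ m ^ a * pauliP m ^ b})}

/-- The orthogonal grading: the subspace of traceless diagonal matrices and the lines spanned by
`E_ij + E_ji` and by `E_ij - E_ji`, `i < j`. -/
def orthogonalGrading (m : ℕ) : Set (Submodule ℂ (LieAlgebra.SpecialLinear.sl (Fin m) ℂ)) :=
  {V | V = inSl (Submodule.span ℂ (Set.range fun i => Matrix.single i i (1 : ℂ))) ∨
    ∃ i j : Fin m, i < j ∧
      (V = inSl (Submodule.span ℂ {Matrix.single i j (1 : ℂ) + Matrix.single j i 1}) ∨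
        V = inSl (Submodule.span ℂ {Matrix.single i j (1 : ℂ) - Matrix.single j i 1}))}

/-- Any two distinct members of `Γ` are orthogonal for the scalar product `tr (A Bᴴ)`. -/
def IsPairwiseOrthogonal {m : ℕ}
    (Γ : Set (Submodule ℂ (LieAlgebra.SpecialLinear.sl (Fin m) ℂ))) : Prop :=
  ∀ U ∈ Γ, ∀ V ∈ Γ, U ≠ V → ∀ A ∈ U, ∀ B ∈ V, Matrix.trace (A.1 * (B.1)ᴴ) = 0

end SpecialLinear

/-- The dimensions of the grading subspaces of the eight fine group gradings. -/
def dims : Fin 8 → Multiset ℕ :=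
  ![3 ::ₘ Multiset.replicate 12 1,
    Multiset.replicate 15 1,
    3 ::ₘ Multiset.replicate 12 1,
    2 ::ₘ Multiset.replicate 13 1,
    2 ::ₘ Multiset.replicate 13 1,
    Multiset.replicate 15 1,
    Multiset.replicate 15 1,
    2 ::ₘ Multiset.replicate 13 1]

/-- `𝒢` is a complete list of eight MAD-groups of `L` up to conjugacy, the decompositions `Gr(𝒢 i)`
are a complete list of the fine group gradings of `L` up to equivalence, the first of them is the
Cartan grading, and their subspaces have the listed dimensions. -/
structure IsClassification {L : Type*} [LieRing L] [LieAlgebra ℂ L]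
    (𝒢 : Fin 8 → Set (L ≃ₗ⁅ℂ⁆ L)) : Prop where
  mad : IsCompleteMADList 𝒢
  fine : IsCompleteFineList fun i => Gr (𝒢 i)
  cartan : IsCartanGrading (Gr (𝒢 0))
  hasDims : ∀ i, HasDims (Gr (𝒢 i)) (dims i)

end LieGrading

open scoped Matrix

namespace LieGrading

/-! ### Simultaneous eigenspaces and independent families of subspaces -/

section LinearAlgebra

variable {V : Type*} [AddCommGroup V] [Module ℂ V]

/-! MAD-groups and fine group gradings are two sides of one duality. A MAD-group 𝒢 gives its joint
eigenspaces `Gr 𝒢`, and a grading Γ gives the group `diagGroup Γ` of automorphisms that are scalar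
on every piece. Since characters into ℂˣ separate the elements of an abelian group, `Gr (diagGroup
Γ) = Γ` for every group grading (`Gr_diagGroup`). Hence fine gradings correspond to MAD-groups, and
equivalence corresponds to conjugacy. It remains to classify MAD-groups.

Upper bound: at most eight classes. Automorphisms of sl(4) preserve the extremal elements, which are
the square-zero matrices of rank at most one, and this shows that each automorphism is inner or
becomes inner after X ↦ -Xᵀ (`IsSlAut.isInner_or`). On the skew-symmetric 4×4 matrices, with
coordinates orthonormal for the Pfaffian, sl(4) acts as so(6), and every automorphism is conjugation
by an orthogonal 6×6 matrix that is unique up to sign (`exists_isLift`). So a MAD-group lifts to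
diagonalizable orthogonal matrices that pairwise commute or anticommute.

If all lifts commute, ℂ⁶ has a common eigenbasis made of orthonormal vectors and k hyperbolic pairs,
k = 0, 1, 2, 3. If lifts g, h anticommute, then ℂ⁶ splits into three planes on which every lift acts
by a scalar times a Pauli matrix; a second independent anticommuting pair would need 4 ∣ 6
(`not_anticommute_of_commute`). The Gram matrix of a plane is 1, Z or X, or two planes are totally
isotropic and dual to each other. Changing bases inside the planes by Clifford matrices permutes the
three forms, so that only four cases are left: three nondegenerate planes with one, two or three
distinct forms, or one such plane and a dual pair. Two MAD-groups with frames of the same shape are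
conjugate by the orthogonal matrix that carries one frame to the other (`conjugate_of_isFrame`): the
transported group commutes with the second one up to signs upstairs, hence exactly downstairs, and
maximality makes them equal.

Lower bound: eight explicit gradings are given by homogeneous bases over the Gaussian integers, with
finite checks by evaluation. They are fine by a criterion on brackets with lines
(`isFineGroupGrading_of_lines`) and are told apart by their dimensions and two bracket invariants
(`not_equivalent_fineGradings`). By pigeonhole, eight pairwise nonconjugate MAD-groups exhaust the
eight types (`IsCompleteMADList.of_not_conjugate`), so the type of an individual grading never has
to be determined. All notions are transported to so(6) by an arbitrary isomorphism. -/

lemma maxGenEigenspace_eq_eigenspace_of_iSup_eq_top (f : Module.End ℂ V)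
    (h : ⨆ μ, f.eigenspace μ = ⊤) (μ : ℂ) : f.maxGenEigenspace μ = f.eigenspace μ := by
  have hle : ∀ ν, f.eigenspace ν ≤ f.maxGenEigenspace ν := fun ν =>
    (f.genEigenspace ν).mono le_top
  refine le_antisymm ?_ (hle μ)
  have hind := f.independent_maxGenEigenspace
  have hd : Disjoint (f.maxGenEigenspace μ) (⨆ ν, ⨆ _ : ν ≠ μ, f.eigenspace ν) :=
    (hind μ).mono_right (iSup_mono fun ν => iSup_mono fun _ => hle ν)
  have hs : f.eigenspace μ ⊔ (⨆ ν, ⨆ _ : ν ≠ μ, f.eigenspace ν) = ⊤ := by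
    rw [← h]; exact (iSup_split_single _ μ).symm
  intro x hx
  have hx' : x ∈ f.eigenspace μ ⊔ (⨆ ν, ⨆ _ : ν ≠ μ, f.eigenspace ν) := by
    rw [hs]; trivial
  obtain ⟨y, hy, z, hz, rfl⟩ := Submodule.mem_sup.1 hx'
  have hz' : z ∈ f.maxGenEigenspace μ := by
    have := Submodule.sub_mem _ hx (hle μ hy)
    simpa using this
  have : z = 0 := Submodule.disjoint_def.1 hd z hz' hz
  simpa [this] using hy

lemma iSup_iInf_eigenspace_eq_top [FiniteDimensional ℂ V] {ι : Type*} (f : ι → Module.End ℂ V)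
    (hc : ∀ i j, Commute (f i) (f j)) (h : ∀ i, ⨆ μ, (f i).eigenspace μ = ⊤) :
    ⨆ χ : ι → ℂ, ⨅ i, (f i).eigenspace (χ i) = ⊤ := by
  have := Module.End.iSup_iInf_maxGenEigenspace_eq_top_of_iSup_maxGenEigenspace_eq_top_of_commute
    f (fun i j _ => hc i j) (fun i => by
      simp_rw [maxGenEigenspace_eq_eigenspace_of_iSup_eq_top _ (h i)]; exact h i)
  simpa only [maxGenEigenspace_eq_eigenspace_of_iSup_eq_top _ (h _)] using this

lemma iSupIndep_iInf_eigenspace {ι : Type*} (f : ι → Module.End ℂ V)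
    (hc : ∀ i j, Commute (f i) (f j)) (h : ∀ i, ⨆ μ, (f i).eigenspace μ = ⊤) :
    iSupIndep fun χ : ι → ℂ => ⨅ i, (f i).eigenspace (χ i) := by
  have := Module.End.independent_iInf_maxGenEigenspace_of_forall_mapsTo f
    (fun i j φ => Module.End.mapsTo_maxGenEigenspace_of_comm (hc j i) φ)
  simpa only [maxGenEigenspace_eq_eigenspace_of_iSup_eq_top _ (h _)] using this

/-- A member of Γ' outside Γ would be disjoint from the sum of Γ, which is everything. This turns
inclusions of gradings into equalities. -/
lemma eq_of_subset_of_sSupIndep {Γ Γ' : Set (Submodule ℂ V)} (h : Γ ⊆ Γ') (htop : sSup Γ = ⊤)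
    (hind : sSupIndep Γ') (hne : ∀ U ∈ Γ', U ≠ ⊥) : Γ = Γ' := by
  refine h.antisymm fun U hU => ?_
  by_contra hn
  have h1 := hind hU
  have h2 : sSup (Γ' \ {U}) = ⊤ := by
    rw [eq_top_iff, ← htop]
    exact sSup_le_sSup fun W hW => ⟨h hW, fun e => hn (e ▸ hW)⟩
  rw [h2] at h1
  exact hne U hU (disjoint_top.1 h1)

lemma eq_of_mem_of_sSupIndep {Γ : Set (Submodule ℂ V)} (hind : sSupIndep Γ) {U W : Submodule ℂ V}
    (hU : U ∈ Γ) (hW : W ∈ Γ) {x : V} (hx : x ≠ 0) (hxU : x ∈ U) (hxW : x ∈ W) : U = W := by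
  by_contra hne
  exact hx (Submodule.disjoint_def.1 (hind.pairwiseDisjoint hU hW hne) x hxU hxW)

lemma exists_linearMap_of_isInternal {Γ : Set (Submodule ℂ V)} (hind : sSupIndep Γ)
    (htop : sSup Γ = ⊤) (c : Submodule ℂ V → ℂ) :
    ∃ T : V →ₗ[ℂ] V, ∀ U ∈ Γ, ∀ x ∈ U, T x = c U • x := by
  classical
  have hint : DirectSum.IsInternal (fun U : Γ => (U : Submodule ℂ V)) := by
    rw [DirectSum.isInternal_submodule_iff_iSupIndep_and_iSup_eq_top]
    exact ⟨((sSupIndep_iff _).1 hind), by rw [← htop, sSup_eq_iSup']⟩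
  let e := LinearEquiv.ofBijective (DirectSum.coeLinearMap fun U : Γ => (U : Submodule ℂ V)) hint
  refine ⟨(DirectSum.toModule ℂ Γ V fun U => c U • (U : Submodule ℂ V).subtype) ∘ₗ
    e.symm.toLinearMap, fun U hU x hx => ?_⟩
  have : e.symm x = DirectSum.lof ℂ Γ (fun U : Γ => (U : Submodule ℂ V)) ⟨U, hU⟩ ⟨x, hx⟩ := by
    rw [LinearEquiv.symm_apply_eq]
    exact (DirectSum.coeLinearMap_lof (R := ℂ) (A := fun U : Γ => (U : Submodule ℂ V)) ⟨U, hU⟩ ⟨x, hx⟩).symm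
  simp [this]

lemma sSup_induction_on {Γ : Set (Submodule ℂ V)} (htop : sSup Γ = ⊤) (W : Submodule ℂ V)
    (h : ∀ U ∈ Γ, ∀ x ∈ U, x ∈ W) (x : V) : x ∈ W := by
  have : sSup Γ ≤ W := sSup_le fun U hU x hx => h U hU x hx
  rw [htop] at this
  exact this trivial

end LinearAlgebra

/-- Characters into ℚ/ℤ separate the elements of any abelian group, and ℚ/ℤ embeds into ℝ/ℤ and,
through the circle, into ℂˣ. -/
lemma exists_unitsHom_ne_one {G : Type*} [CommGroup G] {a : G} (ha : a ≠ 1) :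
    ∃ χ : G →* ℂˣ, χ a ≠ 1 := by
  obtain ⟨c, hc⟩ := CharacterModule.exists_character_apply_ne_zero_of_ne_zero
    (A := Additive G) (a := Additive.ofMul a) (by simpa using ha)
  let e : AddCircle (1 : ℚ) →+ AddCircle (1 : ℝ) :=
    QuotientAddGroup.map _ _ (Rat.castHom ℝ).toAddMonoidHom (by
      rw [AddSubgroup.zmultiples_le]
      simp [AddSubgroup.mem_zmultiples])
  have he : Function.Injective e := by
    rw [injective_iff_map_eq_zero]
    intro x
    induction x using QuotientAddGroup.induction_on with
    | H q =>
      intro hq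
      have : ((q : ℝ) : AddCircle (1 : ℝ)) = 0 := hq
      rw [AddCircle.coe_eq_zero_iff] at this
      obtain ⟨n, hn⟩ := this
      refine (AddCircle.coe_eq_zero_iff 1).2 ⟨n, ?_⟩
      have : ((n : ℚ) : ℝ) = q := by simpa using hn
      simpa using (Rat.cast_injective this)
  let f : AddCircle (1 : ℝ) → ℂˣ := fun x => Circle.toUnits (AddCircle.toCircle x)
  refine ⟨⟨⟨fun g => f (e (c (Additive.ofMul g))), by simp [f]⟩, fun x y => by
    simp [f, AddCircle.toCircle_add]⟩, ?_⟩
  intro h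
  apply hc
  apply he
  rw [map_zero]
  apply AddCircle.injective_toCircle one_ne_zero
  rw [AddCircle.toCircle_zero]
  have h' : Circle.toUnits (AddCircle.toCircle (e (c (Additive.ofMul a)))) = 1 := h
  apply Circle.ext
  simpa using congrArg Units.val h'

/-! ### Duality between toral sets of automorphisms and group gradings -/

section General

variable {L : Type*} [LieRing L] [LieAlgebra ℂ L]
variable {L' : Type*} [LieRing L'] [LieAlgebra ℂ L']

lemma mem_eigenspace {g : L ≃ₗ⁅ℂ⁆ L} {c : ℂ} {x : L} : x ∈ eigenspace g c ↔ g x = c • x :=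
  Module.End.mem_eigenspace_iff

lemma mem_iInf_eigenspace {𝒮 : Set (L ≃ₗ⁅ℂ⁆ L)} {χ : (L ≃ₗ⁅ℂ⁆ L) → ℂ} {x : L} :
    x ∈ ⨅ g ∈ 𝒮, eigenspace g (χ g) ↔ ∀ g ∈ 𝒮, g x = χ g • x := by
  simp [Submodule.mem_iInf, mem_eigenspace]

/-- A set of commuting diagonalizable automorphisms. -/
structure IsToral (𝒮 : Set (L ≃ₗ⁅ℂ⁆ L)) : Prop where
  diag : ∀ g ∈ 𝒮, IsDiagonalizable g
  comm : ∀ f ∈ 𝒮, ∀ g ∈ 𝒮, ∀ x, f (g x) = g (f x)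

lemma IsMADGroup.isToral {𝒮 : Set (L ≃ₗ⁅ℂ⁆ L)} (h : IsMADGroup 𝒮) : IsToral 𝒮 := ⟨h.diag, h.comm⟩

/-- The automorphisms that act by a scalar on each of the subspaces of a set. -/
def diagGroup (Γ : Set (Submodule ℂ L)) : Set (L ≃ₗ⁅ℂ⁆ L) :=
  {g | ∀ U ∈ Γ, ∃ c : ℂ, ∀ x ∈ U, g x = c • x}

lemma exists_scalar_of_mem_Gr {𝒮 : Set (L ≃ₗ⁅ℂ⁆ L)} {U : Submodule ℂ L} (hU : U ∈ Gr 𝒮)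
    {g : L ≃ₗ⁅ℂ⁆ L} (hg : g ∈ 𝒮) : ∃ c : ℂ, ∀ x ∈ U, g x = c • x := by
  obtain ⟨-, χ, rfl⟩ := hU
  exact ⟨χ g, fun x hx => mem_iInf_eigenspace.1 hx g hg⟩

lemma subset_diagGroup_Gr (𝒮 : Set (L ≃ₗ⁅ℂ⁆ L)) : 𝒮 ⊆ diagGroup (Gr 𝒮) :=
  fun _ hg _ hU => exists_scalar_of_mem_Gr hU hg

section Toral

variable {𝒮 : Set (L ≃ₗ⁅ℂ⁆ L)}

lemma IsToral.sSupIndep_Gr (h : IsToral 𝒮) : sSupIndep (Gr 𝒮) := by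
  have := iSupIndep_iInf_eigenspace (fun g : 𝒮 => (g.1.toLinearEquiv : L →ₗ[ℂ] L))
    (fun f g => LinearMap.ext fun x => h.comm f f.2 g g.2 x) (fun g => h.diag g g.2)
  refine this.sSupIndep_range.mono ?_
  rintro U ⟨-, χ, rfl⟩
  exact ⟨fun g => χ g, by rw [iInf_subtype']; rfl⟩

lemma IsToral.sSup_Gr [FiniteDimensional ℂ L] (h : IsToral 𝒮) : sSup (Gr 𝒮) = ⊤ := by
  classical
  have := iSup_iInf_eigenspace_eq_top (fun g : 𝒮 => (g.1.toLinearEquiv : L →ₗ[ℂ] L))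
    (fun f g => LinearMap.ext fun x => h.comm f f.2 g g.2 x) (fun g => h.diag g g.2)
  rw [eq_top_iff, ← this]
  refine iSup_le fun χ => ?_
  by_cases hb : (⨅ g : 𝒮, Module.End.eigenspace (g.1.toLinearEquiv : L →ₗ[ℂ] L) (χ g)) = ⊥
  · rw [hb]; exact bot_le
  refine le_sSup ⟨hb, fun g => if hg : g ∈ 𝒮 then χ ⟨g, hg⟩ else 0, ?_⟩
  rw [iInf_subtype']
  refine iInf_congr fun g => ?_
  simp [eigenspace]

lemma ne_zero_of_apply_eq_smul {g : L ≃ₗ⁅ℂ⁆ L} {c : ℂ} {x : L} (hx : x ≠ 0) (h : g x = c • x) :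
    c ≠ 0 := by
  rintro rfl
  rw [zero_smul] at h
  exact hx (by simpa using h)

end Toral
end General

section Small

variable {L : Type} [LieRing L] [LieAlgebra ℂ L] [FiniteDimensional ℂ L]

/-- The grading group consists of the functions 𝒮 → ℂˣ, and the degree of an eigenspace is its
family of eigenvalues. These multiply under brackets because the elements of 𝒮 are automorphisms. -/
theorem IsToral.isGroupGrading_Gr {𝒮 : Set (L ≃ₗ⁅ℂ⁆ L)} (h : IsToral 𝒮) :
    IsGroupGrading (Gr 𝒮) := by
  classical
  have hex : ∀ U ∈ Gr 𝒮, ∀ g ∈ 𝒮, ∃ c : ℂˣ, ∀ x ∈ U, g x = (c : ℂ) • x := by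
    intro U hU g hg
    obtain ⟨c, hc⟩ := exists_scalar_of_mem_Gr hU hg
    obtain ⟨x, hx, hx0⟩ := (Submodule.ne_bot_iff U).1 hU.1
    exact ⟨Units.mk0 c (ne_zero_of_apply_eq_smul hx0 (hc x hx)), hc⟩
  let deg : Submodule ℂ L → (𝒮 → ℂˣ) := fun U g =>
    if hc : ∃ c : ℂˣ, ∀ x ∈ U, g.1 x = (c : ℂ) • x then hc.choose else 1
  have hdeg : ∀ U ∈ Gr 𝒮, ∀ g : 𝒮, ∀ x ∈ U, g.1 x = (deg U g : ℂ) • x := by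
    intro U hU g
    have hc := hex U hU g g.2
    simp only [deg, dif_pos hc]
    exact hc.choose_spec
  have hW : ∀ U ∈ Gr 𝒮, ∀ V ∈ Gr 𝒮, ∀ x ∈ U, ∀ y ∈ V, ⁅x, y⁆ ≠ 0 →
      ∃ W ∈ Gr 𝒮, deg W = deg U * deg V ∧ BracketLE U V W := by
    intro U hU V hV x hx y hy hne
    -- The value 0 outside 𝒮 is never consulted.
    let χ : (L ≃ₗ⁅ℂ⁆ L) → ℂ := fun g => if hg : g ∈ 𝒮 then (deg U ⟨g, hg⟩ * deg V ⟨g, hg⟩ : ℂˣ) else 0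
    have hb : BracketLE U V (⨅ g ∈ 𝒮, eigenspace g (χ g)) := by
      intro u hu v hv
      rw [mem_iInf_eigenspace]
      intro g hg
      rw [LieEquiv.map_lie, hdeg U hU ⟨g, hg⟩ u hu, hdeg V hV ⟨g, hg⟩ v hv]
      simp [χ, hg, smul_smul]
      ring_nf
    have hmem : (⨅ g ∈ 𝒮, eigenspace g (χ g)) ∈ Gr 𝒮 :=
      ⟨(Submodule.ne_bot_iff _).2 ⟨_, hb x hx y hy, hne⟩, χ, rfl⟩
    refine ⟨_, hmem, ?_, hb⟩
    funext g
    have h1 := hdeg _ hmem g _ (hb x hx y hy)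
    have h2 := mem_iInf_eigenspace.1 (hb x hx y hy) g g.2
    rw [h2] at h1
    have h3 := smul_left_injective ℂ hne h1
    simp only [χ, g.2, dif_pos] at h3
    exact (Units.ext h3).symm
  refine ⟨⟨fun U hU => hU.1, h.sSupIndep_Gr, h.sSup_Gr, fun U hU V hV => ?_⟩, (𝒮 → ℂˣ),
    inferInstance, deg, ?_, ?_⟩
  · by_cases hb : ∃ x ∈ U, ∃ y ∈ V, ⁅x, y⁆ ≠ 0
    · obtain ⟨x, hx, y, hy, hne⟩ := hb
      obtain ⟨W, hW, -, hle⟩ := hW U hU V hV x hx y hy hne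
      exact ⟨W, hW, hle⟩
    · push Not at hb
      exact ⟨U, hU, fun u hu v hv => by rw [hb u hu v hv]; exact U.zero_mem⟩
  · intro U hU V hV hUV
    have key : ∀ U ∈ Gr 𝒮, ∀ V ∈ Gr 𝒮, deg U = deg V → U ≤ V := by
      intro U hU V hV hUV x hx
      obtain ⟨hV0, χ, rfl⟩ := id hV
      rw [mem_iInf_eigenspace]
      intro g hg
      obtain ⟨y, hy, hy0⟩ := (Submodule.ne_bot_iff _).1 hV0
      have h1 := hdeg _ hV ⟨g, hg⟩ y hy
      rw [mem_iInf_eigenspace.1 hy g hg] at h1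
      rw [hdeg U hU ⟨g, hg⟩ x hx, hUV, smul_left_injective ℂ hy0 h1]
    exact (key U hU V hV hUV).antisymm (key V hV U hU hUV.symm)
  · intro U hU V hV hb
    simp only [BracketLE, Submodule.mem_bot, not_forall] at hb
    obtain ⟨x, hx, y, hy, hne⟩ := hb
    exact hW U hU V hV x hx y hy hne

end Small

section General

variable {L : Type*} [LieRing L] [LieAlgebra ℂ L]
variable {L' : Type*} [LieRing L'] [LieAlgebra ℂ L']

lemma isDiagonalizable_of_forall {g : L ≃ₗ⁅ℂ⁆ L} {Γ : Set (Submodule ℂ L)} (htop : sSup Γ = ⊤)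
    (h : ∀ U ∈ Γ, ∃ c : ℂ, ∀ x ∈ U, g x = c • x) : IsDiagonalizable g := by
  rw [IsDiagonalizable, eq_top_iff, ← htop]
  refine sSup_le fun U hU => ?_
  obtain ⟨c, hc⟩ := h U hU
  exact le_iSup_of_le c fun x hx => mem_eigenspace.2 (hc x hx)

lemma comm_of_forall {f g : L ≃ₗ⁅ℂ⁆ L} {Γ : Set (Submodule ℂ L)} (htop : sSup Γ = ⊤)
    (hf : ∀ U ∈ Γ, ∃ c : ℂ, ∀ x ∈ U, f x = c • x) (hg : ∀ U ∈ Γ, ∃ c : ℂ, ∀ x ∈ U, g x = c • x)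
    (x : L) : f (g x) = g (f x) := by
  refine sSup_induction_on htop (LinearMap.eqLocus
    ((f.toLinearEquiv : L →ₗ[ℂ] L) ∘ₗ (g.toLinearEquiv : L →ₗ[ℂ] L))
    ((g.toLinearEquiv : L →ₗ[ℂ] L) ∘ₗ (f.toLinearEquiv : L →ₗ[ℂ] L))) (fun U hU x hx => ?_) x
  obtain ⟨c, hc⟩ := hf U hU
  obtain ⟨d, hd⟩ := hg U hU
  change f (g x) = g (f x)
  rw [hc x hx, hd x hx, map_smul, map_smul, hc x hx, hd x hx, smul_comm]

lemma isToral_diagGroup {Γ : Set (Submodule ℂ L)} (htop : sSup Γ = ⊤) : IsToral (diagGroup Γ) :=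
  ⟨fun _ hg => isDiagonalizable_of_forall htop hg,
    fun _ hf _ hg x => comm_of_forall htop hf hg x⟩

/-- The automorphism by which a character of the grading group acts. -/
lemma exists_automorphism_of_character {Γ : Set (Submodule ℂ L)} (hΓ : IsGrading Γ) {G : Type*}
    [CommGroup G] {deg : Submodule ℂ L → G}
    (hdeg : ∀ U ∈ Γ, ∀ V ∈ Γ, ¬ BracketLE U V ⊥ →
      ∃ W ∈ Γ, deg W = deg U * deg V ∧ BracketLE U V W) (χ : G →* ℂˣ) :
    ∃ g : L ≃ₗ⁅ℂ⁆ L, ∀ U ∈ Γ, ∀ x ∈ U, g x = (χ (deg U) : ℂ) • x := by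
  obtain ⟨T, hT⟩ := exists_linearMap_of_isInternal hΓ.indep hΓ.sSup_eq_top
    fun U => (χ (deg U) : ℂ)
  obtain ⟨T', hT'⟩ := exists_linearMap_of_isInternal hΓ.indep hΓ.sSup_eq_top
    fun U => (((χ (deg U))⁻¹ : ℂˣ) : ℂ)
  have h1 : ∀ x, T' (T x) = x := fun x =>
    sSup_induction_on hΓ.sSup_eq_top (LinearMap.eqLocus (T' ∘ₗ T) LinearMap.id)
      (fun U hU x hx => by
        change T' (T x) = x
        rw [hT U hU x hx, map_smul, hT' U hU x hx, smul_smul, Units.mul_inv, one_smul]) x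
  have h2 : ∀ x, T (T' x) = x := fun x =>
    sSup_induction_on hΓ.sSup_eq_top (LinearMap.eqLocus (T ∘ₗ T') LinearMap.id)
      (fun U hU x hx => by
        change T (T' x) = x
        rw [hT' U hU x hx, map_smul, hT U hU x hx, smul_smul, Units.inv_mul, one_smul]) x
  have hlie : ∀ x y, T ⁅x, y⁆ = ⁅T x, T y⁆ := by
    intro x y
    -- The identity is linear in each variable, so it suffices to check it on homogeneous elements.
    refine sSup_induction_on hΓ.sSup_eq_top (LinearMap.eqLocus
      (T ∘ₗ (LieAlgebra.ad ℂ L x : L →ₗ[ℂ] L)) ((LieAlgebra.ad ℂ L (T x) : L →ₗ[ℂ] L) ∘ₗ T))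
      (fun V hV y hy => ?_) y
    change T ⁅x, y⁆ = ⁅T x, T y⁆
    refine sSup_induction_on hΓ.sSup_eq_top (LinearMap.eqLocus
      (T ∘ₗ ((LieModule.toEnd ℂ L L : L →ₗ[ℂ] Module.End ℂ L).flip y))
      (((LieModule.toEnd ℂ L L : L →ₗ[ℂ] Module.End ℂ L).flip (T y)) ∘ₗ T)) (fun U hU x hx => ?_) x
    change T ⁅x, y⁆ = ⁅T x, T y⁆
    rw [hT U hU x hx, hT V hV y hy, smul_lie, lie_smul, smul_smul]
    by_cases hb : BracketLE U V ⊥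
    · have := (Submodule.mem_bot ℂ).1 (hb x hx y hy)
      simp [this]
    · obtain ⟨W, hW, hd, hle⟩ := hdeg U hU V hV hb
      rw [hT W hW _ (hle x hx y hy), hd, map_mul, Units.val_mul]
  let e : L ≃ₗ[ℂ] L := LinearEquiv.ofLinearMap T T' (LinearMap.ext h2) (LinearMap.ext h1)
  exact ⟨{ e with map_lie' := fun {x y} => hlie x y }, hT⟩

/-- Each piece lies in one joint eigenspace, and the automorphisms defined by characters of the
grading group separate the pieces, so no joint eigenspace contains more than one of them. -/
lemma Gr_diagGroup {Γ : Set (Submodule ℂ L)} (hΓ : IsGroupGrading Γ) : Gr (diagGroup Γ) = Γ := by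
  classical
  obtain ⟨hg, G, _, deg, hinj, hdeg⟩ := hΓ
  symm
  have hT := isToral_diagGroup hg.sSup_eq_top
  refine eq_of_subset_of_sSupIndep (fun U hU => ?_) hg.sSup_eq_top hT.sSupIndep_Gr
    fun U hU => hU.1
  have hc : ∀ g : L ≃ₗ⁅ℂ⁆ L, ∃ c : ℂ, g ∈ diagGroup Γ → ∀ x ∈ U, g x = c • x := by
    intro g
    by_cases h : g ∈ diagGroup Γ
    · obtain ⟨c, hc⟩ := h U hU
      exact ⟨c, fun _ => hc⟩
    · exact ⟨0, fun h' => absurd h' h⟩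
  choose c hc using hc
  refine ⟨hg.ne_bot U hU, c, le_antisymm (fun x hx => mem_iInf_eigenspace.2 fun g h => hc g h x hx)
    fun x hx => ?_⟩
  -- decompose `x` as a sum of a component in `U` and a component in the sum of the others
  have hx' : x ∈ U ⊔ sSup (Γ \ {U}) := by
    have : U ⊔ sSup (Γ \ {U}) = ⊤ := by
      rw [eq_top_iff, ← hg.sSup_eq_top]
      refine sSup_le fun W hW => ?_
      by_cases hWU : W = U
      · rw [hWU]; exact le_sup_left
      · exact le_sup_of_le_right (le_sSup ⟨hW, hWU⟩)
    rw [this]; trivial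
  obtain ⟨y, hy, z, hz, rfl⟩ := Submodule.mem_sup.1 hx'
  have hz' : z ∈ ⨅ g ∈ diagGroup Γ, eigenspace g (c g) := by
    have hyU : y ∈ ⨅ g ∈ diagGroup Γ, eigenspace g (c g) :=
      mem_iInf_eigenspace.2 fun g h => hc g h y hy
    simpa using Submodule.sub_mem _ hx hyU
  suffices z = 0 by simpa [this] using hy
  have hind : iSupIndep fun W : (Γ \ {U} : Set (Submodule ℂ L)) => (W : Submodule ℂ L) :=
    (sSupIndep_iff _).1 (hg.indep.mono Set.sdiff_subset)
  rw [sSup_eq_iSup', Submodule.mem_iSup_iff_exists_dfinsupp'] at hz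
  obtain ⟨s, rfl⟩ := hz
  have hs : ∀ W, s W = 0 := by
    intro W
    by_contra hW
    have hne : deg W * (deg U)⁻¹ ≠ 1 := by
      rw [ne_eq, mul_inv_eq_one]
      exact fun e => W.2.2 (hinj W.2.1 hU e)
    obtain ⟨χ, hχ⟩ := exists_unitsHom_ne_one hne
    obtain ⟨g, hgχ⟩ := exists_automorphism_of_character hg hdeg χ
    have hgm : g ∈ diagGroup Γ := fun V hV => ⟨_, hgχ V hV⟩
    have hcg : c g = χ (deg U) := by
      obtain ⟨u, hu, hu0⟩ := (Submodule.ne_bot_iff U).1 (hg.ne_bot U hU)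
      have := hc g hgm u hu
      rw [hgχ U hU u hu] at this
      exact (smul_left_injective ℂ hu0 this).symm
    have h1 := mem_iInf_eigenspace.1 hz' g hgm
    -- `φ` describes g - c g on components. It kills z, hence every component of z by independence,
    -- while its factor on W is nonzero by the choice of χ.
    let φ : ∀ V : (Γ \ {U} : Set (Submodule ℂ L)), V.1 → V.1 :=
      fun V x => ((χ (deg V.1) : ℂ) - c g) • x
    have hφ : ∀ V, φ V 0 = 0 := fun V => smul_zero _
    have h2 : (s.mapRange φ hφ).sum (fun _ x => (x : L)) = 0 := by
      rw [DFinsupp.sum_mapRange_index (by simp)]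
      rw [DFinsupp.sum] at h1 ⊢
      rw [map_sum, Finset.smul_sum, ← sub_eq_zero, ← Finset.sum_sub_distrib] at h1
      rw [← h1]
      refine Finset.sum_congr rfl fun V _ => ?_
      rw [hgχ V V.2.1 _ (s V).2]
      simp [sub_smul, φ]
    have h3 : s.mapRange φ hφ = 0 := by
      apply hind.dfinsupp_lsum_injective
      rw [map_zero, ← h2, DFinsupp.lsum_apply_apply, DFinsupp.sumAddHom_apply]
      rfl
    have h4 := DFunLike.congr_fun h3 W
    rw [DFinsupp.mapRange_apply, DFinsupp.zero_apply] at h4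
    rcases smul_eq_zero.1 h4 with h4 | h4
    · apply hχ
      rw [map_mul, map_inv, mul_inv_eq_one]
      exact Units.ext ((sub_eq_zero.1 h4).trans hcg)
    · exact hW h4
  have : s = 0 := DFinsupp.ext hs
  rw [this, DFinsupp.sum_zero_index]

lemma IsRefinement.antisymm {Γ Δ : Set (Submodule ℂ L)} (hΓ : sSupIndep Γ)
    (hΔ : sSupIndep Δ) (hΓ0 : ∀ U ∈ Γ, U ≠ ⊥) (hΔ0 : ∀ U ∈ Δ, U ≠ ⊥)
    (h1 : ∀ V ∈ Δ, ∃ U ∈ Γ, V ≤ U) (h2 : ∀ V ∈ Γ, ∃ U ∈ Δ, V ≤ U) : Δ = Γ := by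
  have key : ∀ {Γ Δ : Set (Submodule ℂ L)}, sSupIndep Δ → (∀ U ∈ Δ, U ≠ ⊥) →
      (∀ V ∈ Δ, ∃ U ∈ Γ, V ≤ U) → (∀ V ∈ Γ, ∃ U ∈ Δ, V ≤ U) → Δ ⊆ Γ := by
    intro Γ Δ hΔ hΔ0 h1 h2 V hV
    obtain ⟨U, hU, hVU⟩ := h1 V hV
    obtain ⟨W, hW, hUW⟩ := h2 U hU
    obtain ⟨x, hx, hx0⟩ := (Submodule.ne_bot_iff V).1 (hΔ0 V hV)
    have := eq_of_mem_of_sSupIndep hΔ hV hW hx0 hx (hUW (hVU hx))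
    rw [show V = U from hVU.antisymm (this ▸ hUW)]
    exact hU
  exact (key hΔ hΔ0 h1 h2).antisymm (key hΓ hΓ0 h2 h1)

lemma exists_le_of_subset {𝒮 𝒯 : Set (L ≃ₗ⁅ℂ⁆ L)} (h : 𝒯 ⊆ 𝒮) :
    ∀ V ∈ Gr 𝒮, ∃ U ∈ Gr 𝒯, V ≤ U := by
  rintro V ⟨hV, χ, rfl⟩
  have hle : (⨅ g ∈ 𝒮, eigenspace g (χ g)) ≤ ⨅ g ∈ 𝒯, eigenspace g (χ g) :=
    biInf_mono h
  exact ⟨_, ⟨fun h0 => hV (le_bot_iff.1 (h0 ▸ hle)), χ, rfl⟩, hle⟩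

/-- The members of Δ not contained in U lie in other members of Γ, so an element of U has no
component in their sum. -/
lemma isRefinement_of_forall_exists {Γ Δ : Set (Submodule ℂ L)} (hΓ : sSupIndep Γ)
    (hΔ : sSup Δ = ⊤) (h : ∀ V ∈ Δ, ∃ U ∈ Γ, V ≤ U) :
    IsRefinement Δ Γ := by
  refine ⟨h, fun U hU => le_antisymm (sSup_le fun V hV => hV.2) fun x hx => ?_⟩
  have hle : sSup {V ∈ Δ | ¬ V ≤ U} ≤ sSup (Γ \ {U}) := by
    refine sSup_le fun V hV => ?_
    obtain ⟨W, hW, hVW⟩ := h V hV.1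
    refine hVW.trans (le_sSup ⟨hW, ?_⟩)
    rintro rfl
    exact hV.2 hVW
  have htop : sSup {V ∈ Δ | V ≤ U} ⊔ sSup {V ∈ Δ | ¬ V ≤ U} = ⊤ := by
    rw [eq_top_iff, ← hΔ]
    refine sSup_le fun V hV => ?_
    by_cases hVU : V ≤ U
    · exact le_sup_of_le_left (le_sSup ⟨hV, hVU⟩)
    · exact le_sup_of_le_right (le_sSup ⟨hV, hVU⟩)
  have hx' : x ∈ sSup {V ∈ Δ | V ≤ U} ⊔ sSup {V ∈ Δ | ¬ V ≤ U} := by rw [htop]; trivial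
  obtain ⟨y, hy, z, hz, rfl⟩ := Submodule.mem_sup.1 hx'
  have hyU : y ∈ U := (sSup_le fun V hV => hV.2 : sSup {V ∈ Δ | V ≤ U} ≤ U) hy
  have hzU : z ∈ U := by simpa using U.sub_mem hx hyU
  have : z = 0 := Submodule.disjoint_def.1 (hΓ hU) z hzU (hle hz)
  simpa [this] using hy

lemma mem_diagGroup_Gr_of_isMADGroup {𝒢 : Set (L ≃ₗ⁅ℂ⁆ L)} (h : IsMADGroup 𝒢)
    (htop : sSup (Gr 𝒢) = ⊤) : diagGroup (Gr 𝒢) = 𝒢 := by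
  refine Set.Subset.antisymm (fun g hg => h.maximal g (isDiagonalizable_of_forall htop hg)
    fun f hf x => ?_) (subset_diagGroup_Gr 𝒢)
  exact comm_of_forall htop (fun U hU => hg U hU) (fun U hU => exists_scalar_of_mem_Gr hU hf) x

end General

section Small

variable {L : Type} [LieRing L] [LieAlgebra ℂ L] [FiniteDimensional ℂ L]

lemma IsMADGroup.diagGroup_Gr {𝒢 : Set (L ≃ₗ⁅ℂ⁆ L)} (h : IsMADGroup 𝒢) :
    diagGroup (Gr 𝒢) = 𝒢 :=
  mem_diagGroup_Gr_of_isMADGroup h h.isToral.sSup_Gr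

/-- Adjoining a commuting diagonalizable h yields a toral set whose eigenspaces refine Γ. Fineness
makes the refinement equal to Γ, so h is already scalar on the pieces. -/
theorem IsFineGroupGrading.isMADGroup {Γ : Set (Submodule ℂ L)} (hΓ : IsFineGroupGrading Γ) :
    IsMADGroup (diagGroup Γ) := by
  have hT := isToral_diagGroup hΓ.1.1.sSup_eq_top
  refine ⟨hT.diag, hT.comm, fun h hd hc => ?_⟩
  have hT' : IsToral (insert h (diagGroup Γ)) := by
    refine ⟨fun g hg => ?_, fun f hf g hg x => ?_⟩
    · rcases hg with rfl | hg
      exacts [hd, hT.diag g hg]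
    · rcases hf with rfl | hf <;> rcases hg with rfl | hg
      exacts [rfl, hc g hg x, (hc f hf x).symm, hT.comm f hf g hg x]
  have hle := exists_le_of_subset (Set.subset_insert h (diagGroup Γ))
  rw [Gr_diagGroup hΓ.1] at hle
  have := hΓ.2 _ hT'.isGroupGrading_Gr (isRefinement_of_forall_exists hΓ.1.1.indep
    hT'.sSup_Gr hle)
  rw [← this]
  exact subset_diagGroup_Gr _ (Set.mem_insert h _)

/-- For a refinement Δ, the elements of `diagGroup Δ` commute with 𝒢 and therefore belong to it.
Hence `Gr 𝒢` conversely refines `Gr (diagGroup Δ) = Δ`. -/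
theorem IsMADGroup.isFineGroupGrading {𝒢 : Set (L ≃ₗ⁅ℂ⁆ L)} (h : IsMADGroup 𝒢) :
    IsFineGroupGrading (Gr 𝒢) := by
  refine ⟨h.isToral.isGroupGrading_Gr, fun Δ hΔ hr => ?_⟩
  have hsub : diagGroup Δ ⊆ 𝒢 := by
    intro g hg
    refine h.maximal g (isDiagonalizable_of_forall hΔ.1.sSup_eq_top hg) fun f hf x => ?_
    refine comm_of_forall hΔ.1.sSup_eq_top hg (fun V hV => ?_) x
    obtain ⟨U, hU, hVU⟩ := hr.1 V hV
    obtain ⟨c, hc⟩ := exists_scalar_of_mem_Gr hU hf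
    exact ⟨c, fun x hx => hc x (hVU hx)⟩
  have hle := exists_le_of_subset hsub
  rw [Gr_diagGroup hΔ] at hle
  exact IsRefinement.antisymm h.isToral.sSupIndep_Gr hΔ.1.indep (fun U hU => hU.1) hΔ.1.ne_bot
    hr.1 hle

end Small

/-! ### Transport along isomorphisms -/

section Transport

variable {L : Type*} [LieRing L] [LieAlgebra ℂ L]
variable {L' : Type*} [LieRing L'] [LieAlgebra ℂ L']

lemma mem_conj {f : L ≃ₗ⁅ℂ⁆ L'} {𝒢 : Set (L ≃ₗ⁅ℂ⁆ L)} {g : L' ≃ₗ⁅ℂ⁆ L'} :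
    g ∈ conj f 𝒢 ↔ (f.trans g).trans f.symm ∈ 𝒢 := by
  constructor
  · rintro ⟨k, hk, rfl⟩
    convert hk
    ext x
    simp
  · intro h
    refine ⟨_, h, ?_⟩
    ext x
    simp

lemma map_eigenspace (f : L ≃ₗ⁅ℂ⁆ L') (g : L ≃ₗ⁅ℂ⁆ L) (c : ℂ) :
    (eigenspace g c).map (f.toLinearEquiv : L →ₗ[ℂ] L') =
      eigenspace ((f.symm.trans g).trans f) c := by
  ext y
  rw [mem_eigenspace]
  constructor
  · rintro ⟨x, hx, rfl⟩
    have := mem_eigenspace.1 hx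
    change f (g (f.symm (f x))) = c • f x
    rw [LieEquiv.symm_apply_apply, this, map_smul]
  · intro hy
    refine ⟨f.symm y, mem_eigenspace.2 ?_, LieEquiv.apply_symm_apply f y⟩
    apply f.injective
    change f (g (f.symm y)) = f (c • f.symm y)
    rw [map_smul, LieEquiv.apply_symm_apply]
    exact hy

lemma isDiagonalizable_conj (f : L ≃ₗ⁅ℂ⁆ L') {g : L ≃ₗ⁅ℂ⁆ L} (hg : IsDiagonalizable g) :
    IsDiagonalizable ((f.symm.trans g).trans f) := by
  rw [IsDiagonalizable] at hg ⊢
  simp_rw [← map_eigenspace]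
  rw [← Submodule.map_iSup, hg, Submodule.map_top, LinearMap.range_eq_top]
  exact f.surjective

lemma IsMADGroup.conj {𝒢 : Set (L ≃ₗ⁅ℂ⁆ L)} (h : IsMADGroup 𝒢) (f : L ≃ₗ⁅ℂ⁆ L') :
    IsMADGroup (conj f 𝒢) := by
  refine ⟨?_, ?_, fun k hk hc => ?_⟩
  · rintro _ ⟨g, hg, rfl⟩
    exact isDiagonalizable_conj f (h.diag g hg)
  · rintro _ ⟨g, hg, rfl⟩ _ ⟨k, hk, rfl⟩ x
    change f (g (f.symm (f (k (f.symm x))))) = f (k (f.symm (f (g (f.symm x)))))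
    rw [LieEquiv.symm_apply_apply, LieEquiv.symm_apply_apply, h.comm g hg k hk]
  · rw [mem_conj]
    refine h.maximal _ (isDiagonalizable_conj f.symm hk) fun g hg x => ?_
    have := hc _ ⟨g, hg, rfl⟩ (f x)
    apply f.injective
    change f (f.symm (k (f (g x)))) = f (g (f.symm (k (f x))))
    change k (f (g (f.symm (f x)))) = f (g (f.symm (k (f x)))) at this
    rw [LieEquiv.apply_symm_apply, ← this, LieEquiv.symm_apply_apply]

lemma conj_conj {L'' : Type*} [LieRing L''] [LieAlgebra ℂ L''] (f : L ≃ₗ⁅ℂ⁆ L')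
    (k : L' ≃ₗ⁅ℂ⁆ L'') (𝒢 : Set (L ≃ₗ⁅ℂ⁆ L)) : conj k (conj f 𝒢) = conj (f.trans k) 𝒢 := by
  ext g
  rw [mem_conj, mem_conj, mem_conj]
  rfl

lemma conj_symm_conj (f : L ≃ₗ⁅ℂ⁆ L') (𝒢 : Set (L ≃ₗ⁅ℂ⁆ L)) : conj f.symm (conj f 𝒢) = 𝒢 := by
  ext g
  rw [mem_conj, mem_conj]
  convert Iff.rfl
  ext x
  simp

lemma conj_conj_symm (f : L ≃ₗ⁅ℂ⁆ L') (𝒢 : Set (L' ≃ₗ⁅ℂ⁆ L')) : conj f (conj f.symm 𝒢) = 𝒢 :=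
  conj_symm_conj f.symm 𝒢

lemma Conjugate.conj {𝒢 ℋ : Set (L ≃ₗ⁅ℂ⁆ L)} (h : Conjugate 𝒢 ℋ) (f : L ≃ₗ⁅ℂ⁆ L') :
    Conjugate (conj f 𝒢) (LieGrading.conj f ℋ) := by
  obtain ⟨k, rfl⟩ := h
  refine ⟨(f.symm.trans k).trans f, ?_⟩
  rw [conj_conj, conj_conj]
  congr 1
  ext x
  simp

lemma Gr_conj (f : L ≃ₗ⁅ℂ⁆ L') (𝒢 : Set (L ≃ₗ⁅ℂ⁆ L)) : Gr (conj f 𝒢) = image f (Gr 𝒢) := by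
  have key : ∀ χ : (L' ≃ₗ⁅ℂ⁆ L') → ℂ, (⨅ g ∈ conj f 𝒢, eigenspace g (χ g)) =
      (⨅ g ∈ 𝒢, eigenspace g (χ ((f.symm.trans g).trans f))).map
        (f.toLinearEquiv : L →ₗ[ℂ] L') := by
    intro χ
    ext y
    rw [mem_iInf_eigenspace]
    constructor
    · intro hy
      refine ⟨f.symm y, mem_iInf_eigenspace.2 fun g hg => f.injective ?_,
        LieEquiv.apply_symm_apply f y⟩
      change f (g (f.symm y)) = f (_ • f.symm y)
      rw [map_smul, LieEquiv.apply_symm_apply]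
      exact hy _ ⟨g, hg, rfl⟩
    · rintro ⟨x, hx, rfl⟩ _ ⟨g, hg, rfl⟩
      have := mem_iInf_eigenspace.1 hx g hg
      change f (g (f.symm (f x))) = χ ((f.symm.trans g).trans f) • f x
      rw [LieEquiv.symm_apply_apply, this, map_smul]
  have hbot : ∀ U : Submodule ℂ L, U.map (f.toLinearEquiv : L →ₗ[ℂ] L') = ⊥ ↔ U = ⊥ := fun U =>
    by
    rw [Submodule.map_eq_bot_iff]
  ext V
  constructor
  · rintro ⟨hV, χ, rfl⟩
    rw [key] at hV ⊢
    exact ⟨_, ⟨fun h => hV ((hbot _).2 h), _, rfl⟩, rfl⟩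
  · rintro ⟨U, ⟨hU, χ, rfl⟩, rfl⟩
    refine ⟨fun h => hU ((hbot _).1 h), fun g => χ ((f.trans g).trans f.symm), ?_⟩
    rw [key]
    congr! 6 with g hg
    ext x
    simp

lemma diagGroup_image (f : L ≃ₗ⁅ℂ⁆ L') (Γ : Set (Submodule ℂ L)) :
    diagGroup (image f Γ) = conj f (diagGroup Γ) := by
  ext g
  rw [mem_conj]
  constructor
  · intro h U hU
    obtain ⟨c, hc⟩ := h _ ⟨U, hU, rfl⟩
    refine ⟨c, fun x hx => f.injective ?_⟩
    rw [map_smul]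
    change f (f.symm (g (f x))) = c • f x
    rw [LieEquiv.apply_symm_apply]
    exact hc _ ⟨x, hx, rfl⟩
  · rintro h _ ⟨U, hU, rfl⟩
    obtain ⟨c, hc⟩ := h U hU
    refine ⟨c, ?_⟩
    rintro _ ⟨x, hx, rfl⟩
    have := congrArg f (hc x hx)
    change f (f.symm (g (f x))) = f (c • x) at this
    rw [LieEquiv.apply_symm_apply, map_smul] at this
    exact this

lemma HasDims.image {Γ : Set (Submodule ℂ L)} {m : Multiset ℕ} (h : HasDims Γ m)
    (f : L ≃ₗ⁅ℂ⁆ L') : HasDims (image f Γ) m := by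
  intro d
  rw [← h d]
  have hinj : Function.Injective fun U : Submodule ℂ L => U.map (f.toLinearEquiv : L →ₗ[ℂ] L') :=
    Submodule.map_injective_of_injective f.injective
  rw [← hinj.encard_image]
  congr 1
  ext V
  constructor
  · rintro ⟨⟨U, hU, rfl⟩, hd⟩
    exact ⟨U, ⟨hU, by rw [← hd]; exact (LinearEquiv.finrank_map_eq f.toLinearEquiv U).symm⟩, rfl⟩
  · rintro ⟨U, ⟨hU, hd⟩, rfl⟩
    exact ⟨⟨U, hU, rfl⟩, by rw [← hd]; exact LinearEquiv.finrank_map_eq f.toLinearEquiv U⟩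

end Transport

section Classification

variable {L : Type} [LieRing L] [LieAlgebra ℂ L] [FiniteDimensional ℂ L]

/-- `Gr` and `diagGroup` are mutually inverse between MAD-groups and fine group gradings, and both
are compatible with the action of automorphisms. -/
lemma IsCompleteMADList.isCompleteFineList {n : ℕ} {𝒢 : Fin n → Set (L ≃ₗ⁅ℂ⁆ L)}
    (h : IsCompleteMADList 𝒢) : IsCompleteFineList fun i => Gr (𝒢 i) := by
  refine ⟨fun i => (h.isMAD i).isFineGroupGrading, fun i j hij => ?_, fun Δ hΔ => ?_⟩
  · rintro ⟨k, hk⟩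
    refine h.not_conjugate i j hij ⟨k, ?_⟩
    rw [← (h.isMAD i).diagGroup_Gr, ← diagGroup_image, hk, (h.isMAD j).diagGroup_Gr]
  · obtain ⟨i, k, hk⟩ := h.complete _ hΔ.isMADGroup
    refine ⟨i, k, ?_⟩
    rw [← hk, Gr_conj, Gr_diagGroup hΔ.1]

end Classification

section Transport

variable {L : Type*} [LieRing L] [LieAlgebra ℂ L]
variable {L' : Type*} [LieRing L'] [LieAlgebra ℂ L']

lemma IsCompleteMADList.conj {n : ℕ} {𝒢 : Fin n → Set (L ≃ₗ⁅ℂ⁆ L)}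
    (h : IsCompleteMADList 𝒢) (f : L ≃ₗ⁅ℂ⁆ L') :
    IsCompleteMADList fun i => LieGrading.conj f (𝒢 i) := by
  refine ⟨fun i => (h.isMAD i).conj f, fun i j hij hc => h.not_conjugate i j hij ?_,
    fun ℋ hℋ => ?_⟩
  · have := hc.conj f.symm
    rwa [conj_symm_conj, conj_symm_conj] at this
  · obtain ⟨i, hi⟩ := h.complete _ (hℋ.conj f.symm)
    have := hi.conj f
    rw [conj_conj_symm] at this
    exact ⟨i, this⟩

end Transport

/-! ### Transport of Cartan gradings -/

section Cartan

variable {L : Type*} [LieRing L] [LieAlgebra ℂ L]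
variable {L' : Type*} [LieRing L'] [LieAlgebra ℂ L']

lemma isCartanSubalgebra_map (f : L ≃ₗ⁅ℂ⁆ L') (H : LieSubalgebra ℂ L) (hH : H.IsCartanSubalgebra) :
    (H.map f.toLieHom).IsCartanSubalgebra := by
  refine ⟨?_, ?_⟩
  · have : LieRing.IsNilpotent H := hH.nilpotent
    exact ((LieEquiv.lieSubalgebraMap H f).nilpotent_iff_equiv_nilpotent).1 this
  · refine le_antisymm ?_ (LieSubalgebra.le_normalizer _)
    intro y hy
    rw [LieSubalgebra.mem_normalizer_iff] at hy
    have : f.symm y ∈ H.normalizer := by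
      rw [LieSubalgebra.mem_normalizer_iff]
      intro x hx
      obtain ⟨z, hz, hz'⟩ := hy (f x) ⟨x, hx, rfl⟩
      have h1 : f ⁅f.symm y, x⁆ = f z := by
        rw [LieEquiv.map_lie, LieEquiv.apply_symm_apply]
        exact hz'.symm
      rw [f.injective h1]
      exact hz
    rw [hH.self_normalizing] at this
    exact ⟨f.symm y, this, LieEquiv.apply_symm_apply f y⟩

/-- `f` intertwines all powers of ad x - c and ad (f x) - c. The weight is a function on all of L',
which avoids moving functions between the two subalgebras. -/
lemma map_rootSpace (f : L ≃ₗ⁅ℂ⁆ L') (H : LieSubalgebra ℂ L) [LieRing.IsNilpotent H]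
    (H' : LieSubalgebra ℂ L') [LieRing.IsNilpotent H'] (hH' : H' = H.map f.toLieHom)
    (χ : L' → ℂ) :
    (LieAlgebra.rootSpace H fun x => χ (f x)).toSubmodule.map (f.toLinearEquiv : L →ₗ[ℂ] L') =
      (LieAlgebra.rootSpace H' fun x => χ x).toSubmodule := by
  have key : ∀ (x : H) (hx : f x ∈ H') (m : L) (c : ℂ) (k : ℕ),
      ((LieModule.toEnd ℂ H' L' ⟨f x, hx⟩ - c • 1) ^ k) (f m) =
        f (((LieModule.toEnd ℂ H L x - c • 1) ^ k) m) := by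
    intro x hx m c k
    induction k with
    | zero => simp
    | succ k ih =>
      rw [pow_succ', pow_succ', Module.End.mul_apply, ih, Module.End.mul_apply]
      generalize ((LieModule.toEnd ℂ H L x - c • 1) ^ k) m = n
      change ⁅f x, f n⁆ - c • f n = f (⁅(x : L), n⁆ - c • n)
      rw [map_sub, LieEquiv.map_lie, map_smul]
  have hmem : ∀ x : H, f x ∈ H' := fun x => hH' ▸ ⟨x, x.2, rfl⟩
  ext y
  rw [LieSubmodule.mem_toSubmodule, LieModule.mem_genWeightSpace]
  constructor
  · rintro ⟨m, hm, rfl⟩ ⟨z, hz⟩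
    rw [SetLike.mem_coe, LieSubmodule.mem_toSubmodule, LieModule.mem_genWeightSpace] at hm
    obtain ⟨x, hx, hxz⟩ : z ∈ H.map f.toLieHom := hH' ▸ hz
    obtain rfl : f x = z := hxz
    obtain ⟨k, hk⟩ := hm ⟨x, hx⟩
    refine ⟨k, ?_⟩
    have := key ⟨x, hx⟩ hz m (χ (f x)) k
    rw [hk, map_zero] at this
    exact this
  · intro h
    refine ⟨f.symm y, ?_, LieEquiv.apply_symm_apply f y⟩
    rw [SetLike.mem_coe, LieSubmodule.mem_toSubmodule, LieModule.mem_genWeightSpace]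
    intro x
    obtain ⟨k, hk⟩ := h ⟨f x, hmem x⟩
    refine ⟨k, f.injective ?_⟩
    refine (key x (hmem x) _ _ k).symm.trans ?_
    rw [LieEquiv.apply_symm_apply, LieEquiv.coe_toLieHom, map_zero]
    exact hk

lemma IsCartanGrading.image {Γ : Set (Submodule ℂ L)} (h : IsCartanGrading Γ) (f : L ≃ₗ⁅ℂ⁆ L') :
    IsCartanGrading (image f Γ) := by
  classical
  obtain ⟨H, hH, rfl⟩ := h
  have hH' := isCartanSubalgebra_map f H hH
  refine ⟨_, hH', ?_⟩
  have hbot : ∀ U : Submodule ℂ L, U.map (f.toLinearEquiv : L →ₗ[ℂ] L') = ⊥ ↔ U = ⊥ := fun U => by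
    rw [Submodule.map_eq_bot_iff]
  ext V
  constructor
  · rintro ⟨U, ⟨hU, χ, rfl⟩, rfl⟩
    refine ⟨fun h => hU ((hbot _).1 h),
      fun y => if hy : f.symm y ∈ H then χ ⟨_, hy⟩ else 0, ?_⟩
    have := map_rootSpace f H _ rfl fun y => if hy : f.symm y ∈ H then χ ⟨_, hy⟩ else 0
    refine Eq.trans ?_ this
    congr! 4 with x
    simp
  · rintro ⟨hV, χ, rfl⟩
    have := map_rootSpace f H _ rfl fun y => if hy : y ∈ H.map f.toLieHom then χ ⟨y, hy⟩ else 0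
    have h2 : (fun x : H.map f.toLieHom => if hy : (x : L') ∈ H.map f.toLieHom then χ ⟨x, hy⟩ else 0)
        = χ := by
      funext x
      simp only [x.2, dif_pos]
    rw [h2] at this
    rw [← this] at hV ⊢
    exact ⟨_, ⟨fun h => hV ((hbot _).2 h), _, rfl⟩, rfl⟩

end Cartan

theorem IsClassification.conj {L : Type} [LieRing L] [LieAlgebra ℂ L] {L' : Type} [LieRing L']
    [LieAlgebra ℂ L'] [FiniteDimensional ℂ L'] {𝒢 : Fin 8 → Set (L ≃ₗ⁅ℂ⁆ L)}
    (h : IsClassification 𝒢) (f : L ≃ₗ⁅ℂ⁆ L') :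
    IsClassification fun i => LieGrading.conj f (𝒢 i) := by
  refine ⟨h.mad.conj f, (h.mad.conj f).isCompleteFineList, ?_, fun i => ?_⟩
  · rw [Gr_conj]; exact h.cartan.image f
  · rw [Gr_conj]; exact (h.hasDims i).image f

/-! ### Automorphisms of sl(4): inner, or inner after the negative transpose -/

/-- A linear endomorphism of the matrices that restricts to an automorphism of the Lie algebra of
traceless matrices. -/
structure IsSlAut {n : Type*} [Fintype n] (F : Matrix n n ℂ →ₗ[ℂ] Matrix n n ℂ) : Prop where
  lie : ∀ X Y, X.trace = 0 → Y.trace = 0 → F (X * Y - Y * X) = F X * F Y - F Y * F X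
  trace : ∀ X, X.trace = 0 → (F X).trace = 0
  inj : ∀ X, X.trace = 0 → F X = 0 → X = 0
  surj : ∀ Y : Matrix n n ℂ, Y.trace = 0 → ∃ X, X.trace = 0 ∧ F X = Y

/-- The endomorphism is conjugation by an invertible matrix on the traceless matrices. -/
def IsInner {n : Type*} [Fintype n] [DecidableEq n] (F : Matrix n n ℂ →ₗ[ℂ] Matrix n n ℂ) : Prop :=
  ∃ A B : Matrix n n ℂ, A * B = 1 ∧ B * A = 1 ∧ ∀ X, X.trace = 0 → F X = A * X * B

section Extremal

variable {n : Type*} [Fintype n]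

/-- The elements `N` for which the image of `(ad N) ^ 2` lies in the line spanned by `N`. -/
def IsExtremal (N : Matrix n n ℂ) : Prop :=
  ∀ Y : Matrix n n ℂ, Y.trace = 0 →
    ∃ c : ℂ, N * (N * Y - Y * N) - (N * Y - Y * N) * N = c • N

lemma vecMulVec_mul_mul_vecMulVec (a b : n → ℂ) (Y : Matrix n n ℂ) :
    Matrix.vecMulVec a b * Y * Matrix.vecMulVec a b = (b ⬝ᵥ Y *ᵥ a) • Matrix.vecMulVec a b := by
  rw [Matrix.vecMulVec_mul, Matrix.vecMulVec_mul_vecMulVec, ← Matrix.dotProduct_mulVec]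
  ext i j
  simp [Matrix.vecMulVec_apply]
  ring

/-- With N² = 0 the double commutator is -2 N Y N, which is a multiple of N when N has rank one. -/
lemma isExtremal_vecMulVec {a b : n → ℂ} (h : b ⬝ᵥ a = 0) : IsExtremal (Matrix.vecMulVec a b) := by
  intro Y _
  have h2 : Matrix.vecMulVec a b * Matrix.vecMulVec a b = 0 := by
    rw [Matrix.vecMulVec_mul_vecMulVec, h]
    ext i j
    simp [Matrix.vecMulVec_apply]
  refine ⟨-2 * (b ⬝ᵥ Y *ᵥ a), ?_⟩
  rw [mul_smul, ← vecMulVec_mul_mul_vecMulVec]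
  set N := Matrix.vecMulVec a b
  have h3 : N * (N * Y - Y * N) - (N * Y - Y * N) * N =
      N * N * Y - (2 : ℂ) • (N * Y * N) + Y * (N * N) := by
    rw [two_smul]; noncomm_ring
  rw [h3, h2]
  simp

lemma IsSlAut.isExtremal {F : Matrix n n ℂ →ₗ[ℂ] Matrix n n ℂ} (hF : IsSlAut F) {N : Matrix n n ℂ}
    (htr : N.trace = 0) (h : IsExtremal N) : IsExtremal (F N) := by
  intro Y hY
  obtain ⟨X, hX, rfl⟩ := hF.surj Y hY
  obtain ⟨c, hc⟩ := h X hX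
  refine ⟨c, ?_⟩
  have ht : (N * X - X * N).trace = 0 := by
    rw [Matrix.trace_sub, Matrix.trace_mul_comm, sub_self]
  rw [← hF.lie N X htr hX, ← hF.lie _ _ htr ht, hc, map_smul]

/-- A 2×2 minor of a bᵀ + a' b'ᵀ is the product of a minor of (a, a') and a minor of (b, b'), and
all minors of c dᵀ vanish. -/
lemma parallel_of_vecMulVec_add {a b a' b' c d : n → ℂ}
    (h : Matrix.vecMulVec a b + Matrix.vecMulVec a' b' = Matrix.vecMulVec c d) :
    (∀ i j, a i * a' j = a j * a' i) ∨ (∀ i j, b i * b' j = b j * b' i) := by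
  by_contra hcon
  push Not at hcon
  obtain ⟨⟨i, j, hij⟩, k, l, hkl⟩ := hcon
  have e : ∀ p q, a p * b q + a' p * b' q = c p * d q := fun p q => by
    simpa [Matrix.vecMulVec_apply] using congrFun (congrFun h p) q
  have : (a i * a' j - a j * a' i) * (b k * b' l - b l * b' k) = 0 := by
    have h1 : (a i * a' j - a j * a' i) * (b k * b' l - b l * b' k) =
        (a i * b k + a' i * b' k) * (a j * b l + a' j * b' l) -
          (a i * b l + a' i * b' l) * (a j * b k + a' j * b' k) := by ring
    rw [h1, e, e, e, e]
    ring
  rcases mul_eq_zero.1 this with h | h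
  · exact hij (sub_eq_zero.1 h)
  · exact hkl (sub_eq_zero.1 h)

lemma exists_smul_of_parallel {a a' : n → ℂ} (ha : a ≠ 0) (h : ∀ i j, a i * a' j = a j * a' i) :
    ∃ s : ℂ, a' = s • a := by
  obtain ⟨i, hi⟩ := Function.ne_iff.1 ha
  replace hi : a i ≠ 0 := hi
  refine ⟨a' i / a i, ?_⟩
  funext j
  have := h i j
  simp only [Pi.smul_apply, smul_eq_mul]
  field_simp
  linear_combination this

variable [DecidableEq n]

lemma eq_zero_of_mul_mul_eq_zero {P : Matrix n n ℂ} (h : ∀ Y, P * Y * P = 0) : P = 0 := by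
  ext i j
  have := congrFun (congrFun (h (Matrix.single j i 1)) i) j
  simpa [Matrix.mul_apply, Matrix.single_apply, ite_and] using this

/-- Subtracting a scalar matrix makes Y traceless and changes no commutator. -/
lemma IsExtremal.all {N : Matrix n n ℂ} (h : IsExtremal N) (Y : Matrix n n ℂ) :
    ∃ c : ℂ, N * (N * Y - Y * N) - (N * Y - Y * N) * N = c • N := by
  rcases isEmpty_or_nonempty n with hn | hn
  · exact ⟨0, Subsingleton.elim _ _⟩
  have hc : (Fintype.card n : ℂ) ≠ 0 := Nat.cast_ne_zero.2 Fintype.card_ne_zero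
  obtain ⟨c, hcY⟩ := h (Y - (Y.trace / Fintype.card n) • 1) (by
    rw [Matrix.trace_sub, Matrix.trace_smul, Matrix.trace_one, smul_eq_mul, div_mul_cancel₀ _ hc,
      sub_self])
  refine ⟨c, ?_⟩
  rw [← hcY]
  simp [mul_sub, sub_mul]

/-- Extremality gives (ad N)³ = 0, which forces (N - μ)³ = 0 for an eigenvalue μ; the trace gives μ
= 0. Multiplying the extremality relation by N on both sides then gives N² = 0, and the relation
becomes -2 N Y N = c N. A matrix unit Y placed at a nonzero entry of N exhibits N as a column times
a row. -/
theorem IsExtremal.exists_eq_vecMulVec {N : Matrix n n ℂ} (h : IsExtremal N) (htr : N.trace = 0) :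
    ∃ a b : n → ℂ, N = Matrix.vecMulVec a b := by
  rcases isEmpty_or_nonempty n with hn | hn
  · exact ⟨0, 0, Subsingleton.elim _ _⟩
  -- the third power of `N` vanishes
  have hnil : ∃ μ : ℂ, (N - μ • 1) * (N - μ • 1) * (N - μ • 1) = 0 := by
    obtain ⟨μ, hμ⟩ := Module.End.exists_eigenvalue N.mulVecLin
    obtain ⟨v, hv, hv0⟩ := hμ.exists_hasEigenvector
    rw [Module.End.mem_eigenspace_iff, Matrix.mulVecLin_apply] at hv
    refine ⟨μ, ?_⟩
    set P := N - μ • (1 : Matrix n n ℂ) with hP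
    have hPv : P *ᵥ v = 0 := by
      rw [hP, Matrix.sub_mulVec, hv, Matrix.smul_mulVec, Matrix.one_mulVec, sub_self]
    have h3 : ∀ Y, P * P * P * Y - 3 • (P * P * Y * P) + 3 • (P * Y * (P * P))
        - Y * (P * P * P) = 0 := by
      intro Y
      obtain ⟨c, hc⟩ := h.all Y
      have hN : N = P + μ • 1 := by rw [hP]; abel
      have : N * (N * (N * Y - Y * N) - (N * Y - Y * N) * N)
          - (N * (N * Y - Y * N) - (N * Y - Y * N) * N) * N = 0 := by
        rw [hc]; simp
      rw [← this, hN]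
      simp only [add_mul, mul_add, mul_sub, sub_mul, smul_mul_assoc, mul_smul_comm, one_mul,
        mul_one, smul_add, smul_sub]
      noncomm_ring
    -- For Y = v φᵀ with P v = 0, only the term Y P³ of the expanded (ad P)³ Y survives.
    have hY : ∀ φ : n → ℂ, Matrix.vecMulVec v φ * (P * P * P) = 0 := by
      intro φ
      have h0 : P * Matrix.vecMulVec v φ = 0 := by
        rw [Matrix.mul_vecMulVec, hPv]
        ext i j; simp [Matrix.vecMulVec_apply]
      have := h3 (Matrix.vecMulVec v φ)
      rw [mul_assoc (P * P) P, h0, mul_assoc P P (Matrix.vecMulVec v φ), h0] at this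
      simpa using this
    obtain ⟨i, hi⟩ := Function.ne_iff.1 hv0
    ext j k
    have := congrFun (congrFun (hY (Pi.single j 1)) i) k
    rw [Matrix.vecMulVec_mul] at this
    simp only [Matrix.vecMulVec_apply, Matrix.single_one_vecMul, Matrix.zero_apply] at this
    exact (mul_eq_zero.1 this).resolve_left hi
  obtain ⟨μ, hμ⟩ := hnil
  have hμ0 : μ = 0 := by
    have hni : IsNilpotent (N - μ • (1 : Matrix n n ℂ)) := ⟨3, by rw [← hμ]; noncomm_ring⟩
    have := (Matrix.isNilpotent_trace_of_isNilpotent hni).eq_zero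
    rw [Matrix.trace_sub, htr, Matrix.trace_smul, Matrix.trace_one, smul_eq_mul, zero_sub,
      neg_eq_zero] at this
    exact (mul_eq_zero.1 this).resolve_right (Nat.cast_ne_zero.2 Fintype.card_ne_zero)
  rw [hμ0, zero_smul, sub_zero] at hμ
  have h2 : N * N = 0 := by
    refine eq_zero_of_mul_mul_eq_zero fun Y => ?_
    obtain ⟨c, hc⟩ := h.all Y
    have h4 : N * (N * (N * Y - Y * N) - (N * Y - Y * N) * N) * N =
        N * N * N * Y * N - (2 : ℂ) • (N * N * Y * (N * N)) + N * Y * (N * N * N) := by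
      rw [two_smul]; noncomm_ring
    rw [hc, hμ, mul_smul_comm, smul_mul_assoc, hμ] at h4
    simpa using h4.symm
  by_cases hN : N = 0
  · exact ⟨0, 0, by rw [hN]; ext i j; simp [Matrix.vecMulVec_apply]⟩
  obtain ⟨i, hi⟩ : ∃ i, ∃ j, N i j ≠ 0 := by
    by_contra hcon
    push Not at hcon
    exact hN (by ext i j; exact hcon i j)
  obtain ⟨j, hij⟩ := hi
  obtain ⟨c, hc⟩ := h.all (Matrix.single j i 1)
  have h5 : N * (N * Matrix.single j i 1 - Matrix.single j i 1 * N)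
      - (N * Matrix.single j i 1 - Matrix.single j i 1 * N) * N =
      N * N * Matrix.single j i 1 - (2 : ℂ) • (N * Matrix.single j i 1 * N)
        + Matrix.single j i 1 * (N * N) := by
    rw [two_smul]; noncomm_ring
  rw [h5, h2, zero_mul, mul_zero, zero_sub, add_zero] at hc
  have h6 : ∀ k l, -(2 * (N k j * N i l)) = c * N k l := by
    intro k l
    have := congrFun (congrFun hc k) l
    simpa [Matrix.mul_apply, Matrix.single_apply, ite_and] using this
  have hcv : c = -(2 * N i j) := by
    have := h6 i j
    apply mul_right_cancel₀ hij
    rw [← this]; ring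
  refine ⟨fun k => N k j, fun l => N i l / N i j, ?_⟩
  ext k l
  have := h6 k l
  rw [hcv] at this
  rw [Matrix.vecMulVec_apply]
  field_simp
  linear_combination (1 / 2 : ℂ) * this

end Extremal

lemma trace_single_of_ne {n : Type*} [Fintype n] [DecidableEq n] {i j : n} (h : i ≠ j) (c : ℂ) :
    (Matrix.single i j c).trace = 0 := Matrix.trace_single_eq_of_ne i j c h

lemma single_eq_vecMulVec {n : Type*} [DecidableEq n] (i j : n) :
    Matrix.single i j (1 : ℂ) = Matrix.vecMulVec (Pi.single i 1) (Pi.single j 1) := by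
  ext k l
  simp only [Matrix.single_apply, Matrix.vecMulVec_apply, Pi.single_apply]
  by_cases hk : i = k <;> by_cases hl : j = l <;> simp [hk, hl, @eq_comm _ k i, @eq_comm _ l j]

lemma trace_mul_sub_mul {n : Type*} [Fintype n] (X Y : Matrix n n ℂ) :
    (X * Y - Y * X).trace = 0 := by
  rw [Matrix.trace_sub, Matrix.trace_mul_comm, sub_self]

lemma trace_conj {n : Type*} [Fintype n] [DecidableEq n] {A B : Matrix n n ℂ} (h : B * A = 1)
    (X : Matrix n n ℂ) : (A * X * B).trace = X.trace := by
  rw [Matrix.trace_mul_comm, ← mul_assoc, h, one_mul]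

section IsSlAut

variable {n : Type*} [Fintype n] [DecidableEq n] {F : Matrix n n ℂ →ₗ[ℂ] Matrix n n ℂ}

lemma IsSlAut.inner_comp (hF : IsSlAut F) {A B : Matrix n n ℂ} (hAB : A * B = 1)
    (hBA : B * A = 1) :
    IsSlAut ((LinearMap.mulLeft ℂ A ∘ₗ LinearMap.mulRight ℂ B) ∘ₗ F) := by
  have e : ∀ X, ((LinearMap.mulLeft ℂ A ∘ₗ LinearMap.mulRight ℂ B) ∘ₗ F) X = A * F X * B := by
    intro X; simp [mul_assoc]
  refine ⟨fun X Y hX hY => ?_, fun X hX => ?_, fun X hX h => ?_, fun Y hY => ?_⟩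
  · rw [e, e, e, hF.lie X Y hX hY]
    have : ∀ P Q : Matrix n n ℂ, A * P * B * (A * Q * B) = A * (P * Q) * B := fun P Q => by
      rw [show A * P * B * (A * Q * B) = A * P * (B * A) * Q * B by noncomm_ring, hBA, mul_one,
        mul_assoc A P Q]
    rw [this, this, mul_sub, sub_mul]
  · rw [e, trace_conj hBA, hF.trace X hX]
  · rw [e] at h
    refine hF.inj X hX ?_
    have : B * (A * F X * B) * A = 0 := by rw [h]; simp
    rwa [show B * (A * F X * B) * A = (B * A) * F X * (B * A) by noncomm_ring, hBA, one_mul,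
      mul_one] at this
  · obtain ⟨X, hX, hFX⟩ := hF.surj (B * Y * A) (by rw [trace_conj hAB, hY])
    refine ⟨X, hX, ?_⟩
    rw [e, hFX, show A * (B * Y * A) * B = (A * B) * Y * (A * B) by noncomm_ring, hAB, one_mul,
      mul_one]

lemma IsInner.of_inner_comp {A B : Matrix n n ℂ} (hAB : A * B = 1)
    (hBA : B * A = 1)
    (h : IsInner ((LinearMap.mulLeft ℂ A ∘ₗ LinearMap.mulRight ℂ B) ∘ₗ F)) : IsInner F := by
  obtain ⟨C, D, hCD, hDC, h⟩ := h
  refine ⟨B * C, D * A, ?_, ?_, fun X hX => ?_⟩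
  · rw [show B * C * (D * A) = B * (C * D) * A by noncomm_ring, hCD, mul_one, hBA]
  · rw [show D * A * (B * C) = D * (A * B) * C by noncomm_ring, hAB, mul_one, hDC]
  · have := h X hX
    have e : ((LinearMap.mulLeft ℂ A ∘ₗ LinearMap.mulRight ℂ B) ∘ₗ F) X = A * F X * B := by
      simp [mul_assoc]
    rw [e] at this
    rw [show B * C * X * (D * A) = B * (C * X * D) * A by noncomm_ring, ← this,
      show B * (A * F X * B) * A = (B * A) * F X * (B * A) by noncomm_ring, hBA, one_mul, mul_one]

lemma IsSlAut.neg_transpose (hF : IsSlAut F) :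
    IsSlAut (-(Matrix.transposeLinearEquiv n n ℂ ℂ : Matrix n n ℂ →ₗ[ℂ] Matrix n n ℂ) ∘ₗ F) := by
  have e : ∀ X, (-(Matrix.transposeLinearEquiv n n ℂ ℂ : Matrix n n ℂ →ₗ[ℂ] Matrix n n ℂ) ∘ₗ F) X
      = -(F X)ᵀ := fun X => rfl
  refine ⟨fun X Y hX hY => ?_, fun X hX => ?_, fun X hX h => ?_, fun Y hY => ?_⟩
  · rw [e, e, e, hF.lie X Y hX hY, Matrix.transpose_sub, Matrix.transpose_mul, Matrix.transpose_mul]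
    noncomm_ring
  · rw [e, Matrix.trace_neg, Matrix.trace_transpose, hF.trace X hX, neg_zero]
  · rw [e, neg_eq_zero, Matrix.transpose_eq_zero] at h
    exact hF.inj X hX h
  · obtain ⟨X, hX, hFX⟩ := hF.surj (-Yᵀ) (by simpa using hY)
    exact ⟨X, hX, by rw [e, hFX]; simp⟩

end IsSlAut

/-- The matrices that are zero outside the first row and are zero in the first diagonal place. -/
def InRow (Z : Matrix (Fin 4) (Fin 4) ℂ) : Prop := ∀ i j, (i ≠ 0 ∨ j = 0) → Z i j = 0

lemma InRow.trace {Z : Matrix (Fin 4) (Fin 4) ℂ} (h : InRow Z) : Z.trace = 0 := by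
  simp [Matrix.trace, h 0 0, Fin.sum_univ_four, h 1 1, h 2 2, h 3 3]

lemma InRow.eq_sum {Z : Matrix (Fin 4) (Fin 4) ℂ} (h : InRow Z) :
    Z = Z 0 1 • Matrix.single 0 1 1 + Z 0 2 • Matrix.single 0 2 1 +
      Z 0 3 • Matrix.single 0 3 (1 : ℂ) := by
  ext i j
  fin_cases i <;> fin_cases j <;> simp [h 0 0, h 1 0, h 1 1, h 1 2, h 1 3, h 2 0,
    h 2 1, h 2 2, h 2 3, h 3 0, h 3 1, h 3 2, h 3 3]

/-- The span of the E_0j, j ≠ 0, is its own centralizer in sl(4): commuting with it leaves a scalar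
plus a row, and the trace removes the scalar. -/
lemma inRow_of_commute {Z : Matrix (Fin 4) (Fin 4) ℂ} (htr : Z.trace = 0)
    (h : ∀ j : Fin 4, j ≠ 0 → Z * Matrix.single 0 j 1 - Matrix.single 0 j 1 * Z = 0) : InRow Z := by
  have e : ∀ j : Fin 4, j ≠ 0 → ∀ k l, (if l = j then Z k 0 else 0) = if k = 0 then Z j l else 0 := by
    intro j hj k l
    have := congrFun (congrFun (h j hj) k) l
    rw [Matrix.sub_apply, Matrix.zero_apply, sub_eq_zero] at this
    simpa [Matrix.mul_apply, Matrix.single_apply, ite_and, @eq_comm _ j l, @eq_comm _ (0 : Fin 4) k] using this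
  have h1 : ∀ k : Fin 4, k ≠ 0 → Z k 0 = 0 := fun k hk => by
    simpa [hk] using e 1 (by decide) k 1
  have h2 : ∀ j l : Fin 4, j ≠ 0 → l ≠ j → Z j l = 0 := fun j l hj hl => by
    simpa [hl] using (e j hj 0 l).symm
  have h3 : ∀ j : Fin 4, j ≠ 0 → Z j j = Z 0 0 := fun j hj => by
    simpa using (e j hj 0 j).symm
  have h0 : Z 0 0 = 0 := by
    rw [Matrix.trace, Fin.sum_univ_four] at htr
    simp only [Matrix.diag_apply, h3 1 (by decide), h3 2 (by decide), h3 3 (by decide)] at htr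
    linear_combination htr / 4
  intro i j hij
  by_cases hi : i = 0
  · subst hi
    rcases hij with hij | rfl
    · exact absurd rfl hij
    · exact h0
  · by_cases hj : j = i
    · rw [hj, h3 i hi, h0]
    · exact h2 i j hi hj

/-- The traceless diagonal matrix defining the grading by the first row. -/
def rowGrade : Matrix (Fin 4) (Fin 4) ℂ := Matrix.diagonal ![3, -1, -1, -1]

lemma trace_rowGrade : rowGrade.trace = 0 := by
  simp [rowGrade, Matrix.trace, Fin.sum_univ_four]; norm_num

lemma rowGrade_mul_sub (X : Matrix (Fin 4) (Fin 4) ℂ) (i j : Fin 4) :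
    (rowGrade * X - X * rowGrade) i j =
      ((![3, -1, -1, -1] : Fin 4 → ℂ) i - (![3, -1, -1, -1] : Fin 4 → ℂ) j) * X i j := by
  simp [rowGrade, Matrix.diagonal_mul, Matrix.mul_diagonal]; ring

section Fixing

variable {F : Matrix (Fin 4) (Fin 4) ℂ →ₗ[ℂ] Matrix (Fin 4) (Fin 4) ℂ}

lemma IsSlAut.apply_of_inRow (hfix : ∀ j : Fin 4, j ≠ 0 → F (Matrix.single 0 j 1) = Matrix.single 0 j 1)
    {Z : Matrix (Fin 4) (Fin 4) ℂ} (h : InRow Z) : F Z = Z := by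
  rw [h.eq_sum]
  simp only [map_add, map_smul, hfix 1 (by decide), hfix 2 (by decide), hfix 3 (by decide)]

/-- Since F fixes both E_0j and [X, E_0j], the difference F X - X commutes with every E_0j. -/
lemma IsSlAut.inRow_sub (hF : IsSlAut F)
    (hfix : ∀ j : Fin 4, j ≠ 0 → F (Matrix.single 0 j 1) = Matrix.single 0 j 1)
    {X : Matrix (Fin 4) (Fin 4) ℂ} (hX : X.trace = 0)
    (h : ∀ j : Fin 4, j ≠ 0 → F (X * Matrix.single 0 j 1 - Matrix.single 0 j 1 * X) =
      X * Matrix.single 0 j 1 - Matrix.single 0 j 1 * X) : InRow (F X - X) := by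
  refine inRow_of_commute (by rw [Matrix.trace_sub, hF.trace X hX, hX, sub_zero]) fun j hj => ?_
  have h1 := h j hj
  rw [hF.lie X _ hX (trace_single_of_ne hj.symm 1), hfix j hj] at h1
  rw [sub_mul, mul_sub]
  rw [← sub_eq_zero] at h1
  rw [← h1]; abel

/-- F X - X lies in the first row, where ad `rowGrade` is 4, and is also annihilated by ad
`rowGrade` - c. -/
lemma IsSlAut.eq_of_grade (hF : IsSlAut F)
    (hfix : ∀ j : Fin 4, j ≠ 0 → F (Matrix.single 0 j 1) = Matrix.single 0 j 1)
    (hg : F rowGrade = rowGrade) {X : Matrix (Fin 4) (Fin 4) ℂ} (hX : X.trace = 0) {c : ℂ}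
    (hc : c ≠ 4) (hXc : rowGrade * X - X * rowGrade = c • X)
    (h : ∀ j : Fin 4, j ≠ 0 → F (X * Matrix.single 0 j 1 - Matrix.single 0 j 1 * X) =
      X * Matrix.single 0 j 1 - Matrix.single 0 j 1 * X) : F X = X := by
  have hrow := hF.inRow_sub hfix hX h
  have h1 : rowGrade * F X - F X * rowGrade = c • F X := by
    have := hF.lie rowGrade X trace_rowGrade hX
    rw [hXc, map_smul, hg] at this
    exact this.symm
  have h2 : ∀ i j, (rowGrade * (F X - X) - (F X - X) * rowGrade) i j = c * (F X - X) i j := by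
    intro i j
    rw [mul_sub, sub_mul, show rowGrade * F X - rowGrade * X - (F X * rowGrade - X * rowGrade) =
      (rowGrade * F X - F X * rowGrade) - (rowGrade * X - X * rowGrade) by abel, h1, hXc]
    simp [mul_sub]
  rw [← sub_eq_zero]
  ext i j
  by_cases hij : i ≠ 0 ∨ j = 0
  · exact hrow i j hij
  · push Not at hij
    obtain ⟨rfl, hj⟩ := hij
    have := h2 0 j
    rw [rowGrade_mul_sub] at this
    have hj' : (![3, -1, -1, -1] : Fin 4 → ℂ) j = -1 := by fin_cases j <;> simp at hj ⊢
    rw [hj'] at this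
    have h4 : (4 - c) * (F X - X) 0 j = 0 := by
      simp only [Matrix.cons_val_zero] at this
      linear_combination this
    exact (mul_eq_zero.1 h4).resolve_left (sub_ne_zero.2 hc.symm)

/-- Bracketing with E_0j raises the grade by 4. So fixing grade 4 (the row) implies fixing grade 0
(the diagonal blocks), which in turn implies fixing grade -4 (the column). -/
lemma IsSlAut.eq_id_of_fix (hF : IsSlAut F)
    (hfix : ∀ j : Fin 4, j ≠ 0 → F (Matrix.single 0 j 1) = Matrix.single 0 j 1)
    (hg : F rowGrade = rowGrade) {X : Matrix (Fin 4) (Fin 4) ℂ} (hX : X.trace = 0) : F X = X := by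
  have h0 : ∀ Y : Matrix (Fin 4) (Fin 4) ℂ, Y.trace = 0 → (∀ j, j ≠ 0 → Y 0 j = 0) →
      (∀ j, j ≠ 0 → Y j 0 = 0) → F Y = Y := by
    intro Y hY h1 h2
    refine hF.eq_of_grade hfix hg hY (c := 0) (by norm_num) ?_ fun j hj => ?_
    · ext k l
      rw [rowGrade_mul_sub]
      fin_cases k <;> fin_cases l <;> simp [h1, h2]
    · refine IsSlAut.apply_of_inRow hfix fun k l hkl => ?_
      by_cases hk : k = 0
      · subst hk
        have hl : l = 0 := by tauto
        subst hl
        simp [Matrix.mul_apply, Matrix.single_apply, hj, ite_and, h2 j hj]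
      · simp [Matrix.mul_apply, Matrix.single_apply, hj, ite_and, h2 k hk, Ne.symm hk]
  have hm : ∀ Y : Matrix (Fin 4) (Fin 4) ℂ, (∀ i j, (i = 0 ∨ j ≠ 0) → Y i j = 0) → F Y = Y := by
    intro Y hY
    have htr : Y.trace = 0 := by
      simp [Matrix.trace, Fin.sum_univ_four, hY 0 0, hY 1 1, hY 2 2, hY 3 3]
    refine hF.eq_of_grade hfix hg htr (c := -4) (by norm_num) ?_ fun j hj => ?_
    · ext k l
      rw [rowGrade_mul_sub]
      fin_cases k <;> fin_cases l <;> simp [hY] <;> norm_num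
    · refine h0 _ (trace_mul_sub_mul _ _) (fun l hl => ?_) (fun k hk => ?_)
      · simp [Matrix.mul_apply, Matrix.single_apply, ite_and, hY 0 0, hY j l (Or.inr hl)]
      · simp [Matrix.mul_apply, Matrix.single_apply, hj, ite_and, Ne.symm hk]
  let X₁ : Matrix (Fin 4) (Fin 4) ℂ := Matrix.of fun i j => if i = 0 ∧ j ≠ 0 then X i j else 0
  let X₂ : Matrix (Fin 4) (Fin 4) ℂ := Matrix.of fun i j => if i ≠ 0 ∧ j = 0 then X i j else 0
  have h1 : F X₁ = X₁ := IsSlAut.apply_of_inRow hfix fun i j hij => by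
    simp only [X₁, Matrix.of_apply]; rw [if_neg]; tauto
  have h2 : F X₂ = X₂ := hm _ fun i j hij => by simp only [X₂, Matrix.of_apply]; rw [if_neg]; tauto
  have h3 : F (X - X₁ - X₂) = X - X₁ - X₂ := by
    refine h0 _ ?_ (fun j hj => ?_) (fun j hj => ?_)
    · rw [Matrix.trace_sub, Matrix.trace_sub, hX]
      simp [Matrix.trace, X₁, X₂, Fin.sum_univ_four, Matrix.diag_apply]
    · simp [X₁, X₂, Matrix.sub_apply, hj]
    · simp [X₁, X₂, Matrix.sub_apply, hj]
  rw [map_sub, map_sub, h1, h2] at h3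
  simpa using h3

/-- F can move `rowGrade` only by an element Z of the first row. A unipotent conjugation that fixes
the E_0j undoes this, and after it F is the identity. -/
lemma IsSlAut.isInner_of_fix (hF : IsSlAut F)
    (hfix : ∀ j : Fin 4, j ≠ 0 → F (Matrix.single 0 j 1) = Matrix.single 0 j 1) : IsInner F := by
  have hrow : InRow (F rowGrade - rowGrade) := by
    refine hF.inRow_sub hfix trace_rowGrade fun j hj => IsSlAut.apply_of_inRow hfix fun k l hkl => ?_
    rw [rowGrade_mul_sub, Matrix.single_apply, if_neg, mul_zero]
    rintro ⟨rfl, rfl⟩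
    tauto
  set Z := F rowGrade - rowGrade with hZ
  have hZZ : Z * Z = 0 := by
    ext i j
    rw [Matrix.mul_apply]
    refine Finset.sum_eq_zero fun k _ => ?_
    by_cases hk : k = 0
    · rw [hrow i k (Or.inr hk), zero_mul]
    · rw [hrow k j (Or.inl hk), mul_zero]
  have hgZ : rowGrade * Z = 3 • Z := by
    ext i j
    rw [rowGrade, Matrix.diagonal_mul]
    by_cases hi : i = 0
    · subst hi; simp
    · simp [hrow i j (Or.inl hi)]
  have hZg : Z * rowGrade = -Z := by
    ext i j
    rw [rowGrade, Matrix.mul_diagonal]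
    by_cases hj : j = 0
    · simp [hrow i j (Or.inr hj)]
    · have hj' : (![3, -1, -1, -1] : Fin 4 → ℂ) j = -1 := by fin_cases j <;> simp at hj ⊢
      simp [hj']
  -- Conjugating `rowGrade` by 1 + n adds [n, `rowGrade`] = -4 n, which has to cancel Z.
  set n := (1 / 4 : ℂ) • Z with hn
  have hnn : n * n = 0 := by rw [hn, smul_mul_assoc, mul_smul_comm, hZZ]; simp
  have hAB : (1 + n) * (1 - n) = 1 := by
    rw [show (1 + n) * (1 - n) = 1 - n * n by noncomm_ring, hnn, sub_zero]
  have hBA : (1 - n) * (1 + n) = 1 := by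
    rw [show (1 - n) * (1 + n) = 1 - n * n by noncomm_ring, hnn, sub_zero]
  have hnrow : InRow n := fun i j hij => by rw [hn, Matrix.smul_apply, hrow i j hij, smul_zero]
  refine IsInner.of_inner_comp hAB hBA ⟨1, 1, by simp, by simp, fun X hX => ?_⟩
  rw [one_mul, mul_one]
  refine (hF.inner_comp hAB hBA).eq_id_of_fix (fun j hj => ?_) ?_ hX
  · simp only [LinearMap.comp_apply, hfix j hj, LinearMap.mulLeft_apply, LinearMap.mulRight_apply]
    have e1 : n * Matrix.single 0 j 1 = 0 := by
      ext k l
      simp [Matrix.mul_apply, Matrix.single_apply, ite_and, hnrow k 0]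
    have e2 : Matrix.single 0 j 1 * n = 0 := by
      ext k l
      simp [Matrix.mul_apply, Matrix.single_apply, ite_and, hnrow j l (Or.inl hj)]
    rw [mul_sub, e2, add_mul]
    simp [e1]
  · have hFg : F rowGrade = rowGrade + Z := by rw [hZ]; abel
    simp only [LinearMap.comp_apply, hFg, LinearMap.mulLeft_apply, LinearMap.mulRight_apply]
    have e1 : n * rowGrade = -n := by rw [hn, smul_mul_assoc, hZg, smul_neg]
    have e2 : rowGrade * n = 3 • n := by rw [hn, mul_smul_comm, hgZ, smul_comm]
    have e3 : Z = 4 • n := by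
      rw [hn, ← Nat.cast_smul_eq_nsmul ℂ, smul_smul]; norm_num
    rw [e3]
    have : (1 + n) * ((rowGrade + 4 • n) * (1 - n)) =
      rowGrade + 4 • n - rowGrade * n + n * rowGrade - n * (rowGrade * n) - 4 • (n * n * n) := by
      noncomm_ring
    rw [this, e1, e2, mul_smul_comm, hnn]
    simp only [smul_zero, zero_mul, sub_zero]
    abel

end Fixing

section Classification

variable {F : Matrix (Fin 4) (Fin 4) ℂ →ₗ[ℂ] Matrix (Fin 4) (Fin 4) ℂ}

/-- The rows b j, completed by a row dual to a, form an invertible matrix B with B a = e₀.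
Conjugation by B takes a (b j)ᵀ back to E_0j, which reduces to the case that F fixes the E_0j. -/
lemma IsSlAut.isInner_of_common_column (hF : IsSlAut F) (a : Fin 4 → ℂ) (b : Fin 4 → Fin 4 → ℂ)
    (h : ∀ j : Fin 4, j ≠ 0 → F (Matrix.single 0 j 1) = Matrix.vecMulVec a (b j)) : IsInner F := by
  have ha : a ≠ 0 := by
    rintro rfl
    have := hF.inj (Matrix.single 0 1 1) (trace_single_of_ne (by decide) 1) (by
      rw [h 1 (by decide)]; ext i j; simp [Matrix.vecMulVec_apply])
    simpa using congrFun (congrFun this 0) 1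
  have hba : ∀ j : Fin 4, j ≠ 0 → b j ⬝ᵥ a = 0 := by
    intro j hj
    have := hF.trace _ (trace_single_of_ne hj.symm 1)
    rwa [h j hj, Matrix.trace_vecMulVec, dotProduct_comm] at this
  obtain ⟨i, hi⟩ := Function.ne_iff.1 ha
  replace hi : a i ≠ 0 := hi
  let B : Matrix (Fin 4) (Fin 4) ℂ := Function.update b 0 (Pi.single i (a i)⁻¹)
  have hB0 : B 0 = Pi.single i (a i)⁻¹ := Function.update_self ..
  have hBj : ∀ j : Fin 4, j ≠ 0 → B j = b j := fun j hj => Function.update_of_ne hj ..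
  have hBa : B *ᵥ a = Pi.single 0 1 := by
    funext j
    by_cases hj : j = 0
    · subst hj
      simp [Matrix.mulVec, hB0, hi]
    · simp [Matrix.mulVec, hBj j hj, hba j hj, hj]
  have hinj : ∀ x : Fin 4 → ℂ, x ᵥ* B = 0 → x = 0 := by
    intro x hx
    have h0 : x 0 = 0 := by
      have : x ᵥ* B ⬝ᵥ a = 0 := by rw [hx, zero_dotProduct]
      rw [← Matrix.dotProduct_mulVec, hBa] at this
      simpa using this
    -- F sends the matrix with first row x to a times x B = 0, so x = 0 by injectivity of F.
    have hZ : InRow (Matrix.vecMulVec (Pi.single 0 1) x) := by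
      rintro k l (hk | rfl)
      · simp [Matrix.vecMulVec_apply, hk]
      · simp [Matrix.vecMulVec_apply, h0]
    have := hF.inj _ hZ.trace (by
      rw [hZ.eq_sum]
      simp only [map_add, map_smul, h 1 (by decide), h 2 (by decide), h 3 (by decide)]
      ext k l
      have := congrFun hx l
      simp [Matrix.vecMul, dotProduct, Fin.sum_univ_four, h0, hBj] at this
      simp [Matrix.vecMulVec_apply]
      linear_combination a k * this)
    funext j
    simpa [Matrix.vecMulVec_apply] using congrFun (congrFun this 0) j
  have hunit : IsUnit B := by
    rw [← Matrix.vecMul_injective_iff_isUnit]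
    intro x y hxy
    have := hinj (x - y) (by rw [Matrix.sub_vecMul]; exact sub_eq_zero.2 hxy)
    exact sub_eq_zero.1 this
  obtain ⟨u, hu⟩ := hunit
  have hBA : B * (↑u⁻¹ : Matrix (Fin 4) (Fin 4) ℂ) = 1 := by rw [← hu, Units.mul_inv]
  have hAB : (↑u⁻¹ : Matrix (Fin 4) (Fin 4) ℂ) * B = 1 := by rw [← hu, Units.inv_mul]
  refine IsInner.of_inner_comp hBA hAB ((hF.inner_comp hBA hAB).isInner_of_fix fun j hj => ?_)
  simp only [LinearMap.comp_apply, h j hj, LinearMap.mulLeft_apply, LinearMap.mulRight_apply]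
  rw [Matrix.vecMulVec_mul, Matrix.mul_vecMulVec, single_eq_vecMulVec]
  congr 1
  have : b j = Pi.single j 1 ᵥ* B := by
    rw [Matrix.single_one_vecMul]; exact (hBj j hj).symm
  rw [this, Matrix.vecMul_vecMul, hBA, Matrix.vecMul_one]

/-- The images of the E_0j and of their pairwise sums are extremal, hence of rank at most one. So
any two images share their column direction or their row direction, never both, and all three share
the same kind. A common column means inner; a common row becomes a common column after
transposition. -/
theorem IsSlAut.isInner_or (hF : IsSlAut F) : IsInner F ∨ IsInner
    (-(Matrix.transposeLinearEquiv (Fin 4) (Fin 4) ℂ ℂ :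
      Matrix (Fin 4) (Fin 4) ℂ →ₗ[ℂ] Matrix (Fin 4) (Fin 4) ℂ) ∘ₗ F) := by
  have hex : ∀ φ : Fin 4 → ℂ, φ 0 = 0 →
      ∃ a b : Fin 4 → ℂ, F (Matrix.vecMulVec (Pi.single 0 1) φ) = Matrix.vecMulVec a b := by
    intro φ hφ
    have htr : (Matrix.vecMulVec (Pi.single 0 1) φ).trace = 0 := by
      rw [Matrix.trace_vecMulVec]; simp [hφ]
    exact (hF.isExtremal htr (isExtremal_vecMulVec (by simp [hφ]))).exists_eq_vecMulVec
      (hF.trace _ htr)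
  have hj : ∀ j : Fin 4, ∃ a b : Fin 4 → ℂ, j ≠ 0 →
      F (Matrix.single 0 j 1) = Matrix.vecMulVec a b := by
    intro j
    by_cases hj : j = 0
    · exact ⟨0, 0, fun h => absurd hj h⟩
    · obtain ⟨a, b, hab⟩ := hex (Pi.single j 1) (by simp [Ne.symm hj])
      exact ⟨a, b, fun _ => by rw [single_eq_vecMulVec, hab]⟩
  choose a b hab using hj
  have hne : ∀ j : Fin 4, j ≠ 0 → Matrix.vecMulVec (a j) (b j) ≠ 0 := by
    intro j hj h0
    have := hF.inj (Matrix.single 0 j 1) (trace_single_of_ne hj.symm 1) (by rw [hab j hj, h0])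
    simpa using congrFun (congrFun this 0) j
  have ha : ∀ j : Fin 4, j ≠ 0 → a j ≠ 0 := fun j hj h0 => hne j hj (by
    rw [h0]; ext; simp [Matrix.vecMulVec_apply])
  have hb : ∀ j : Fin 4, j ≠ 0 → b j ≠ 0 := fun j hj h0 => hne j hj (by
    rw [h0]; ext; simp [Matrix.vecMulVec_apply])
  have hpar : ∀ j k : Fin 4, j ≠ 0 → k ≠ 0 →
      (∃ s : ℂ, a k = s • a j) ∨ (∃ s : ℂ, b k = s • b j) := by
    intro j k hj hk
    obtain ⟨c, d, hcd⟩ := hex (Pi.single j 1 + Pi.single k 1) (by simp [Ne.symm hj, Ne.symm hk])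
    rw [Matrix.vecMulVec_add, ← single_eq_vecMulVec, ← single_eq_vecMulVec, map_add, hab j hj,
      hab k hk] at hcd
    exact (parallel_of_vecMulVec_add hcd).imp (exists_smul_of_parallel (ha j hj))
      (exists_smul_of_parallel (hb j hj))
  have hnot : ∀ j k : Fin 4, j ≠ 0 → k ≠ 0 → j ≠ k → (∃ s : ℂ, a k = s • a j) →
      (∃ s : ℂ, b k = s • b j) → False := by
    rintro j k hj hk hjk ⟨s, hs⟩ ⟨t, ht⟩
    have := hF.inj (Matrix.single 0 k 1 - (s * t) • Matrix.single 0 j 1) (by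
      rw [Matrix.trace_sub, Matrix.trace_smul, trace_single_of_ne hk.symm,
        trace_single_of_ne hj.symm]; simp) (by
      rw [map_sub, map_smul, hab j hj, hab k hk, hs, ht]
      ext p q
      simp [Matrix.vecMulVec_apply]
      ring)
    have := congrFun (congrFun this 0) k
    simp [Matrix.single_apply, hjk] at this
  have hsymm : ∀ {u v : Fin 4 → ℂ}, v ≠ 0 → (∃ s : ℂ, v = s • u) → ∃ s : ℂ, u = s • v := by
    rintro u v hv ⟨s, rfl⟩
    have hs : s ≠ 0 := fun h => hv (by rw [h, zero_smul])
    exact ⟨s⁻¹, by rw [smul_smul, inv_mul_cancel₀ hs, one_smul]⟩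
  have htrans : ∀ {u v w : Fin 4 → ℂ}, (∃ s : ℂ, v = s • u) → (∃ s : ℂ, w = s • v) →
      ∃ s : ℂ, w = s • u := by
    rintro u v w ⟨s, rfl⟩ ⟨t, rfl⟩
    exact ⟨t * s, by rw [smul_smul]⟩
  have h1 : (1 : Fin 4) ≠ 0 := by decide
  have h2 : (2 : Fin 4) ≠ 0 := by decide
  have h3 : (3 : Fin 4) ≠ 0 := by decide
  have key : ((∃ s : ℂ, a 2 = s • a 1) ∧ ∃ s : ℂ, a 3 = s • a 1) ∨
      ((∃ s : ℂ, b 2 = s • b 1) ∧ ∃ s : ℂ, b 3 = s • b 1) := by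
    rcases hpar 1 2 h1 h2 with p | p <;> rcases hpar 1 3 h1 h3 with q | q
    · exact Or.inl ⟨p, q⟩
    -- If 1, 2 share columns and 1, 3 share rows, either choice for 2, 3 makes some pair share both.
    · exfalso
      rcases hpar 2 3 h2 h3 with r | r
      · exact hnot 1 3 h1 h3 (by decide) (htrans p r) q
      · exact hnot 1 2 h1 h2 (by decide) p (htrans q (hsymm (hb 3 h3) r))
    · exfalso
      rcases hpar 2 3 h2 h3 with r | r
      · exact hnot 1 2 h1 h2 (by decide) (htrans q (hsymm (ha 3 h3) r)) p
      · exact hnot 1 3 h1 h3 (by decide) q (htrans p r)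
    · exact Or.inr ⟨p, q⟩
  have hall : ∀ u : Fin 4 → Fin 4 → ℂ, (∃ s : ℂ, u 2 = s • u 1) → (∃ s : ℂ, u 3 = s • u 1) →
      ∀ j : Fin 4, ∃ s : ℂ, j ≠ 0 → u j = s • u 1 := by
    rintro u ⟨s, hs⟩ ⟨t, ht⟩ j
    fin_cases j
    · exact ⟨0, fun h => absurd rfl h⟩
    · exact ⟨1, fun _ => (one_smul ℂ _).symm⟩
    · exact ⟨s, fun _ => hs⟩
    · exact ⟨t, fun _ => ht⟩
  rcases key with ⟨p, q⟩ | ⟨p, q⟩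
  · left
    choose s hs using hall a p q
    refine hF.isInner_of_common_column (a 1) (fun j => s j • b j) fun j hj => ?_
    rw [hab j hj, hs j hj, Matrix.smul_vecMulVec, Matrix.vecMulVec_smul]
  · right
    choose s hs using hall b p q
    refine hF.neg_transpose.isInner_of_common_column (b 1) (fun j => -s j • a j) fun j hj => ?_
    change -(F (Matrix.single 0 j 1))ᵀ = _
    rw [hab j hj, hs j hj]
    ext k l
    simp [Matrix.vecMulVec_apply]
    ring

end Classification

/-! ### The exceptional isomorphism through skew-symmetric 4×4 matrices -/

/-- The skew-symmetric matrix with given coordinates, which are orthonormal for the Pfaffian. -/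
def skewMat (v : Fin 6 → ℂ) : Matrix (Fin 4) (Fin 4) ℂ :=
  !![0, v 0 + Complex.I * v 1, v 2 + Complex.I * v 3, v 4 + Complex.I * v 5;
    -(v 0 + Complex.I * v 1), 0, v 4 - Complex.I * v 5, -(v 2 - Complex.I * v 3);
    -(v 2 + Complex.I * v 3), -(v 4 - Complex.I * v 5), 0, v 0 - Complex.I * v 1;
    -(v 4 + Complex.I * v 5), v 2 - Complex.I * v 3, -(v 0 - Complex.I * v 1), 0]

/-- The coordinates of a skew-symmetric matrix. -/
noncomputable def skewCoord (M : Matrix (Fin 4) (Fin 4) ℂ) : Fin 6 → ℂ :=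
  ![(M 0 1 + M 2 3) / 2, -(M 0 1 - M 2 3) * Complex.I / 2, (M 0 2 - M 1 3) / 2,
    -(M 0 2 + M 1 3) * Complex.I / 2, (M 0 3 + M 1 2) / 2, -(M 0 3 - M 1 2) * Complex.I / 2]

/-- The matrix of the action `K ↦ X * K + K * Xᵀ` on the skew-symmetric matrices. -/
noncomputable def rep (X : Matrix (Fin 4) (Fin 4) ℂ) : Matrix (Fin 6) (Fin 6) ℂ :=
  !![(X 0 0 + X 1 1 + X 2 2 + X 3 3) / 2,
    (X 0 0 + X 1 1 - X 2 2 - X 3 3) * Complex.I / 2,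
    (X 0 3 + X 1 2 - X 2 1 - X 3 0) / 2,
    (-X 0 3 + X 1 2 + X 2 1 - X 3 0) * Complex.I / 2,
    (-X 0 2 + X 1 3 + X 2 0 - X 3 1) / 2,
    (X 0 2 + X 1 3 + X 2 0 + X 3 1) * Complex.I / 2;
    (-X 0 0 - X 1 1 + X 2 2 + X 3 3) * Complex.I / 2,
    (X 0 0 + X 1 1 + X 2 2 + X 3 3) / 2,
    (-X 0 3 - X 1 2 - X 2 1 - X 3 0) * Complex.I / 2,
    (-X 0 3 + X 1 2 - X 2 1 + X 3 0) / 2,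
    (X 0 2 - X 1 3 + X 2 0 - X 3 1) * Complex.I / 2,
    (X 0 2 + X 1 3 - X 2 0 - X 3 1) / 2;
    (-X 0 3 - X 1 2 + X 2 1 + X 3 0) / 2,
    (X 0 3 + X 1 2 + X 2 1 + X 3 0) * Complex.I / 2,
    (X 0 0 + X 1 1 + X 2 2 + X 3 3) / 2,
    (X 0 0 - X 1 1 + X 2 2 - X 3 3) * Complex.I / 2,
    (X 0 1 - X 1 0 + X 2 3 - X 3 2) / 2,
    (-X 0 1 - X 1 0 + X 2 3 + X 3 2) * Complex.I / 2;
    (X 0 3 - X 1 2 - X 2 1 + X 3 0) * Complex.I / 2,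
    (X 0 3 - X 1 2 + X 2 1 - X 3 0) / 2,
    (-X 0 0 + X 1 1 - X 2 2 + X 3 3) * Complex.I / 2,
    (X 0 0 + X 1 1 + X 2 2 + X 3 3) / 2,
    (-X 0 1 - X 1 0 - X 2 3 - X 3 2) * Complex.I / 2,
    (-X 0 1 + X 1 0 + X 2 3 - X 3 2) / 2;
    (X 0 2 - X 1 3 - X 2 0 + X 3 1) / 2,
    (-X 0 2 + X 1 3 - X 2 0 + X 3 1) * Complex.I / 2,
    (-X 0 1 + X 1 0 - X 2 3 + X 3 2) / 2,
    (X 0 1 + X 1 0 + X 2 3 + X 3 2) * Complex.I / 2,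
    (X 0 0 + X 1 1 + X 2 2 + X 3 3) / 2,
    (X 0 0 - X 1 1 - X 2 2 + X 3 3) * Complex.I / 2;
    (-X 0 2 - X 1 3 - X 2 0 - X 3 1) * Complex.I / 2,
    (-X 0 2 - X 1 3 + X 2 0 + X 3 1) / 2,
    (X 0 1 + X 1 0 - X 2 3 - X 3 2) * Complex.I / 2,
    (X 0 1 - X 1 0 - X 2 3 + X 3 2) / 2,
    (-X 0 0 + X 1 1 + X 2 2 - X 3 3) * Complex.I / 2,
    (X 0 0 + X 1 1 + X 2 2 + X 3 3) / 2]

/-- The traceless matrix acting on the skew-symmetric matrices by a given matrix. -/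
noncomputable def unrep (S : Matrix (Fin 6) (Fin 6) ℂ) : Matrix (Fin 4) (Fin 4) ℂ :=
  !![(-S 0 1 - S 2 3 - S 4 5) * Complex.I / 2,
    (S 2 4 - S 3 5) / 2 + (S 2 5 + S 3 4) * Complex.I / 2,
    (-S 0 4 + S 1 5) / 2 + (-S 0 5 - S 1 4) * Complex.I / 2,
    (S 0 2 - S 1 3) / 2 + (S 0 3 + S 1 2) * Complex.I / 2;
    (-S 2 4 + S 3 5) / 2 + (S 2 5 + S 3 4) * Complex.I / 2,
    (-S 0 1 + S 2 3 + S 4 5) * Complex.I / 2,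
    (S 0 2 + S 1 3) / 2 + (-S 0 3 + S 1 2) * Complex.I / 2,
    (S 0 4 + S 1 5) / 2 + (-S 0 5 + S 1 4) * Complex.I / 2;
    (S 0 4 - S 1 5) / 2 + (-S 0 5 - S 1 4) * Complex.I / 2,
    (-S 0 2 - S 1 3) / 2 + (-S 0 3 + S 1 2) * Complex.I / 2,
    (S 0 1 - S 2 3 + S 4 5) * Complex.I / 2,
    (S 2 4 + S 3 5) / 2 + (-S 2 5 + S 3 4) * Complex.I / 2;
    (-S 0 2 + S 1 3) / 2 + (S 0 3 + S 1 2) * Complex.I / 2,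
    (-S 0 4 - S 1 5) / 2 + (-S 0 5 + S 1 4) * Complex.I / 2,
    (-S 2 4 - S 3 5) / 2 + (-S 2 5 + S 3 4) * Complex.I / 2,
    (S 0 1 + S 2 3 - S 4 5) * Complex.I / 2]

lemma skewCoord_skewMat (v : Fin 6 → ℂ) : skewCoord (skewMat v) = v := by
  funext i
  fin_cases i <;> simp [skewCoord, skewMat] <;> ring_nf <;> simp only [Complex.I_sq] <;> ring_nf

lemma skewMat_injective : Function.Injective skewMat :=
  Function.LeftInverse.injective skewCoord_skewMat

lemma skewMat_skewCoord {M : Matrix (Fin 4) (Fin 4) ℂ} (h : Mᵀ = -M) : skewMat (skewCoord M) = M := by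
  have e : ∀ i j, M i j = - M j i := fun i j => by
    simpa using congrFun (congrFun h j) i
  have e0 : ∀ i, M i i = 0 := fun i => by linear_combination (1 / 2 : ℂ) * e i i
  ext i j
  fin_cases i <;> fin_cases j <;> simp [skewCoord, skewMat, e0, e 1 0, e 2 0, e 3 0, e 2 1, e 3 1, e 3 2] <;>
    ring_nf <;> simp only [Complex.I_sq] <;> ring_nf

lemma transpose_skewMat (v : Fin 6 → ℂ) : (skewMat v)ᵀ = -skewMat v := by
  ext i j
  fin_cases i <;> fin_cases j <;> simp [skewMat]

lemma skewMat_add (u w : Fin 6 → ℂ) : skewMat (u + w) = skewMat u + skewMat w := by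
  ext i j
  fin_cases i <;> fin_cases j <;> simp [skewMat] <;> ring

lemma skewMat_smul (c : ℂ) (w : Fin 6 → ℂ) : skewMat (c • w) = c • skewMat w := by
  ext i j
  fin_cases i <;> fin_cases j <;> simp [skewMat] <;> ring

lemma rep_mulVec (X : Matrix (Fin 4) (Fin 4) ℂ) (v : Fin 6 → ℂ) :
    rep X *ᵥ v = skewCoord (X * skewMat v + skewMat v * Xᵀ) := by
  have hI : Complex.I * Complex.I = -1 := Complex.I_mul_I
  funext i
  fin_cases i <;>
    simp only [skewCoord, Matrix.add_apply, Matrix.mul_apply, Matrix.transpose_apply,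
      Fin.sum_univ_four, Matrix.mulVec, dotProduct, Fin.sum_univ_six] <;>
    simp [rep, skewMat] <;>
    grind

/-- Since `skewMat` is injective, linearity of `rep` and its compatibility with brackets follow from
this identity without looking at entries. -/
lemma skewMat_rep_mulVec (X : Matrix (Fin 4) (Fin 4) ℂ) (v : Fin 6 → ℂ) :
    skewMat (rep X *ᵥ v) = X * skewMat v + skewMat v * Xᵀ := by
  rw [rep_mulVec, skewMat_skewCoord]
  rw [Matrix.transpose_add, Matrix.transpose_mul, Matrix.transpose_mul, Matrix.transpose_transpose,
    transpose_skewMat]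
  noncomm_ring

lemma matrix_eq_of_mulVec {m n : Type*} [Fintype n] [DecidableEq n] {A B : Matrix m n ℂ}
    (h : ∀ v, A *ᵥ v = B *ᵥ v) : A = B :=
  Matrix.mulVec_injective (funext h)

lemma rep_add (X Y : Matrix (Fin 4) (Fin 4) ℂ) : rep (X + Y) = rep X + rep Y := by
  refine matrix_eq_of_mulVec fun v => skewMat_injective ?_
  rw [skewMat_rep_mulVec, Matrix.add_mulVec, skewMat_add, skewMat_rep_mulVec, skewMat_rep_mulVec,
    Matrix.transpose_add]
  noncomm_ring

lemma rep_smul (c : ℂ) (X : Matrix (Fin 4) (Fin 4) ℂ) : rep (c • X) = c • rep X := by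
  refine matrix_eq_of_mulVec fun v => skewMat_injective ?_
  rw [skewMat_rep_mulVec, Matrix.smul_mulVec, skewMat_smul, skewMat_rep_mulVec, Matrix.transpose_smul]
  simp

lemma rep_mul_sub_mul (X Y : Matrix (Fin 4) (Fin 4) ℂ) :
    rep (X * Y - Y * X) = rep X * rep Y - rep Y * rep X := by
  refine matrix_eq_of_mulVec fun v => skewMat_injective ?_
  have h : ∀ u w, skewMat (u - w) = skewMat u - skewMat w := fun u w => by
    rw [sub_eq_add_neg, ← neg_one_smul ℂ w, skewMat_add, skewMat_smul, neg_one_smul, sub_eq_add_neg]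
  rw [skewMat_rep_mulVec, Matrix.sub_mulVec, h, ← Matrix.mulVec_mulVec, ← Matrix.mulVec_mulVec,
    skewMat_rep_mulVec, skewMat_rep_mulVec, skewMat_rep_mulVec, skewMat_rep_mulVec,
    Matrix.transpose_sub, Matrix.transpose_mul, Matrix.transpose_mul]
  noncomm_ring

/-- The Pfaffian is the sum of the squares of the coordinates, and traceless X preserve it
infinitesimally. -/
lemma transpose_rep {X : Matrix (Fin 4) (Fin 4) ℂ} (h : X.trace = 0) : (rep X)ᵀ = -rep X := by
  have h' : X 0 0 + X 1 1 + X 2 2 + X 3 3 = 0 := by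
    simpa [Matrix.trace, Fin.sum_univ_four] using h
  ext i j
  fin_cases i <;> fin_cases j <;> simp [rep, h'] <;> ring

lemma unrep_rep {X : Matrix (Fin 4) (Fin 4) ℂ} (h : X.trace = 0) : unrep (rep X) = X := by
  have h' : X 3 3 = - X 0 0 - X 1 1 - X 2 2 := by
    simp [Matrix.trace, Fin.sum_univ_four] at h
    linear_combination h
  ext i j
  fin_cases i <;> fin_cases j <;> simp [rep, unrep, h'] <;> ring_nf <;> simp only [Complex.I_sq] <;>
    ring_nf

lemma trace_unrep (S : Matrix (Fin 6) (Fin 6) ℂ) : (unrep S).trace = 0 := by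
  simp [Matrix.trace, Fin.sum_univ_four, unrep]
  ring

lemma eq_of_transpose_eq_neg {n : Type*} [LinearOrder n] {A B : Matrix n n ℂ} (hA : Aᵀ = -A)
    (hB : Bᵀ = -B) (h : ∀ i j, i < j → A i j = B i j) : A = B := by
  have e : ∀ {M : Matrix n n ℂ}, Mᵀ = -M → ∀ i j, M i j = - M j i := fun {M} hM i j => by
    simpa using congrFun (congrFun hM j) i
  ext i j
  rcases lt_trichotomy i j with hij | rfl | hij
  · exact h i j hij
  · linear_combination (1 / 2 : ℂ) * e hA i i - (1 / 2 : ℂ) * e hB i i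
  · rw [e hA, e hB, h j i hij]

lemma rep_unrep {S : Matrix (Fin 6) (Fin 6) ℂ} (h : Sᵀ = -S) : rep (unrep S) = S := by
  have hI : Complex.I * Complex.I = -1 := Complex.I_mul_I
  refine eq_of_transpose_eq_neg (transpose_rep (trace_unrep S)) h fun i j hij => ?_
  fin_cases i <;> fin_cases j <;> first | exact absurd hij (by decide) | skip
  all_goals simp [rep, unrep]
  all_goals grind

/-- The matrix of the operator `K ↦ A * K * Aᵀ` on the skew-symmetric matrices. -/
noncomputable def skewConj (A : Matrix (Fin 4) (Fin 4) ℂ) : Matrix (Fin 6) (Fin 6) ℂ :=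
  Matrix.of fun i j => skewCoord (A * skewMat (Pi.single j 1) * Aᵀ) i

lemma skewMat_skewConj_mulVec (A : Matrix (Fin 4) (Fin 4) ℂ) (v : Fin 6 → ℂ) :
    skewMat (skewConj A *ᵥ v) = A * skewMat v * Aᵀ := by
  let f : (Fin 6 → ℂ) →ₗ[ℂ] Matrix (Fin 4) (Fin 4) ℂ :=
    { toFun := skewMat
      map_add' := skewMat_add
      map_smul' := skewMat_smul }
  have hskew : ∀ w, (A * skewMat w * Aᵀ)ᵀ = -(A * skewMat w * Aᵀ) := fun w => by
    rw [Matrix.transpose_mul, Matrix.transpose_mul, Matrix.transpose_transpose, transpose_skewMat]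
    noncomm_ring
  have : f ∘ₗ (skewConj A).mulVecLin =
      LinearMap.mulLeft ℂ A ∘ₗ LinearMap.mulRight ℂ Aᵀ ∘ₗ f := by
    refine LinearMap.pi_ext' fun j => LinearMap.ext_ring ?_
    change skewMat (skewConj A *ᵥ Pi.single j 1) = A * (skewMat (Pi.single j 1) * Aᵀ)
    rw [← mul_assoc, ← skewMat_skewCoord (hskew _), Matrix.mulVec_single_one]
    rfl
  have := LinearMap.congr_fun this v
  rw [mul_assoc]
  exact this

lemma skewConj_mul (A B : Matrix (Fin 4) (Fin 4) ℂ) : skewConj (A * B) = skewConj A * skewConj B := by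
  refine matrix_eq_of_mulVec fun v => skewMat_injective ?_
  rw [skewMat_skewConj_mulVec, ← Matrix.mulVec_mulVec, skewMat_skewConj_mulVec,
    skewMat_skewConj_mulVec, Matrix.transpose_mul]
  noncomm_ring

lemma skewConj_one : skewConj 1 = 1 := by
  refine matrix_eq_of_mulVec fun v => skewMat_injective ?_
  rw [skewMat_skewConj_mulVec, Matrix.one_mulVec]
  simp

lemma skewConj_mul_rep {A X Y : Matrix (Fin 4) (Fin 4) ℂ} (h : A * X = Y * A) :
    skewConj A * rep X = rep Y * skewConj A := by
  refine matrix_eq_of_mulVec fun v => skewMat_injective ?_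
  rw [← Matrix.mulVec_mulVec, ← Matrix.mulVec_mulVec, skewMat_skewConj_mulVec, skewMat_rep_mulVec,
    skewMat_rep_mulVec, skewMat_skewConj_mulVec]
  have h' : Xᵀ * Aᵀ = Aᵀ * Yᵀ := by rw [← Matrix.transpose_mul, h, Matrix.transpose_mul]
  calc A * (X * skewMat v + skewMat v * Xᵀ) * Aᵀ
      = (A * X) * skewMat v * Aᵀ + A * skewMat v * (Xᵀ * Aᵀ) := by noncomm_ring
    _ = _ := by rw [h, h']; noncomm_ring

/-- The Hodge star on the skew-symmetric matrices. -/
def hodge : Matrix (Fin 6) (Fin 6) ℂ := Matrix.diagonal ![1, -1, 1, -1, 1, -1]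

lemma hodge_mul_hodge : hodge * hodge = 1 := by
  rw [hodge, Matrix.diagonal_mul_diagonal, ← Matrix.diagonal_one]
  congr 1
  funext i
  fin_cases i <;> simp

/-- The Hodge star identifies the second exterior power with its dual, so it implements the outer
automorphism X ↦ -Xᵀ. -/
lemma hodge_mul_rep {X : Matrix (Fin 4) (Fin 4) ℂ} (h : X.trace = 0) :
    hodge * rep X = rep (-Xᵀ) * hodge := by
  suffices hodge * rep X * hodge = rep (-Xᵀ) by
    rw [← this, mul_assoc, hodge_mul_hodge, mul_one]
  have ht : hodgeᵀ = hodge := Matrix.diagonal_transpose _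
  refine eq_of_transpose_eq_neg ?_ (transpose_rep (by simpa using h)) fun i j hij => ?_
  · rw [Matrix.transpose_mul, Matrix.transpose_mul, ht, transpose_rep h]
    noncomm_ring
  · rw [hodge, Matrix.mul_diagonal, Matrix.diagonal_mul]
    fin_cases i <;> fin_cases j <;> first | exact absurd hij (by decide) | skip
    all_goals simp [rep]
    all_goals ring

/-! ### Schur's lemma and irreducibility for skew-symmetric matrices -/

section Skew

variable {n : Type*} [Fintype n] [DecidableEq n]

lemma transpose_single_sub_single (i j : n) :
    (Matrix.single i j (1 : ℂ) - Matrix.single j i 1)ᵀ =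
      -(Matrix.single i j (1 : ℂ) - Matrix.single j i 1) := by
  rw [Matrix.transpose_sub, Matrix.transpose_single, Matrix.transpose_single, neg_sub]

/-- Commuting with E_ij - E_ji is compared entrywise. A third index j isolates each off-diagonal
entry of M; in size two all skew-symmetric matrices commute, so the bound is needed. -/
lemma exists_eq_smul_one_of_commute_skew (hn : 2 < Fintype.card n) {M : Matrix n n ℂ}
    (h : ∀ S : Matrix n n ℂ, Sᵀ = -S → M * S = S * M) : ∃ c : ℂ, M = c • (1 : Matrix n n ℂ) := by
  have e : ∀ i j k l, M k i * (if j = l then 1 else 0) - M k j * (if i = l then 1 else 0) =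
      (if i = k then 1 else 0) * M j l - (if j = k then 1 else 0) * M i l := by
    intro i j k l
    have := congrFun (congrFun (h _ (transpose_single_sub_single i j)) k) l
    simpa [Matrix.mul_sub, Matrix.sub_mul, Matrix.mul_apply, Matrix.single_apply, ite_and,
      mul_sub, sub_mul, Finset.sum_sub_distrib] using this
  have third : ∀ k i : n, ∃ j, j ≠ k ∧ j ≠ i := fun k i => by
    obtain ⟨j, -, hj⟩ := Finset.exists_mem_notMem_of_card_lt_card
      (s := ({k, i} : Finset n)) (t := Finset.univ) (by
        rw [Finset.card_univ]
        exact (Finset.card_le_two).trans_lt hn)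
    exact ⟨j, by simpa using hj⟩
  obtain ⟨i₀⟩ : Nonempty n := Fintype.card_pos_iff.mp (by omega)
  refine ⟨M i₀ i₀, Matrix.ext fun k i => ?_⟩
  rw [Matrix.smul_apply, Matrix.one_apply]
  split_ifs with hki
  · subst hki
    by_cases hk : k = i₀
    · rw [hk]; simp
    · have := e k i₀ k i₀
      simpa [hk, Ne.symm hk] using this
  · obtain ⟨j, hjk, hji⟩ := third k i
    have := e i j k j
    simpa [hjk, hji.symm, Ne.symm hki] using this

/-- Two generators applied in succession through a third index reduce a vector with w i ≠ 0 to a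
multiple of a basis vector. -/
lemma eq_top_of_skew_stable (hn : 2 < Fintype.card n) {E : Submodule ℂ (n → ℂ)} (hE : E ≠ ⊥)
    (h : ∀ S : Matrix n n ℂ, Sᵀ = -S → ∀ v ∈ E, S *ᵥ v ∈ E) : E = ⊤ := by
  have third : ∀ k i : n, ∃ j, j ≠ k ∧ j ≠ i := fun k i => by
    obtain ⟨j, -, hj⟩ := Finset.exists_mem_notMem_of_card_lt_card
      (s := ({k, i} : Finset n)) (t := Finset.univ) (by
        rw [Finset.card_univ]
        exact (Finset.card_le_two).trans_lt hn)
    exact ⟨j, by simpa using hj⟩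
  have e : ∀ i j, ∀ w ∈ E, (Pi.single j (w i) - Pi.single i (w j) : n → ℂ) ∈ E := by
    intro i j w hw
    have := h _ (transpose_single_sub_single j i) w hw
    rw [Matrix.sub_mulVec, Matrix.single_mulVec, Matrix.single_mulVec, one_mul, one_mul] at this
    exact this
  obtain ⟨w, hw, hw0⟩ := Submodule.exists_mem_ne_zero_of_ne_bot hE
  obtain ⟨i, hi⟩ := Function.ne_iff.mp hw0
  have h1 : ∀ k, k ≠ i → (Pi.single k 1 : n → ℂ) ∈ E := by
    intro k hk
    obtain ⟨j, hjk, hji⟩ := third k i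
    have h2 := e j k _ (e i j w hw)
    simp only [Pi.sub_apply, Pi.single_eq_same, Pi.single_eq_of_ne hji,
      Pi.single_eq_of_ne hjk.symm, Pi.single_eq_of_ne hk, sub_zero, Pi.single_zero] at h2
    have h3 := E.smul_mem (w i)⁻¹ h2
    rwa [← Pi.single_smul, smul_eq_mul, inv_mul_cancel₀ hi] at h3
  have h4 : ∀ k, (Pi.single k 1 : n → ℂ) ∈ E := by
    intro k
    by_cases hk : k = i
    · obtain ⟨j, hj, -⟩ := third i i
      have := e j i _ (h1 j hj)
      rw [hk]
      simpa [hj, hj.symm] using this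
    · exact h1 k hk
  rw [eq_top_iff]
  intro v _
  rw [pi_eq_sum_univ' v]
  exact E.sum_mem fun k _ => E.smul_mem _ (by simpa [Pi.single_apply, eq_comm] using h4 k)

end Skew

/-! ### Orthogonal lifts of the automorphisms of sl(4) -/

section Lift

attribute [local instance] LieRing.ofAssociativeRing

/-- The Lie algebra of traceless matrices of size four. -/
abbrev Sl4 : LieSubalgebra ℂ (Matrix (Fin 4) (Fin 4) ℂ) := LieAlgebra.SpecialLinear.sl (Fin 4) ℂ

lemma trace_val (X : Sl4) : X.1.trace = 0 := X.2

lemma val_lie (X Y : Sl4) : (⁅X, Y⁆ : Sl4).1 = X.1 * Y.1 - Y.1 * X.1 := rfl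

lemma val_add (X Y : Sl4) : (X + Y).1 = X.1 + Y.1 := rfl

lemma val_smul (c : ℂ) (X : Sl4) : (c • X).1 = c • X.1 := rfl

/-- The exceptional isomorphism. -/
noncomputable def slEquivSo : Sl4 ≃ₗ⁅ℂ⁆ LieAlgebra.Orthogonal.so (Fin 6) ℂ where
  toFun X := ⟨rep X.1, (LieAlgebra.Orthogonal.mem_so _ _ _).mpr (transpose_rep X.2)⟩
  map_add' X Y := Subtype.ext (rep_add X.1 Y.1)
  map_smul' c X := Subtype.ext (rep_smul c X.1)
  map_lie' {X Y} := Subtype.ext (rep_mul_sub_mul X.1 Y.1)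
  invFun S := ⟨unrep S.1, trace_unrep S.1⟩
  left_inv X := Subtype.ext (unrep_rep X.2)
  right_inv S := Subtype.ext (rep_unrep ((LieAlgebra.Orthogonal.mem_so _ _ _).mp S.2))

/-- The orthogonal matrix implements the automorphism on the skew-symmetric matrices. -/
structure IsLift (f : Sl4 ≃ₗ⁅ℂ⁆ Sl4) (G : Matrix (Fin 6) (Fin 6) ℂ) : Prop where
  orthogonal : Gᵀ * G = 1
  mul_rep : ∀ X : Sl4, G * rep X.1 = rep (f X).1 * G

variable {f g : Sl4 ≃ₗ⁅ℂ⁆ Sl4} {F G : Matrix (Fin 6) (Fin 6) ℂ}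

lemma IsLift.mul_transpose (h : IsLift f G) : G * Gᵀ = 1 := mul_eq_one_comm.mp h.orthogonal

lemma IsLift.rep_apply (h : IsLift f G) (X : Sl4) : rep (f X).1 = G * rep X.1 * Gᵀ := by
  rw [h.mul_rep, mul_assoc, h.mul_transpose, mul_one]

lemma rep_injOn {X Y : Sl4} (h : rep X.1 = rep Y.1) : X = Y :=
  Subtype.ext (by rw [← unrep_rep X.2, h, unrep_rep Y.2])

lemma exists_rep_eq {S : Matrix (Fin 6) (Fin 6) ℂ} (h : Sᵀ = -S) : ∃ X : Sl4, rep X.1 = S :=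
  ⟨⟨unrep S, trace_unrep S⟩, rep_unrep h⟩

lemma exists_eq_smul_one_of_commute_rep (h : ∀ X : Sl4, G * rep X.1 = rep X.1 * G) :
    ∃ c : ℂ, G = c • (1 : Matrix (Fin 6) (Fin 6) ℂ) :=
  exists_eq_smul_one_of_commute_skew (by simp) fun S hS => by
    obtain ⟨X, rfl⟩ := exists_rep_eq hS
    exact h X

lemma IsLift.eq_of_eq (hf : IsLift f G) (hg : IsLift g G) : f = g :=
  LieEquiv.ext fun X => rep_injOn (by rw [hf.rep_apply, hg.rep_apply])

lemma IsLift.mul (hf : IsLift f F) (hg : IsLift g G) : IsLift (g.trans f) (F * G) where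
  orthogonal := by
    rw [Matrix.transpose_mul, mul_assoc, ← mul_assoc Fᵀ, hf.orthogonal, one_mul, hg.orthogonal]
  mul_rep X := by
    rw [mul_assoc, hg.mul_rep, ← mul_assoc, hf.mul_rep, mul_assoc]
    rfl

lemma IsLift.neg (hf : IsLift f F) : IsLift f (-F) where
  orthogonal := by simpa using hf.orthogonal
  mul_rep X := by simpa using hf.mul_rep X

lemma IsLift.symm (hf : IsLift f F) : IsLift f.symm Fᵀ where
  orthogonal := by simpa using hf.mul_transpose
  mul_rep X := by
    have := hf.rep_apply (f.symm X)
    rw [LieEquiv.apply_symm_apply] at this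
    rw [this, mul_assoc F, ← mul_assoc Fᵀ, hf.orthogonal, one_mul]

/-- Gᵀ F commutes with so(6), so it is a scalar c, and orthogonality gives c² = 1. -/
lemma IsLift.eq_or_eq_neg (hF : IsLift f F) (hG : IsLift f G) : F = G ∨ F = -G := by
  obtain ⟨c, hc⟩ := exists_eq_smul_one_of_commute_rep (G := Gᵀ * F) fun X => by
    have := (hF.mul hG.symm).mul_rep
    have h2 := (hG.symm.mul hF).mul_rep X
    simpa using h2
  have hF' : F = c • G := by
    rw [← one_mul F, ← hG.mul_transpose, mul_assoc, hc]
    simp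
  have h1 := hF.orthogonal
  rw [hF', Matrix.transpose_smul, Matrix.smul_mul, Matrix.mul_smul, hG.orthogonal, smul_smul] at h1
  have hcc : c * c = 1 := by simpa using congrFun (congrFun h1 0) 0
  rcases mul_self_eq_one_iff.mp hcc with rfl | rfl
  · exact Or.inl (by simpa using hF')
  · exact Or.inr (by simpa using hF')

lemma IsLift.commute_or (hf : IsLift f F) (hg : IsLift g G) (h : ∀ x, f (g x) = g (f x)) :
    F * G = G * F ∨ F * G = -(G * F) := by
  have : g.trans f = f.trans g := LieEquiv.ext h
  have h1 := hf.mul hg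
  rw [this] at h1
  exact h1.eq_or_eq_neg (hg.mul hf)

lemma IsLift.commute_of (hf : IsLift f F) (hg : IsLift g G)
    (h : F * G = G * F ∨ F * G = -(G * F)) : ∀ x, f (g x) = g (f x) := by
  have : IsLift (g.trans f) (G * F) := by
    rcases h with h | h
    · rw [← h]; exact hf.mul hg
    · rw [← neg_neg (G * F), ← h]; exact (hf.mul hg).neg
  exact fun x => congrArg (fun k : Sl4 ≃ₗ⁅ℂ⁆ Sl4 => k x) (this.eq_of_eq (hg.mul hf))

lemma exists_isLift_of_orthogonal (h : Gᵀ * G = 1) : ∃ f, IsLift f G := by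
  have h' : G * Gᵀ = 1 := mul_eq_one_comm.mp h
  have skew : ∀ {A S : Matrix (Fin 6) (Fin 6) ℂ}, Sᵀ = -S → (A * S * Aᵀ)ᵀ = -(A * S * Aᵀ) :=
    fun {A S} hS => by
      rw [Matrix.transpose_mul, Matrix.transpose_mul, Matrix.transpose_transpose, hS]
      noncomm_ring
  have ru : ∀ X : Sl4, rep (unrep (G * rep X.1 * Gᵀ)) = G * rep X.1 * Gᵀ := fun X =>
    rep_unrep (skew (transpose_rep X.2))
  let f : Sl4 ≃ₗ⁅ℂ⁆ Sl4 :=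
    { toFun := fun X => ⟨unrep (G * rep X.1 * Gᵀ), trace_unrep _⟩
      map_add' := fun X Y => rep_injOn (by
        refine (ru (X + Y)).trans ?_
        change _ = rep (unrep (G * rep X.1 * Gᵀ) + unrep (G * rep Y.1 * Gᵀ))
        rw [rep_add, ru, ru, val_add, rep_add]
        noncomm_ring)
      map_smul' := fun c X => rep_injOn (by
        refine (ru (c • X)).trans ?_
        change _ = rep (c • unrep (G * rep X.1 * Gᵀ))
        rw [rep_smul, ru, val_smul, rep_smul]
        simp)
      map_lie' := fun {X Y} => rep_injOn (by
        refine (ru ⁅X, Y⁆).trans ?_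
        change _ = rep (unrep (G * rep X.1 * Gᵀ) * unrep (G * rep Y.1 * Gᵀ) -
            unrep (G * rep Y.1 * Gᵀ) * unrep (G * rep X.1 * Gᵀ))
        rw [rep_mul_sub_mul, ru, ru, val_lie, rep_mul_sub_mul]
        have e : ∀ A B : Matrix (Fin 6) (Fin 6) ℂ, G * A * Gᵀ * (G * B * Gᵀ) = G * (A * B) * Gᵀ :=
          fun A B => by
            rw [mul_assoc (G * A), ← mul_assoc Gᵀ, ← mul_assoc Gᵀ, h, one_mul]
            noncomm_ring
        rw [e, e]
        noncomm_ring)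
      invFun := fun X => ⟨unrep (Gᵀ * rep X.1 * G), trace_unrep _⟩
      left_inv := fun X => rep_injOn (by
        change rep (unrep (Gᵀ * rep (unrep (G * rep X.1 * Gᵀ)) * G)) = _
        rw [ru]
        have e : Gᵀ * (G * rep X.1 * Gᵀ) * G = rep X.1 := by
          calc _ = (Gᵀ * G) * rep X.1 * (Gᵀ * G) := by noncomm_ring
            _ = _ := by rw [h, one_mul, mul_one]
        rw [e, unrep_rep X.2])
      right_inv := fun X => rep_injOn (by
        change rep (unrep (G * rep (unrep (Gᵀ * rep X.1 * G)) * Gᵀ)) = _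
        have := skew (A := Gᵀ) (transpose_rep X.2)
        rw [Matrix.transpose_transpose] at this
        rw [rep_unrep this]
        have e : G * (Gᵀ * rep X.1 * G) * Gᵀ = rep X.1 := by
          calc _ = (G * Gᵀ) * rep X.1 * (G * Gᵀ) := by noncomm_ring
            _ = _ := by rw [h', one_mul, mul_one]
        rw [e, unrep_rep X.2]) }
  refine ⟨f, h, fun X => ?_⟩
  change _ = rep (unrep (G * rep X.1 * Gᵀ)) * G
  rw [ru, mul_assoc (G * rep X.1), h, mul_one]

/-- Kᵀ K commutes with so(6), so it is a nonzero scalar c, and K divided by a square root of c is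
orthogonal. -/
lemma exists_isLift_of_intertwiner {K K' : Matrix (Fin 6) (Fin 6) ℂ} (hK : K' * K = 1)
    (h : ∀ X : Sl4, K * rep X.1 = rep (f X).1 * K) : ∃ G, IsLift f G := by
  obtain ⟨c, hc⟩ := exists_eq_smul_one_of_commute_rep (G := Kᵀ * K) fun X => by
    have := congrArg Matrix.transpose (h X)
    rw [Matrix.transpose_mul, Matrix.transpose_mul, transpose_rep X.2, transpose_rep (f X).2,
      neg_mul, mul_neg, neg_inj] at this
    rw [mul_assoc, h, ← mul_assoc, ← this, mul_assoc]
  have hc0 : c ≠ 0 := by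
    rintro rfl
    rw [zero_smul] at hc
    have h1 : K'ᵀ * (Kᵀ * K) = 0 := by rw [hc, mul_zero]
    have h2 : K'ᵀ * Kᵀ = 1 := by
      rw [← Matrix.transpose_mul, mul_eq_one_comm.mp hK, Matrix.transpose_one]
    rw [← mul_assoc, h2, one_mul] at h1
    rw [h1, mul_zero] at hK
    simpa using congrFun (congrFun hK 0) 0
  obtain ⟨s, hs⟩ := IsAlgClosed.exists_eq_mul_self c
  have hs0 : s ≠ 0 := by rintro rfl; simp [hs] at hc0
  refine ⟨s⁻¹ • K, ?_, fun X => ?_⟩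
  · rw [Matrix.transpose_smul, Matrix.smul_mul, Matrix.mul_smul, hc, smul_smul, smul_smul, hs]
    field_simp
    simp
  · rw [Matrix.smul_mul, h, Matrix.mul_smul]

/-- The extension to all matrices precedes f by the projection along the scalars. -/
lemma exists_isSlAut (f : Sl4 ≃ₗ⁅ℂ⁆ Sl4) :
    ∃ F : Matrix (Fin 4) (Fin 4) ℂ →ₗ[ℂ] Matrix (Fin 4) (Fin 4) ℂ,
      IsSlAut F ∧ ∀ X : Sl4, F X.1 = (f X).1 := by
  let pr : Matrix (Fin 4) (Fin 4) ℂ →ₗ[ℂ] Sl4 :=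
    { toFun := fun X => ⟨X - (X.trace / 4) • 1, by
        change (X - (X.trace / 4) • (1 : Matrix (Fin 4) (Fin 4) ℂ)).trace = 0
        rw [Matrix.trace_sub, Matrix.trace_smul, Matrix.trace_one, Fintype.card_fin, smul_eq_mul]
        push_cast
        ring⟩
      map_add' := fun X Y => Subtype.ext (by
        change X + Y - ((X + Y).trace / 4) • (1 : Matrix (Fin 4) (Fin 4) ℂ) =
          X - (X.trace / 4) • 1 + (Y - (Y.trace / 4) • 1)
        rw [Matrix.trace_add]
        module)
      map_smul' := fun c X => Subtype.ext (by
        change c • X - ((c • X).trace / 4) • (1 : Matrix (Fin 4) (Fin 4) ℂ) =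
          c • (X - (X.trace / 4) • 1)
        rw [Matrix.trace_smul, smul_eq_mul]
        module) }
  have hpr : ∀ X : Sl4, pr X.1 = X := fun X => Subtype.ext (by
    change X.1 - (X.1.trace / 4) • (1 : Matrix (Fin 4) (Fin 4) ℂ) = X.1
    rw [trace_val]
    simp)
  let F : Matrix (Fin 4) (Fin 4) ℂ →ₗ[ℂ] Matrix (Fin 4) (Fin 4) ℂ :=
    Sl4.toSubmodule.subtype ∘ₗ (f.toLinearEquiv : Sl4 →ₗ[ℂ] Sl4) ∘ₗ pr
  have hF : ∀ X : Sl4, F X.1 = (f X).1 := fun X => by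
    change (f (pr X.1)).1 = _
    rw [hpr]
  refine ⟨F, ⟨fun X Y hX hY => ?_, fun X hX => ?_, fun X hX h0 => ?_, fun Y hY => ?_⟩, hF⟩
  · have := hF ⁅(⟨X, hX⟩ : Sl4), (⟨Y, hY⟩ : Sl4)⁆
    rw [LieEquiv.map_lie, val_lie, val_lie, ← hF, ← hF] at this
    exact this
  · rw [hF ⟨X, hX⟩]
    exact (f _).2
  · rw [hF ⟨X, hX⟩] at h0
    have : f ⟨X, hX⟩ = 0 := Subtype.ext h0
    have := congrArg f.symm this
    rw [LieEquiv.symm_apply_apply, map_zero] at this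
    exact congrArg Subtype.val this
  · exact ⟨(f.symm ⟨Y, hY⟩).1, (f.symm ⟨Y, hY⟩).2, by rw [hF, LieEquiv.apply_symm_apply]⟩

/-- Conjugation by A is intertwined by K ↦ A K Aᵀ, and an automorphism that is not inner needs the
Hodge star in addition. -/
theorem exists_isLift (f : Sl4 ≃ₗ⁅ℂ⁆ Sl4) : ∃ G, IsLift f G := by
  obtain ⟨F, hF, hFf⟩ := exists_isSlAut f
  rcases hF.isInner_or with ⟨A, B, hAB, hBA, h⟩ | ⟨A, B, hAB, hBA, h⟩
  · refine exists_isLift_of_intertwiner (K := skewConj A) (K' := skewConj B)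
      (by rw [← skewConj_mul, hBA, skewConj_one]) fun X => skewConj_mul_rep ?_
    rw [← hFf, h X.1 X.2, mul_assoc, hBA, mul_one]
  · refine exists_isLift_of_intertwiner (K := hodge * skewConj A) (K' := skewConj B * hodge) ?_
      fun X => ?_
    · rw [mul_assoc, ← mul_assoc hodge, hodge_mul_hodge, one_mul, ← skewConj_mul, hBA, skewConj_one]
    · have h1 : -(f X).1ᵀ = A * X.1 * B := by
        rw [← hFf, ← h X.1 X.2]
        rfl
      have h2 : (A * X.1 * B).trace = 0 := by
        rw [← h1, Matrix.trace_neg, Matrix.trace_transpose, trace_val, neg_zero]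
      have h3 : (f X).1 = -(A * X.1 * B)ᵀ := by rw [← h1]; simp
      rw [mul_assoc, skewConj_mul_rep (Y := A * X.1 * B) (by rw [mul_assoc (A * X.1), hBA, mul_one]),
        ← mul_assoc, hodge_mul_rep h2, ← h3, mul_assoc]

/-- An eigenvector X of f maps each eigenspace of G into another one. So the sum of the eigenspaces
of G is stable under so(6); being nonzero, it is everything. -/
lemma IsLift.iSup_eigenspace (h : IsLift f G) (hf : IsDiagonalizable f) :
    ⨆ μ : ℂ, Module.End.eigenspace G.mulVecLin μ = ⊤ := by
  obtain ⟨μ, hμ⟩ := Module.End.exists_eigenvalue G.mulVecLin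
  refine eq_top_of_skew_stable (by simp) (fun h0 => ?_) fun S hS v hv => ?_
  · exact hμ (le_bot_iff.mp (h0 ▸ le_iSup (fun μ => Module.End.eigenspace G.mulVecLin μ) μ))
  · obtain ⟨X, rfl⟩ := exists_rep_eq hS
    have hX : X ∈ ⨆ c : ℂ, eigenspace f c := by
      rw [show (⨆ c : ℂ, eigenspace f c) = ⊤ from hf]; trivial
    induction hX using Submodule.iSup_induction' with
    | mem c X hX =>
      rw [mem_eigenspace] at hX
      induction hv using Submodule.iSup_induction' with
      | mem μ v hv =>
        rw [Module.End.mem_eigenspace_iff, Matrix.mulVecLin_apply] at hv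
        refine Submodule.mem_iSup_of_mem (c * μ) ?_
        rw [Module.End.mem_eigenspace_iff, Matrix.mulVecLin_apply, Matrix.mulVec_mulVec, h.mul_rep,
          hX, ← Matrix.mulVec_mulVec, hv, val_smul, rep_smul, Matrix.mulVec_smul,
          Matrix.smul_mulVec, smul_smul, mul_comm]
      | zero => rw [Matrix.mulVec_zero]; exact Submodule.zero_mem _
      | add v w _ _ hv hw => rw [Matrix.mulVec_add]; exact Submodule.add_mem _ hv hw
    | zero =>
      have : rep (0 : Sl4).1 = 0 := by
        have := rep_smul 0 0
        simpa using this
      rw [this, Matrix.zero_mulVec]; exact Submodule.zero_mem _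
    | add X Y _ _ hX hY =>
      rw [val_add, rep_add, Matrix.add_mulVec]
      exact Submodule.add_mem _ (hX (transpose_rep X.2)) (hY (transpose_rep Y.2))

end Lift

/-! ### Frames of blocks with prescribed Gram matrices -/

section Frame

variable {n β T : Type*} [Fintype n] [DecidableEq n] [Fintype β] [DecidableEq β]

/-- A family of blocks of vectors on which the matrices of `S` act by scalar multiples of the
matrices `x F`, and whose Gram matrix pairs the block `i` with the block `σ i` by `B (t i)`. -/
structure IsFrame (S : Set (Matrix n n ℂ)) (x : Matrix n n ℂ → Matrix β β ℂ) (B : T → Matrix β β ℂ)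
    {κ : Type*} [DecidableEq κ] (σ : Equiv.Perm κ) (t : κ → T) (E : κ → Matrix n β ℂ) : Prop where
  invol : ∀ i, σ (σ i) = i
  label : ∀ i, t (σ i) = t i
  gram : ∀ i j, (E i)ᵀ * E j = if j = σ i then B (t i) else 0
  block : ∀ i, ∀ F ∈ S, ∃ r : ℂ, F * E i = r • (E i * x F)

/-- The matrix carrying the frame `E'` to the frame `E`. -/
def transfer (B : T → Matrix β β ℂ) {κ : Type*} [Fintype κ] (σ : Equiv.Perm κ) (t : κ → T)
    (E E' : κ → Matrix n β ℂ) : Matrix n n ℂ :=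
  ∑ i, E i * B (t i) * (E' (σ i))ᵀ

variable {S : Set (Matrix n n ℂ)} {x : Matrix n n ℂ → Matrix β β ℂ} {B : T → Matrix β β ℂ}
  {κ : Type*} [DecidableEq κ] [Fintype κ] {σ : Equiv.Perm κ} {t : κ → T} {E E' : κ → Matrix n β ℂ}

lemma IsFrame.transfer_mul (h : IsFrame S x B σ t E') (hB : ∀ a, B a * B a = 1) (j : κ) :
    transfer B σ t E E' * E' j = E j := by
  rw [transfer, Matrix.sum_mul, Finset.sum_eq_single j]
  · rw [Matrix.mul_assoc, h.gram, if_pos (h.invol j).symm, h.label, Matrix.mul_assoc, hB, Matrix.mul_one]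
  · intro i _ hij
    rw [Matrix.mul_assoc, h.gram, h.invol, if_neg hij.symm, Matrix.mul_zero]
  · simp

lemma IsFrame.transpose_transfer (h : IsFrame S x B σ t E) (hB : ∀ a, (B a)ᵀ = B a) :
    (transfer B σ t E E')ᵀ = transfer B σ t E' E := by
  rw [transfer, transfer, Matrix.transpose_sum]
  refine Fintype.sum_equiv σ _ _ fun i => ?_
  rw [Matrix.transpose_mul, Matrix.transpose_mul, Matrix.transpose_transpose, hB, h.invol, h.label,
    Matrix.mul_assoc]

lemma transfer_eq_mul (A : Matrix n n ℂ) (h : ∀ i, E i = A * E' i) (E'' : κ → Matrix n β ℂ) :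
    transfer B σ t E E'' = A * transfer B σ t E' E'' := by
  rw [transfer, transfer, Matrix.mul_sum]
  exact Finset.sum_congr rfl fun i _ => by rw [h, Matrix.mul_assoc, Matrix.mul_assoc, Matrix.mul_assoc]

/-- The transfer of a frame to itself is the projection onto its span, orthogonal for the bilinear
dot product. -/
lemma IsFrame.transfer_idem (h : IsFrame S x B σ t E) (hB : ∀ a, B a * B a = 1) :
    transfer B σ t E E * transfer B σ t E E = transfer B σ t E E :=
  (transfer_eq_mul _ (fun i => (h.transfer_mul hB i).symm) _).symm

lemma IsFrame.trace_transfer (h : IsFrame S x B σ t E) (hB : ∀ a, B a * B a = 1) :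
    (transfer B σ t E E).trace = Fintype.card κ * Fintype.card β := by
  rw [transfer, Matrix.trace_sum, Finset.sum_congr rfl (g := fun _ => (Fintype.card β : ℂ))]
  · simp
  · intro i _
    rw [Matrix.trace_mul_comm, ← Matrix.mul_assoc, h.gram, if_pos (h.invol i).symm, h.label, hB,
      Matrix.trace_one]

/-- F preserves the range of Q, so F Q + (1 - Q) is orthogonal. That its transpose is also a right
inverse yields F Q Fᵀ = Q. -/
lemma commute_of_mul_mul_eq {F Q : Matrix n n ℂ} (hF : Fᵀ * F = 1) (hQt : Qᵀ = Q) (hQ : Q * Q = Q)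
    (h : Q * (F * Q) = F * Q) : F * Q = Q * F := by
  have h1 : (F * Q)ᵀ * (F * Q) = Q := by
    rw [Matrix.transpose_mul, hQt, Matrix.mul_assoc, ← Matrix.mul_assoc Fᵀ, hF, one_mul, hQ]
  have h2 : Q * Fᵀ * Q = Q * Fᵀ := by
    have := congrArg Matrix.transpose h
    simpa [Matrix.transpose_mul, hQt, Matrix.mul_assoc] using this
  have h3 : (F * Q + (1 - Q))ᵀ * (F * Q + (1 - Q)) = 1 := by
    rw [Matrix.transpose_add, Matrix.transpose_sub, Matrix.transpose_one, hQt, Matrix.transpose_mul,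
      hQt]
    rw [Matrix.transpose_mul, hQt] at h1
    calc _ = Q * Fᵀ * (F * Q) + (Q * Fᵀ - Q * Fᵀ * Q) + (F * Q - Q * (F * Q)) +
          (1 - Q - Q + Q * Q) := by noncomm_ring
      _ = 1 := by rw [h1, h2, h, hQ]; noncomm_ring
  have h4 := mul_eq_one_comm.mp h3
  rw [Matrix.transpose_add, Matrix.transpose_sub, Matrix.transpose_one, hQt, Matrix.transpose_mul,
      hQt] at h4
  have h5 : F * Q * Fᵀ = Q := by
    have : F * Q * Fᵀ + (1 - Q) = 1 := by
      refine Eq.trans ?_ h4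
      have e0 : F * Q * (Q * Fᵀ) = F * Q * Fᵀ := by
        rw [Matrix.mul_assoc, ← Matrix.mul_assoc Q, hQ, ← Matrix.mul_assoc]
      have e1 : F * Q * (1 - Q) = 0 := by rw [mul_sub, mul_one, Matrix.mul_assoc, hQ, sub_self]
      have e2 : (1 - Q) * (Q * Fᵀ) = 0 := by rw [sub_mul, one_mul, ← Matrix.mul_assoc, hQ, sub_self]
      have e3 : (1 - Q) * (1 - Q) = 1 - Q := by rw [sub_mul, one_mul, mul_sub, mul_one, hQ]; simp
      rw [add_mul, mul_add, mul_add, e0, e1, e2, e3, add_zero, zero_add]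
    have h6 : F * Q * Fᵀ = 1 - (1 - Q) := eq_sub_of_add_eq this
    rw [h6, sub_sub_cancel]
  calc F * Q = F * Q * (Fᵀ * F) := by rw [hF, mul_one]
    _ = Q * F := by rw [← Matrix.mul_assoc, h5]

lemma IsFrame.commute_transfer (h : IsFrame S x B σ t E) (hB : ∀ a, B a * B a = 1)
    (hB' : ∀ a, (B a)ᵀ = B a) {F : Matrix n n ℂ} (hF : F ∈ S) (hF1 : Fᵀ * F = 1) :
    F * transfer B σ t E E = transfer B σ t E E * F := by
  refine commute_of_mul_mul_eq hF1 (h.transpose_transfer hB') (h.transfer_idem hB) ?_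
  rw [← transfer_eq_mul F (E := fun i => F * E i) (fun i => rfl)]
  refine (transfer_eq_mul _ (fun i => ?_) _).symm
  obtain ⟨r, hr⟩ := h.block i F hF
  rw [hr, Matrix.mul_smul, ← Matrix.mul_assoc, h.transfer_mul hB]

/-- The trace of the projection is its rank. -/
lemma IsFrame.card_le (h : IsFrame S x B σ t E) (hB : ∀ a, B a * B a = 1) :
    Fintype.card κ * Fintype.card β ≤ Fintype.card n := by
  have h1 : IsIdempotentElem (Matrix.toLin' (transfer B σ t E E)) := by
    rw [IsIdempotentElem, Module.End.mul_eq_comp, ← Matrix.toLin'_mul, h.transfer_idem hB]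
  have h2 := (LinearMap.IsIdempotentElem.isProj_range _ h1).trace
  rw [Matrix.trace_toLin'_eq, h.trace_transfer hB] at h2
  have h3 := LinearMap.finrank_range_le (Matrix.toLin' (transfer B σ t E E))
  have h4 : Fintype.card κ * Fintype.card β =
      Module.finrank ℂ (LinearMap.range (Matrix.toLin' (transfer B σ t E E))) := by exact_mod_cast h2
  have h5 := Submodule.finrank_le (LinearMap.range (Matrix.toLin' (transfer B σ t E E)))
  rw [Module.finrank_pi] at h5
  omega

lemma IsFrame.sum {κ' : Type*} [DecidableEq κ'] {σ' : Equiv.Perm κ'} {t' : κ' → T}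
    {E' : κ' → Matrix n β ℂ} (h : IsFrame S x B σ t E) (h' : IsFrame S x B σ' t' E')
    (hEE : ∀ i j, (E i)ᵀ * E' j = 0) :
    IsFrame S x B (Equiv.sumCongr σ σ') (Sum.elim t t') (Sum.elim E E') where
  invol := by rintro (i | i) <;> simp [h.invol, h'.invol]
  label := by rintro (i | i) <;> simp [h.label, h'.label]
  gram := by
    have hEE' : ∀ i j, (E' j)ᵀ * E i = 0 := fun i j => by
      simpa using congrArg Matrix.transpose (hEE i j)
    rintro (i | i) (j | j) <;> simp [h.gram, h'.gram, hEE, hEE']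
  block := by
    rintro (i | i)
    · exact h.block i
    · exact h'.block i

lemma isFrame_single {U : Matrix n β ℂ} {a : T} (hU : Uᵀ * U = B a)
    (hb : ∀ F ∈ S, ∃ r : ℂ, F * U = r • (U * x F)) :
    IsFrame S x B (1 : Equiv.Perm (Fin 1)) (fun _ => a) fun _ => U where
  invol _ := rfl
  label _ := rfl
  gram i j := by rw [hU, if_pos (Subsingleton.elim _ _)]
  block _ := hb

lemma isFrame_pair (hB' : ∀ a, (B a)ᵀ = B a) {U U' : Matrix n β ℂ} {a : T} (hU : Uᵀ * U = 0)
    (hU' : U'ᵀ * U' = 0) (hUU' : Uᵀ * U' = B a) (hb : ∀ F ∈ S, ∃ r : ℂ, F * U = r • (U * x F))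
    (hb' : ∀ F ∈ S, ∃ r : ℂ, F * U' = r • (U' * x F)) :
    IsFrame S x B (Equiv.swap (0 : Fin 2) 1) (fun _ => a) ![U, U'] where
  invol i := by simp
  label _ := rfl
  gram i j := by
    have hUU : U'ᵀ * U = B a := by
      rw [← hB' a, ← hUU', Matrix.transpose_mul, Matrix.transpose_transpose]
    fin_cases i <;> fin_cases j <;> simp [hU, hU', hUU', hUU]
  block i := by
    fin_cases i
    · exact hb
    · exact hb'

/-- A frame with the most blocks exists because the number of blocks is bounded. Its projection
commutes with S, so unless it is 1, the hypothesis `step`, applied to the complementary projection,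
produces a block or a dual pair of isotropic blocks orthogonal to the frame, against maximality. -/
theorem exists_isFrame [Nonempty β] (hS : ∀ F ∈ S, Fᵀ * F = 1) (hB : ∀ a, B a * B a = 1)
    (hB' : ∀ a, (B a)ᵀ = B a)
    (step : ∀ Q : Matrix n n ℂ, Qᵀ = Q → Q * Q = Q → Q ≠ 0 → (∀ F ∈ S, F * Q = Q * F) →
      ∃ (a : T) (U U' : Matrix n β ℂ), Q * U = U ∧ Q * U' = U' ∧
        (∀ F ∈ S, ∃ r : ℂ, F * U = r • (U * x F)) ∧ (∀ F ∈ S, ∃ r : ℂ, F * U' = r • (U' * x F)) ∧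
        Uᵀ * U' = B a ∧ (U = U' ∨ Uᵀ * U = 0 ∧ U'ᵀ * U' = 0)) :
    ∃ (κ : Type) (_ : Fintype κ) (_ : DecidableEq κ) (σ : Equiv.Perm κ) (t : κ → T)
      (E : κ → Matrix n β ℂ), IsFrame S x B σ t E ∧ transfer B σ t E E = 1 := by
  let P : ℕ → Prop := fun m => ∃ (κ : Type) (_ : Fintype κ) (_ : DecidableEq κ) (σ : Equiv.Perm κ)
    (t : κ → T) (E : κ → Matrix n β ℂ), IsFrame S x B σ t E ∧ Fintype.card κ = m
  have hP0 : P 0 := ⟨Fin 0, inferInstance, inferInstance, 1, Fin.elim0, Fin.elim0,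
    ⟨fun i => i.elim0, fun i => i.elim0, fun i => i.elim0, fun i => i.elim0⟩, rfl⟩
  have bound : ∀ m, P m → m ≤ Fintype.card n := by
    rintro m ⟨κ, _, _, σ, t, E, h, rfl⟩
    exact (Nat.le_mul_of_pos_right _ Fintype.card_pos).trans (h.card_le hB)
  classical
  have hmax := Nat.findGreatest_spec (P := P) (Nat.zero_le (Fintype.card n)) hP0
  obtain ⟨κ, _, _, σ, t, E, h, hcard⟩ := hmax
  have contra : ∀ m, P m → ¬ Fintype.card κ < m := fun m hm hlt =>
    absurd (Nat.le_findGreatest (bound m hm) hm) (by rw [← hcard]; omega)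
  refine ⟨κ, inferInstance, inferInstance, σ, t, E, h, ?_⟩
  by_contra hne
  have hQt := h.transpose_transfer (E' := E) hB'
  have hQQ := h.transfer_idem hB
  have hQE := h.transfer_mul (E := E) hB
  set Q := transfer B σ t E E with hQ
  obtain ⟨a, U, U', hU, hU', hb, hb', hUU', hor⟩ := step (1 - Q)
    (by rw [Matrix.transpose_sub, Matrix.transpose_one, hQt])
    (by rw [sub_mul, one_mul, mul_sub, mul_one, hQQ]; simp)
    (fun h0 => hne (sub_eq_zero.mp h0).symm) (fun F hF => by
      rw [mul_sub, sub_mul, h.commute_transfer hB hB' hF (hS F hF), mul_one, one_mul])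
  have orth : ∀ W : Matrix n β ℂ, (1 - Q) * W = W → ∀ i, (E i)ᵀ * W = 0 := by
    intro W hW i
    have : (E i)ᵀ * (1 - Q) = 0 := by
      have h1 : (1 - Q) * E i = 0 := by rw [Matrix.sub_mul, Matrix.one_mul, hQE, sub_self]
      have h2 := congrArg Matrix.transpose h1
      rwa [Matrix.transpose_mul, Matrix.transpose_sub, Matrix.transpose_one, hQt,
        Matrix.transpose_zero] at h2
    rw [← hW, ← Matrix.mul_assoc, this, Matrix.zero_mul]
  rcases hor with rfl | ⟨h0, h0'⟩
  · refine contra _ ⟨_, inferInstance, inferInstance, _, _, _,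
      h.sum (isFrame_single hUU' hb) (fun i _ => orth U hU i), rfl⟩ ?_
    simp
  · refine contra _ ⟨_, inferInstance, inferInstance, _, _, _,
      h.sum (isFrame_pair hB' h0 h0' hUU' hb hb') (fun i j => ?_), rfl⟩ ?_
    · fin_cases j
      · exact orth U hU i
      · exact orth U' hU' i
    · simp

end Frame

/-! ### Conjugacy of MAD-groups through their frames -/

section Lifts

variable {𝒢 ℋ : Set (Sl4 ≃ₗ⁅ℂ⁆ Sl4)}

/-- The orthogonal matrices implementing the elements of `ℋ`. -/
def lifts (ℋ : Set (Sl4 ≃ₗ⁅ℂ⁆ Sl4)) : Set (Matrix (Fin 6) (Fin 6) ℂ) :=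
  {G | ∃ f ∈ ℋ, IsLift f G}

lemma orthogonal_of_mem_lifts {F : Matrix (Fin 6) (Fin 6) ℂ} (h : F ∈ lifts ℋ) : Fᵀ * F = 1 := by
  obtain ⟨f, -, h⟩ := h
  exact h.orthogonal

lemma IsMADGroup.iSup_eigenspace_of_mem_lifts (hℋ : IsMADGroup ℋ) {F : Matrix (Fin 6) (Fin 6) ℂ}
    (h : F ∈ lifts ℋ) : ⨆ μ : ℂ, Module.End.eigenspace F.mulVecLin μ = ⊤ := by
  obtain ⟨f, hf, h⟩ := h
  exact h.iSup_eigenspace (hℋ.diag f hf)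

lemma IsMADGroup.commute_or_of_mem_lifts (hℋ : IsMADGroup ℋ) {F G : Matrix (Fin 6) (Fin 6) ℂ}
    (hF : F ∈ lifts ℋ) (hG : G ∈ lifts ℋ) : F * G = G * F ∨ F * G = -(G * F) := by
  obtain ⟨f, hf, hF⟩ := hF
  obtain ⟨g, hg, hG⟩ := hG
  exact hF.commute_or hG (hℋ.comm f hf g hg)

lemma IsMADGroup.trans_mem (hℋ : IsMADGroup ℋ) {f g : Sl4 ≃ₗ⁅ℂ⁆ Sl4} (hf : f ∈ ℋ) (hg : g ∈ ℋ) :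
    g.trans f ∈ ℋ := by
  rw [← hℋ.diagGroup_Gr] at hf hg ⊢
  intro U hU
  obtain ⟨c, hc⟩ := hf U hU
  obtain ⟨d, hd⟩ := hg U hU
  refine ⟨d * c, fun x hx => ?_⟩
  change f (g x) = _
  rw [hd x hx, map_smul, hc x hx, smul_smul]

lemma IsMADGroup.mul_mem_lifts (hℋ : IsMADGroup ℋ) {F G : Matrix (Fin 6) (Fin 6) ℂ}
    (hF : F ∈ lifts ℋ) (hG : G ∈ lifts ℋ) : F * G ∈ lifts ℋ := by
  obtain ⟨f, hf, hF⟩ := hF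
  obtain ⟨g, hg, hG⟩ := hG
  exact ⟨_, hℋ.trans_mem hf hg, hF.mul hG⟩

/-- The automorphism p lifted by P conjugates 𝒢 to a MAD-group commuting with ℋ, and MAD-groups that
commute elementwise coincide by maximality. -/
lemma conjugate_of_commute (h𝒢 : IsMADGroup 𝒢) (hℋ : IsMADGroup ℋ) {P : Matrix (Fin 6) (Fin 6) ℂ}
    (hP : Pᵀ * P = 1) (h : ∀ F ∈ lifts 𝒢, ∀ G ∈ lifts ℋ,
      P * F * Pᵀ * G = G * (P * F * Pᵀ) ∨ P * F * Pᵀ * G = -(G * (P * F * Pᵀ))) :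
    Conjugate 𝒢 ℋ := by
  obtain ⟨p, hp⟩ := exists_isLift_of_orthogonal hP
  have hc : ∀ f ∈ conj p 𝒢, ∀ g ∈ ℋ, ∀ x, f (g x) = g (f x) := by
    rintro _ ⟨f, hf, rfl⟩ g hg
    obtain ⟨F, hF⟩ := exists_isLift f
    obtain ⟨G, hG⟩ := exists_isLift g
    have h1 : IsLift ((p.symm.trans f).trans p) (P * (F * Pᵀ)) := hp.mul (hF.mul hp.symm)
    refine h1.commute_of hG ?_
    rw [← mul_assoc]
    exact h F ⟨f, hf, hF⟩ G ⟨g, hg, hG⟩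
  have hpm := h𝒢.conj p
  refine ⟨p, Set.Subset.antisymm (fun f hf => ?_) fun g hg => ?_⟩
  · exact hℋ.maximal f (hpm.diag f hf) fun g hg => hc f hf g hg
  · exact hpm.maximal g (hℋ.diag g hg) fun f hf x => (hc f hf g hg x).symm

variable {β T : Type*} [Fintype β] [DecidableEq β] {x y : Matrix (Fin 6) (Fin 6) ℂ → Matrix β β ℂ}
  {B : T → Matrix β β ℂ}
  {κ : Type*} [DecidableEq κ] [Fintype κ] {σ : Equiv.Perm κ} {t : κ → T}
  {E E' : κ → Matrix (Fin 6) β ℂ}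

/-- Let P carry E to E'. On every block of E', P F Pᵀ and G act by multiples of x F and y G, and the
sign by which these commute is the same for all blocks. So P F Pᵀ and G commute up to a sign. -/
lemma conjugate_of_isFrame (h𝒢 : IsMADGroup 𝒢) (hℋ : IsMADGroup ℋ)
    (hB : ∀ a, B a * B a = 1) (hB' : ∀ a, (B a)ᵀ = B a)
    (hE : IsFrame (lifts 𝒢) x B σ t E) (hE' : IsFrame (lifts ℋ) y B σ t E')
    (h1 : transfer B σ t E E = 1) (h1' : transfer B σ t E' E' = 1)
    (hxy : ∀ F ∈ lifts 𝒢, ∀ G ∈ lifts ℋ, x F * y G = y G * x F ∨ x F * y G = -(y G * x F)) :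
    Conjugate 𝒢 ℋ := by
  have hP : ∀ j, transfer B σ t E' E * E j = E' j := hE.transfer_mul hB
  have hPt : (transfer B σ t E' E)ᵀ = transfer B σ t E E' := hE'.transpose_transfer hB'
  have hP' : ∀ j, transfer B σ t E E' * E' j = E j := hE'.transfer_mul hB
  -- The columns of E' span ℂ⁶, since their projection is 1.
  have ext : ∀ A A' : Matrix (Fin 6) (Fin 6) ℂ, (∀ j, A * E' j = A' * E' j) → A = A' := by
    intro A A' hA
    rw [← mul_one A, ← mul_one A', ← h1', ← transfer_eq_mul A (fun _ => rfl),
      ← transfer_eq_mul A' (fun _ => rfl), funext hA]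
  set P := transfer B σ t E' E
  refine conjugate_of_commute h𝒢 hℋ (P := P) ?_ fun F hF G hG => ?_
  · refine mul_eq_one_comm.mp (ext _ _ fun j => ?_)
    rw [hPt, Matrix.mul_assoc, hP', hP, Matrix.one_mul]
  · have key : ∀ j, ∃ c : ℂ, P * F * Pᵀ * G * E' j = c • (E' j * (x F * y G)) ∧
        G * (P * F * Pᵀ) * E' j = c • (E' j * (y G * x F)) := by
      intro j
      obtain ⟨r, hr⟩ := hE.block j F hF
      obtain ⟨s, hs⟩ := hE'.block j G hG
      have h3 : P * F * Pᵀ * E' j = r • (E' j * x F) := by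
        rw [hPt, Matrix.mul_assoc, hP', Matrix.mul_assoc, hr, Matrix.mul_smul, ← Matrix.mul_assoc, hP]
      refine ⟨r * s, ?_, ?_⟩
      · rw [Matrix.mul_assoc, hs, Matrix.mul_smul, ← Matrix.mul_assoc, h3, Matrix.smul_mul,
          smul_smul, Matrix.mul_assoc, mul_comm r]
      · rw [Matrix.mul_assoc, h3, Matrix.mul_smul, ← Matrix.mul_assoc, hs, Matrix.smul_mul,
          smul_smul, Matrix.mul_assoc]
    rcases hxy F hF G hG with h | h
    · refine Or.inl (ext _ _ fun j => ?_)
      obtain ⟨c, hc, hc'⟩ := key j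
      rw [hc, hc', h]
    · refine Or.inr (ext _ _ fun j => ?_)
      obtain ⟨c, hc, hc'⟩ := key j
      rw [Matrix.neg_mul, hc, hc', h, Matrix.mul_neg, smul_neg]

end Lifts

section Reindex

variable {n β T : Type*} [Fintype n] [DecidableEq n] [Fintype β] [DecidableEq β]
  {S : Set (Matrix n n ℂ)} {x : Matrix n n ℂ → Matrix β β ℂ} {B : T → Matrix β β ℂ}
  {κ κ' : Type*} [DecidableEq κ] [Fintype κ] [DecidableEq κ'] [Fintype κ']
  {σ : Equiv.Perm κ} {t : κ → T} {E : κ → Matrix n β ℂ}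

lemma IsFrame.reindex (h : IsFrame S x B σ t E) (ε : κ ≃ κ') :
    IsFrame S x B ((ε.symm.trans σ).trans ε) (t ∘ ε.symm) (E ∘ ε.symm) where
  invol i := by simp [h.invol]
  label i := by simp [h.label]
  gram i j := by
    simp only [Function.comp_apply, h.gram, Equiv.trans_apply]
    congr 1
    exact propext (Equiv.symm_apply_eq ε)
  block i F hF := h.block (ε.symm i) F hF

end Reindex

/-! ### Joint eigenvectors of commuting matrices -/

section Eigenvectors

/-- The vectors which are eigenvectors (or zero) of all matrices in `C`. -/
def jointEigenvectors {n : Type*} [Fintype n] (C : Set (Matrix n n ℂ)) : Set (n → ℂ) :=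
  {v | ∀ F ∈ C, ∃ c : ℂ, F *ᵥ v = c • v}

variable {n : Type*} [Fintype n] [DecidableEq n] {C : Set (Matrix n n ℂ)}

lemma span_jointEigenvectors (hd : ∀ F ∈ C, ⨆ μ : ℂ, Module.End.eigenspace F.mulVecLin μ = ⊤)
    (hc : ∀ F ∈ C, ∀ G ∈ C, F * G = G * F) : Submodule.span ℂ (jointEigenvectors C) = ⊤ := by
  have h := iSup_iInf_eigenspace_eq_top (fun F : C => F.1.mulVecLin) 
    (fun F G => by
      rw [commute_iff_eq, Module.End.mul_eq_comp, Module.End.mul_eq_comp, ← Matrix.mulVecLin_mul,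
        hc _ F.2 _ G.2, Matrix.mulVecLin_mul])
    (fun F => hd F.1 F.2)
  rw [eq_top_iff, ← h]
  refine iSup_le fun χ v hv => Submodule.subset_span fun F hF => ⟨χ ⟨F, hF⟩, ?_⟩
  have := (Submodule.mem_iInf _).mp hv ⟨F, hF⟩
  rwa [Module.End.mem_eigenspace_iff] at this

/-- Joint eigenvectors span, and Q maps them to joint eigenvectors. If all dot products in the range
of Q vanished, then Qᵀ Q = Q would be zero. -/
lemma exists_jointEigenvectors_dotProduct_ne_zero
    (hd : ∀ F ∈ C, ⨆ μ : ℂ, Module.End.eigenspace F.mulVecLin μ = ⊤)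
    (hc : ∀ F ∈ C, ∀ G ∈ C, F * G = G * F) {Q : Matrix n n ℂ} (hQt : Qᵀ = Q) (hQ : Q * Q = Q)
    (hQ0 : Q ≠ 0) (hQC : ∀ F ∈ C, F * Q = Q * F) :
    ∃ u ∈ jointEigenvectors C, ∃ w ∈ jointEigenvectors C, Q *ᵥ u = u ∧ Q *ᵥ w = w ∧ u ⬝ᵥ w ≠ 0 := by
  have stable : ∀ v ∈ jointEigenvectors C, Q *ᵥ v ∈ jointEigenvectors C := by
    intro v hv F hF
    obtain ⟨c, h⟩ := hv F hF
    exact ⟨c, by rw [Matrix.mulVec_mulVec, hQC F hF, ← Matrix.mulVec_mulVec, h, Matrix.mulVec_smul]⟩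
  have idem : ∀ v, Q *ᵥ (Q *ᵥ v) = Q *ᵥ v := fun v => by rw [Matrix.mulVec_mulVec, hQ]
  by_contra hcon
  push Not at hcon
  apply hQ0
  have hspan := span_jointEigenvectors hd hc
  have h1 : ∀ v w, (Q *ᵥ v) ⬝ᵥ (Q *ᵥ w) = 0 := by
    intro v w
    have hv : v ∈ Submodule.span ℂ (jointEigenvectors C) := hspan ▸ Submodule.mem_top
    have hw : w ∈ Submodule.span ℂ (jointEigenvectors C) := hspan ▸ Submodule.mem_top
    induction hv using Submodule.span_induction with
    | mem v hv =>
      induction hw using Submodule.span_induction with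
      | mem w hw => exact hcon _ (stable v hv) _ (stable w hw) (idem v) (idem w)
      | zero => simp
      | add w w' _ _ h h' => rw [Matrix.mulVec_add, dotProduct_add, h, h', add_zero]
      | smul c w _ h => rw [Matrix.mulVec_smul, dotProduct_smul, h, smul_zero]
    | zero => simp
    | add w w' _ _ h h' => rw [Matrix.mulVec_add, add_dotProduct, h, h', add_zero]
    | smul c w _ h => rw [Matrix.mulVec_smul, smul_dotProduct, h, smul_zero]
  ext i j
  have h2 := h1 (Pi.single i 1) (Pi.single j 1)
  rw [Matrix.mulVec_single_one, Matrix.mulVec_single_one] at h2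
  have h3 : (Q * Q) i j = 0 := by
    rw [← h2, Matrix.mul_apply']
    congr 1
    funext k
    exact congrFun (congrFun hQt.symm i) k
  rwa [hQ] at h3

end Eigenvectors

/-! ### Divisibility of dimensions forced by anticommuting operators -/

section Parity

variable {V : Type*} [AddCommGroup V] [Module ℂ V] [FiniteDimensional ℂ V]

/-- Taking determinants of r r' = -r' r gives (-1)^dim = 1. -/
lemma even_finrank_of_anticommute {r r' : Module.End ℂ V} (hr : Function.Injective r)
    (hr' : Function.Injective r') (h : ∀ v, r (r' v) = -r' (r v)) : Even (Module.finrank ℂ V) := by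
  have hdet : ∀ {A : Module.End ℂ V}, Function.Injective A → LinearMap.det A ≠ 0 := fun {A} hA =>
    IsUnit.ne_zero (IsUnit.map LinearMap.det
      ((LinearMap.isUnit_iff_ker_eq_bot A).mpr (LinearMap.ker_eq_bot.mpr hA)))
  have key : r * r' = (-1 : ℂ) • (r' * r) := by
    refine LinearMap.ext fun v => ?_
    change r (r' v) = (-1 : ℂ) • r' (r v)
    rw [h, neg_one_smul]
  have := congrArg LinearMap.det key
  rw [LinearMap.det_smul, map_mul, map_mul] at this
  by_contra hodd
  rw [Nat.not_even_iff_odd] at hodd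
  rw [hodd.neg_one_pow] at this
  apply mul_ne_zero (hdet hr) (hdet hr')
  linear_combination (1 / 2 : ℂ) * this

/-- h exchanges the eigenspaces of g for μ and -μ, so the eigenvalues taken up to sign account for
half of the dimension. r and r' preserve that half and anticommute on it, so its dimension is even.
-/
lemma four_dvd_finrank_of_anticommute {g h r r' : Module.End ℂ V} (hg : Function.Injective g)
    (hh : Function.Injective h) (hr : Function.Injective r) (hr' : Function.Injective r')
    (hd : ⨆ μ : ℂ, g.eigenspace μ = ⊤) (hgh : ∀ v, g (h v) = -h (g v))
    (hrg : ∀ v, g (r v) = r (g v)) (hrg' : ∀ v, g (r' v) = r' (g v))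
    (hrr : ∀ v, r (r' v) = -r' (r v)) : 4 ∣ Module.finrank ℂ V := by
  -- `H` contains one of z, -z for each nonzero z.
  let H : Set ℂ := {z | 0 < z.re ∨ z.re = 0 ∧ 0 < z.im}
  let H' : Set ℂ := {z | -z ∈ H}
  have hHH : Disjoint H H' := by
    rw [Set.disjoint_left]
    rintro z hz hz'
    simp only [H, H', Set.mem_setOf_eq, Complex.neg_re, Complex.neg_im] at hz hz'
    rcases hz with hz | ⟨hz, hz1⟩ <;> rcases hz' with hz' | ⟨hz', hz1'⟩ <;> linarith
  have htri : ∀ z : ℂ, z ∈ H ∨ z ∈ H' ∨ z = 0 := by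
    intro z
    simp only [H, H', Set.mem_setOf_eq, Complex.neg_re, Complex.neg_im, Complex.ext_iff,
      Complex.zero_re, Complex.zero_im]
    rcases lt_trichotomy z.re 0 with h1 | h1 | h1 <;> rcases lt_trichotomy z.im 0 with h2 | h2 | h2 <;>
      simp [h1, h2]
  let W : Set ℂ → Submodule ℂ V := fun K => ⨆ μ ∈ K, g.eigenspace μ
  have hmem : ∀ {K : Set ℂ} {μ : ℂ} {v : V}, μ ∈ K → g v = μ • v → v ∈ W K := fun {K μ v} hμ hv =>
    (le_biSup (fun μ => g.eigenspace μ) hμ) (Module.End.mem_eigenspace_iff.mpr hv)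
  have hcompl : IsCompl (W H) (W H') := by
    have hind : iSupIndep fun μ => g.eigenspace μ := g.eigenspaces_iSupIndep
    have hdis : Disjoint (W H) (W H') := hind.disjoint_biSup_biSup hHH
    refine ⟨hdis, ?_⟩
    rw [codisjoint_iff, eq_top_iff, ← hd]
    refine iSup_le fun μ => ?_
    rcases htri μ with hμ | hμ | rfl
    · exact (le_biSup (fun μ => g.eigenspace μ) hμ).trans le_sup_left
    · exact (le_biSup (fun μ => g.eigenspace μ) hμ).trans le_sup_right
    · rw [Module.End.eigenspace_zero, LinearMap.ker_eq_bot.mpr hg]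
      exact bot_le
  have hle : ∀ K K' : Set ℂ, (∀ z ∈ K, -z ∈ K') →
      Module.finrank ℂ (W K) ≤ Module.finrank ℂ (W K') := by
    intro K K' hK
    have hmap : ∀ v ∈ W K, h v ∈ W K' := by
      change W K ≤ (W K').comap h
      refine iSup₂_le fun μ hμ v hv => hmem (hK μ hμ) ?_
      rw [hgh, Module.End.mem_eigenspace_iff.mp hv, map_smul, neg_smul]
    refine LinearMap.finrank_le_finrank_of_injective (f := h.restrict hmap) fun v w hvw => ?_
    exact Subtype.ext (hh (congrArg Subtype.val hvw))
  have stable : ∀ {A : Module.End ℂ V}, (∀ v, g (A v) = A (g v)) → ∀ v ∈ W H, A v ∈ W H := by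
    intro A hA
    change W H ≤ (W H).comap A
    refine iSup₂_le fun μ hμ v hv => hmem hμ ?_
    rw [hA, Module.End.mem_eigenspace_iff.mp hv, map_smul]
  have hinj : ∀ {A : Module.End ℂ V} (hA : ∀ v, g (A v) = A (g v)), Function.Injective A →
      Function.Injective (A.restrict (stable hA)) := fun {A} hA hi v w hvw =>
    Subtype.ext (hi (congrArg Subtype.val hvw))
  have heven : Even (Module.finrank ℂ (W H)) :=
    even_finrank_of_anticommute (hinj hrg hr) (hinj hrg' hr') fun v => Subtype.ext (hrr v.1)
  have h1 := Submodule.finrank_add_eq_of_isCompl hcompl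
  have h2 := hle H H' (fun z hz => by simpa [H'] using hz)
  have h3 := hle H' H (fun z hz => hz)
  obtain ⟨k, hk⟩ := heven
  exact ⟨k, by omega⟩

lemma mulVecLin_injective_of_orthogonal {n : Type*} [Fintype n] [DecidableEq n] {A : Matrix n n ℂ}
    (hA : Aᵀ * A = 1) : Function.Injective A.mulVecLin := by
  refine Function.LeftInverse.injective (g := Aᵀ.mulVecLin) fun v => ?_
  rw [Matrix.mulVecLin_apply, Matrix.mulVecLin_apply, Matrix.mulVec_mulVec, hA, Matrix.one_mulVec]

/-- Otherwise 4 would divide 6. Hence the lifts that commute with a member of an anticommuting pair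
do not anticommute among themselves, and only one Pauli factor can occur. -/
lemma not_anticommute_of_commute {g h r r' : Matrix (Fin 6) (Fin 6) ℂ} (hg : gᵀ * g = 1)
    (hh : hᵀ * h = 1) (hr : rᵀ * r = 1) (hr' : r'ᵀ * r' = 1)
    (hd : ⨆ μ : ℂ, Module.End.eigenspace g.mulVecLin μ = ⊤) (hgh : g * h = -(h * g))
    (hrg : r * g = g * r) (hrg' : r' * g = g * r') : r * r' ≠ -(r' * r) := by
  intro hrr
  have anti : ∀ {A B : Matrix (Fin 6) (Fin 6) ℂ}, A * B = -(B * A) → ∀ v,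
      A.mulVecLin (B.mulVecLin v) = -B.mulVecLin (A.mulVecLin v) := fun {A B} hAB v => by
    simp only [Matrix.mulVecLin_apply, Matrix.mulVec_mulVec, hAB, Matrix.neg_mulVec]
  have comm : ∀ {A B : Matrix (Fin 6) (Fin 6) ℂ}, A * B = B * A → ∀ v,
      B.mulVecLin (A.mulVecLin v) = A.mulVecLin (B.mulVecLin v) := fun {A B} hAB v => by
    simp only [Matrix.mulVecLin_apply, Matrix.mulVec_mulVec, hAB]
  have := four_dvd_finrank_of_anticommute (mulVecLin_injective_of_orthogonal hg)
    (mulVecLin_injective_of_orthogonal hh) (mulVecLin_injective_of_orthogonal hr)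
    (mulVecLin_injective_of_orthogonal hr') hd (anti hgh) (comm hrg) (comm hrg') (anti hrr)
  rw [Module.finrank_pi, Fintype.card_fin] at this
  omega

end Parity

/-! ### Frames of lines for commuting lifts -/

section Commuting

variable {n : Type*} [Fintype n] [DecidableEq n] {S : Set (Matrix n n ℂ)}

lemma transpose_replicateCol_mul (u w : n → ℂ) :
    (Matrix.replicateCol (Fin 1) u)ᵀ * Matrix.replicateCol (Fin 1) w =
      (u ⬝ᵥ w) • (1 : Matrix (Fin 1) (Fin 1) ℂ) := by
  ext i j
  rw [Subsingleton.elim i j]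
  simp [Matrix.mul_apply, dotProduct]

/-- Among two joint eigenvectors with u ⬝ᵥ w ≠ 0, a nonisotropic one can be normalized to a block of
its own; if both are isotropic, they scale to a hyperbolic pair. -/
theorem exists_isFrame_of_commute (hS : ∀ F ∈ S, Fᵀ * F = 1)
    (hd : ∀ F ∈ S, ⨆ μ : ℂ, Module.End.eigenspace F.mulVecLin μ = ⊤)
    (hc : ∀ F ∈ S, ∀ G ∈ S, F * G = G * F) :
    ∃ (κ : Type) (_ : Fintype κ) (_ : DecidableEq κ) (σ : Equiv.Perm κ) (t : κ → Unit)
      (E : κ → Matrix n (Fin 1) ℂ), IsFrame S (fun _ => 1) (fun _ => 1) σ t E ∧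
        transfer (fun _ => 1) σ t E E = 1 := by
  refine exists_isFrame hS (fun _ => mul_one 1) (fun _ => Matrix.transpose_one) ?_
  intro Q hQt hQ hQ0 hQS
  obtain ⟨u, hu, w, hw, hQu, hQw, huw⟩ :=
    exists_jointEigenvectors_dotProduct_ne_zero hd hc hQt hQ hQ0 hQS
  have hQc : ∀ v, Q *ᵥ v = v → ∀ s : ℂ, Q * Matrix.replicateCol (Fin 1) (s • v) =
      Matrix.replicateCol (Fin 1) (s • v) := by
    intro v hv s
    rw [← Matrix.replicateCol_mulVec, Matrix.mulVec_smul, hv]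
  have hb : ∀ v ∈ jointEigenvectors S, ∀ s : ℂ, ∀ F ∈ S, ∃ r : ℂ,
      F * Matrix.replicateCol (Fin 1) (s • v) =
        r • (Matrix.replicateCol (Fin 1) (s • v) * (1 : Matrix (Fin 1) (Fin 1) ℂ)) := by
    intro v hv s F hF
    obtain ⟨c, hc⟩ := hv F hF
    refine ⟨c, ?_⟩
    rw [← Matrix.replicateCol_mulVec, Matrix.mulVec_smul, hc, Matrix.mul_one, smul_comm,
      Matrix.replicateCol_smul]
  have single : ∀ v ∈ jointEigenvectors S, Q *ᵥ v = v → v ⬝ᵥ v ≠ 0 →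
      ∃ (_ : Unit) (U U' : Matrix n (Fin 1) ℂ), Q * U = U ∧ Q * U' = U' ∧
        (∀ F ∈ S, ∃ r : ℂ, F * U = r • (U * (1 : Matrix (Fin 1) (Fin 1) ℂ))) ∧ (∀ F ∈ S, ∃ r : ℂ, F * U' = r • (U' * (1 : Matrix (Fin 1) (Fin 1) ℂ))) ∧
        Uᵀ * U' = 1 ∧ (U = U' ∨ Uᵀ * U = 0 ∧ U'ᵀ * U' = 0) := by
    intro v hv hQv hvv
    obtain ⟨s, hs⟩ := IsAlgClosed.exists_eq_mul_self (v ⬝ᵥ v)⁻¹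
    refine ⟨(), _, _, hQc v hQv s, hQc v hQv s, hb v hv s, hb v hv s, ?_, Or.inl rfl⟩
    rw [transpose_replicateCol_mul, smul_dotProduct, dotProduct_smul, smul_smul, ← hs,
      smul_eq_mul, inv_mul_cancel₀ hvv, one_smul]
  by_cases huu : u ⬝ᵥ u = 0
  · by_cases hww : w ⬝ᵥ w = 0
    · refine ⟨(), _, _, hQc u hQu 1, hQc w hQw (u ⬝ᵥ w)⁻¹, hb u hu 1, hb w hw _, ?_, Or.inr ⟨?_, ?_⟩⟩
      · rw [transpose_replicateCol_mul, one_smul, dotProduct_smul, smul_eq_mul,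
          inv_mul_cancel₀ huw, one_smul]
      · rw [transpose_replicateCol_mul, one_smul, huu, zero_smul]
      · rw [transpose_replicateCol_mul, smul_dotProduct, dotProduct_smul, hww, smul_zero, smul_zero,
          zero_smul]
    · exact single w hw hQw hww
  · exact single u hu hQu huu

end Commuting

/-! ### Frames of Pauli blocks for anticommuting lifts -/

section Blocks

variable {n : Type*} [Fintype n] [DecidableEq n]

/-- The matrix with two given columns. -/
def cols (u w : n → ℂ) : Matrix n (Fin 2) ℂ := Matrix.of fun i j => ![u i, w i] j

lemma mul_cols (F : Matrix n n ℂ) (u w : n → ℂ) : F * cols u w = cols (F *ᵥ u) (F *ᵥ w) := by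
  ext i j
  fin_cases j <;> simp [cols, Matrix.mul_apply, Matrix.mulVec, dotProduct]

lemma smul_cols (c : ℂ) (u w : n → ℂ) : c • cols u w = cols (c • u) (c • w) := by
  ext i j
  fin_cases j <;> simp [cols]

lemma cols_mul (u w : n → ℂ) (a b c d : ℂ) :
    cols u w * !![a, b; c, d] = cols (a • u + c • w) (b • u + d • w) := by
  ext i j
  fin_cases j <;> simp [cols, Matrix.mul_apply] <;> ring

lemma transpose_cols_mul_cols (u w u' w' : n → ℂ) :
    (cols u w)ᵀ * cols u' w' = !![u ⬝ᵥ u', u ⬝ᵥ w'; w ⬝ᵥ u', w ⬝ᵥ w'] := by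
  ext i j
  fin_cases i <;> fin_cases j <;> simp [cols, Matrix.mul_apply, dotProduct]

/-- The Pauli matrix `diag(1, -1)`. -/
def pauliZ : Matrix (Fin 2) (Fin 2) ℂ := !![1, 0; 0, -1]

/-- The Pauli matrix exchanging the basis vectors. -/
def pauliX : Matrix (Fin 2) (Fin 2) ℂ := !![0, 1; 1, 0]

lemma pauliZ_mul_self : pauliZ * pauliZ = 1 := by
  simp [pauliZ, Matrix.one_fin_two]

lemma pauliX_mul_self : pauliX * pauliX = 1 := by
  simp [pauliX, Matrix.one_fin_two]

/-- The symmetric Pauli matrices. -/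
def formB : Fin 3 → Matrix (Fin 2) (Fin 2) ℂ := ![1, pauliZ, pauliX]

lemma formB_mul_self (a : Fin 3) : formB a * formB a = 1 := by
  fin_cases a
  · exact mul_one 1
  · exact pauliZ_mul_self
  · exact pauliX_mul_self

lemma transpose_formB (a : Fin 3) : (formB a)ᵀ = formB a := by
  fin_cases a <;> ext i j <;> fin_cases i <;> fin_cases j <;> simp [formB, pauliZ, pauliX]

/-- The Pauli matrices. -/
def paulis : Set (Matrix (Fin 2) (Fin 2) ℂ) := {1, pauliZ, pauliX, pauliX * pauliZ}

lemma paulis_commute_or {x y : Matrix (Fin 2) (Fin 2) ℂ} (hx : x ∈ paulis) (hy : y ∈ paulis) :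
    x * y = y * x ∨ x * y = -(y * x) := by
  rcases hx with rfl | rfl | rfl | rfl <;> rcases hy with rfl | rfl | rfl | rfl <;>
    simp [pauliX, pauliZ]

open Classical in
/-- The Pauli matrix by which a matrix that commutes or anticommutes with `g` and `h` acts. -/
noncomputable def pauliType (g h F : Matrix n n ℂ) : Matrix (Fin 2) (Fin 2) ℂ :=
  if F * g = g * F then if F * h = h * F then 1 else pauliZ
  else if F * h = h * F then pauliX else pauliX * pauliZ

lemma pauliType_mem (g h F : Matrix n n ℂ) : pauliType g h F ∈ paulis := by
  unfold pauliType paulis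
  split_ifs <;> simp

lemma dotProduct_mulVec_of_orthogonal {F : Matrix n n ℂ} (hF : Fᵀ * F = 1) (u w : n → ℂ) :
    (F *ᵥ u) ⬝ᵥ (F *ᵥ w) = u ⬝ᵥ w := by
  rw [Matrix.dotProduct_mulVec, ← Matrix.mulVec_transpose, Matrix.mulVec_mulVec, hF,
    Matrix.one_mulVec]

end Blocks

section Anticommuting

variable {n : Type*} [Fintype n] [DecidableEq n] {S : Set (Matrix n n ℂ)} {g h : Matrix n n ℂ}

/-- The matrices of `S` that commute with `g` and `h`. -/
def centralPart (S : Set (Matrix n n ℂ)) (g h : Matrix n n ℂ) : Set (Matrix n n ℂ) :=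
  {F ∈ S | F * g = g * F ∧ F * h = h * F}

lemma eq_smul_of_mul_eq {β : Type*} {F : Matrix n n ℂ} (hF : Fᵀ * F = 1)
    {U V : Matrix n β ℂ} {c : ℂ} (hc : c ≠ 0) (h : F * U = c • V) : Fᵀ * V = c⁻¹ • U := by
  rw [eq_inv_smul_iff₀ hc, ← Matrix.mul_smul, ← h, ← Matrix.mul_assoc, hF, Matrix.one_mul]

/-- On the columns u and c h u, g acts as a multiple of Z and h as a multiple of X. Any F in S
becomes central after multiplication by 1, g, h or g h, according to its signs with g and h, so it
acts by a multiple of the matching Pauli matrix. -/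
lemma exists_block (hS : ∀ F ∈ S, Fᵀ * F = 1)
    (hpm : ∀ F ∈ S, ∀ G ∈ S, F * G = G * F ∨ F * G = -(G * F))
    (hmul : ∀ F ∈ S, ∀ G ∈ S, F * G ∈ S) (hg : g ∈ S) (hh : h ∈ S) (hgh : g * h = -(h * g))
    {u : n → ℂ} (hu0 : u ≠ 0) (hu : u ∈ jointEigenvectors (insert g (centralPart S g h))) :
    ∃ a k c : ℂ, g *ᵥ u = a • u ∧ h *ᵥ (h *ᵥ u) = k • u ∧ c * c * k = 1 ∧
      ∀ F ∈ S, ∃ r : ℂ, F * cols u (c • h *ᵥ u) = r • (cols u (c • h *ᵥ u) * pauliType g h F) := by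
  obtain ⟨a, ha⟩ := hu g (Set.mem_insert _ _)
  -- h² commutes with g and h, so u is an eigenvector of it.
  obtain ⟨k, hk⟩ := hu (h * h) (Set.mem_insert_of_mem _ ⟨hmul h hh h hh, by
    rw [← mul_assoc g, hgh, neg_mul, mul_assoc h g, hgh]
    noncomm_ring, by rw [mul_assoc]⟩)
  rw [← Matrix.mulVec_mulVec] at hk
  have inj : ∀ {A : Matrix n n ℂ}, Aᵀ * A = 1 → A *ᵥ u = 0 → u = 0 := fun {A} hA h0 =>
    mulVecLin_injective_of_orthogonal hA (by simpa using h0)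
  have ha0 : a ≠ 0 := by
    rintro rfl
    exact hu0 (inj (hS g hg) (by rw [ha, zero_smul]))
  have hk0 : k ≠ 0 := by
    rintro rfl
    rw [zero_smul] at hk
    exact hu0 (inj (A := h * h) (hS _ (hmul h hh h hh)) (by rw [← Matrix.mulVec_mulVec, hk]))
  obtain ⟨c, hc⟩ := IsAlgClosed.exists_eq_mul_self k⁻¹
  have hck : c * c * k = 1 := by rw [← hc, inv_mul_cancel₀ hk0]
  have hc0 : c ≠ 0 := by
    rintro rfl
    simp at hck
  have hck' : c * k = c⁻¹ := by
    refine eq_inv_of_mul_eq_one_left ?_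
    linear_combination hck
  have hgU : g * cols u (c • h *ᵥ u) = a • (cols u (c • h *ᵥ u) * pauliZ) := by
    rw [pauliZ, cols_mul, mul_cols, smul_cols, Matrix.mulVec_smul, Matrix.mulVec_mulVec, hgh,
      Matrix.neg_mulVec, ← Matrix.mulVec_mulVec, ha, Matrix.mulVec_smul]
    congr 1
    · module
    · module
  have hhU : h * cols u (c • h *ᵥ u) = c⁻¹ • (cols u (c • h *ᵥ u) * pauliX) := by
    rw [pauliX, cols_mul, mul_cols, smul_cols, Matrix.mulVec_smul, hk, smul_smul, hck']
    congr 1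
    · rw [zero_smul, one_smul, zero_add, smul_smul, inv_mul_cancel₀ hc0, one_smul]
    · module
  have hRU : ∀ F ∈ centralPart S g h, ∃ r : ℂ,
      F * cols u (c • h *ᵥ u) = r • cols u (c • h *ᵥ u) := by
    intro F hF
    obtain ⟨r, hr⟩ := hu F (Set.mem_insert_of_mem _ hF)
    refine ⟨r, ?_⟩
    rw [mul_cols, smul_cols, Matrix.mulVec_smul, Matrix.mulVec_mulVec, hF.2.2,
      ← Matrix.mulVec_mulVec, hr, Matrix.mulVec_smul, smul_comm]
  set U := cols u (c • h *ᵥ u)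
  have hgU' : gᵀ * U = a⁻¹ • (U * pauliZ) := by
    refine eq_smul_of_mul_eq (hS g hg) ha0 ?_
    rw [← Matrix.mul_assoc, hgU, Matrix.smul_mul, Matrix.mul_assoc, pauliZ_mul_self, Matrix.mul_one]
  have hhU' : hᵀ * U = c • (U * pauliX) := by
    rw [← inv_inv c]
    refine eq_smul_of_mul_eq (hS h hh) (inv_ne_zero hc0) ?_
    rw [← Matrix.mul_assoc, hhU, Matrix.smul_mul, Matrix.mul_assoc, pauliX_mul_self, Matrix.mul_one]
  refine ⟨a, k, c, ha, hk, hck, fun F hF => ?_⟩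
  have hFg := hpm F hF g hg
  have hFh := hpm F hF h hh
  unfold pauliType
  split_ifs with h1 h2 h2
  · obtain ⟨r, hr⟩ := hRU F ⟨hF, h1, h2⟩
    exact ⟨r, by rw [hr, Matrix.mul_one]⟩
  · have h2' := hFh.resolve_left h2
    obtain ⟨r, hr⟩ := hRU (g * F) ⟨hmul g hg F hF, by rw [mul_assoc, h1], by
      rw [mul_assoc, h2', mul_neg, ← mul_assoc, hgh]; noncomm_ring⟩
    refine ⟨r * a⁻¹, ?_⟩
    rw [← smul_smul, ← hgU', ← Matrix.mul_smul, ← hr, ← Matrix.mul_assoc, ← mul_assoc, hS g hg,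
      one_mul]
  · have h1' := hFg.resolve_left h1
    obtain ⟨r, hr⟩ := hRU (h * F) ⟨hmul h hh F hF, by
      rw [mul_assoc, h1', mul_neg, ← mul_assoc, ← mul_assoc, hgh]; noncomm_ring,
      by rw [mul_assoc, h2]⟩
    refine ⟨r * c, ?_⟩
    rw [← smul_smul, ← hhU', ← Matrix.mul_smul, ← hr, ← Matrix.mul_assoc, ← mul_assoc, hS h hh,
      one_mul]
  · have h1' := hFg.resolve_left h1
    have h2' := hFh.resolve_left h2
    obtain ⟨r, hr⟩ := hRU (g * h * F) ⟨hmul _ (hmul g hg h hh) F hF, by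
      rw [mul_assoc, h1', mul_neg, ← mul_assoc, ← mul_assoc, ← mul_assoc, mul_assoc g h g,
        ← neg_eq_iff_eq_neg.mpr hgh]; noncomm_ring, by
      rw [mul_assoc, h2', mul_neg, ← mul_assoc, ← mul_assoc, ← mul_assoc, hgh]; noncomm_ring⟩
    refine ⟨r * (a⁻¹ * c), ?_⟩
    have h3 : (g * h)ᵀ * U = (a⁻¹ * c) • (U * (pauliX * pauliZ)) := by
      rw [Matrix.transpose_mul, Matrix.mul_assoc, hgU', Matrix.mul_smul,
        ← Matrix.mul_assoc, hhU', Matrix.smul_mul, Matrix.mul_assoc, smul_smul]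
    rw [← smul_smul, ← h3, ← Matrix.mul_smul, ← hr, ← Matrix.mul_assoc, ← mul_assoc,
      hS _ (hmul g hg h hh), one_mul]

end Anticommuting

section AnticommutingFrame

variable {S : Set (Matrix (Fin 6) (Fin 6) ℂ)} {g h : Matrix (Fin 6) (Fin 6) ℂ}

/-- Let u, w be joint eigenvectors with u ⬝ᵥ w ≠ 0. Orthogonality of g and h makes the Gram matrix
of their blocks a multiple of diag(1, ±1), that is, of 1 or Z. An isotropic u with u ⬝ᵥ h u ≠ 0 has
a block with Gram matrix a multiple of X. If neither u nor w gives a nondegenerate block, both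
blocks are totally isotropic and form a dual pair. -/
theorem exists_isFrame_of_anticommute (hS : ∀ F ∈ S, Fᵀ * F = 1)
    (hd : ∀ F ∈ S, ⨆ μ : ℂ, Module.End.eigenspace F.mulVecLin μ = ⊤)
    (hpm : ∀ F ∈ S, ∀ G ∈ S, F * G = G * F ∨ F * G = -(G * F))
    (hmul : ∀ F ∈ S, ∀ G ∈ S, F * G ∈ S) (hg : g ∈ S) (hh : h ∈ S) (hgh : g * h = -(h * g)) :
    ∃ (κ : Type) (_ : Fintype κ) (_ : DecidableEq κ) (σ : Equiv.Perm κ) (t : κ → Fin 3)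
      (E : κ → Matrix (Fin 6) (Fin 2) ℂ), IsFrame S (pauliType g h) formB σ t E ∧
        transfer formB σ t E E = 1 := by
  -- Besides the central part, g is diagonalized too, and the parity argument makes this family
  -- commutative.
  have hRS : insert g (centralPart S g h) ⊆ S := Set.insert_subset hg fun F hF => hF.1
  have hRc : ∀ F ∈ insert g (centralPart S g h), ∀ G ∈ insert g (centralPart S g h),
      F * G = G * F := by
    rintro F (rfl | hF) G (rfl | hG)
    · rfl
    · exact hG.2.1.symm
    · exact hF.2.1
    · exact (hpm F hF.1 G hG.1).resolve_right (not_anticommute_of_commute (hS g hg) (hS h hh)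
        (hS F hF.1) (hS G hG.1) (hd g hg) hgh hF.2.1 hG.2.1)
  refine exists_isFrame hS formB_mul_self transpose_formB ?_
  intro Q hQt hQ hQ0 hQS
  obtain ⟨u, hu, w, hw, hQu, hQw, huw⟩ := exists_jointEigenvectors_dotProduct_ne_zero
    (fun F hF => hd F (hRS hF)) hRc hQt hQ hQ0 (fun F hF => hQS F (hRS hF))
  have hu0 : u ≠ 0 := by rintro rfl; simp at huw
  have hw0 : w ≠ 0 := by rintro rfl; simp at huw
  have hQc : ∀ v, Q *ᵥ v = v → ∀ s c : ℂ, Q * (s • cols v (c • h *ᵥ v)) =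
      s • cols v (c • h *ᵥ v) := by
    intro v hv s c
    rw [Matrix.mul_smul, mul_cols, Matrix.mulVec_smul, Matrix.mulVec_mulVec, ← hQS h hh,
      ← Matrix.mulVec_mulVec, hv]
  have hb : ∀ (s : ℂ) (U : Matrix (Fin 6) (Fin 2) ℂ),
      (∀ F ∈ S, ∃ r : ℂ, F * U = r • (U * pauliType g h F)) →
      ∀ F ∈ S, ∃ r : ℂ, F * (s • U) = r • ((s • U) * pauliType g h F) := by
    intro s U hU F hF
    obtain ⟨r, hr⟩ := hU F hF
    exact ⟨r, by rw [Matrix.mul_smul, hr, Matrix.smul_mul, smul_comm]⟩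
  have gram : ∀ {v w : Fin 6 → ℂ} {a k c a' k' c' : ℂ}, g *ᵥ v = a • v → g *ᵥ w = a' • w →
      h *ᵥ (h *ᵥ v) = k • v → h *ᵥ (h *ᵥ w) = k' • w → c * c * k = 1 → c' * c' * k' = 1 →
      v ⬝ᵥ w ≠ 0 → ∃ b : Fin 3,
        (cols v (c • h *ᵥ v))ᵀ * cols w (c' • h *ᵥ w) = (v ⬝ᵥ w) • formB b := by
    intro v w a k c a' k' c' hv hw hkv hkw hck hck' hvw
    have e1 : a * a' = 1 := by
      have := dotProduct_mulVec_of_orthogonal (hS g hg) v w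
      rw [hv, hw, smul_dotProduct, dotProduct_smul, smul_eq_mul, smul_eq_mul] at this
      refine mul_right_cancel₀ hvw ?_
      linear_combination this
    have hgh' : ∀ v, g *ᵥ (h *ᵥ v) = -(h *ᵥ (g *ᵥ v)) := fun v => by
      rw [Matrix.mulVec_mulVec, hgh, Matrix.neg_mulVec, Matrix.mulVec_mulVec]
    have e2 : v ⬝ᵥ h *ᵥ w = 0 := by
      have := dotProduct_mulVec_of_orthogonal (hS g hg) v (h *ᵥ w)
      rw [hv, hgh', hw, Matrix.mulVec_smul, smul_dotProduct, dotProduct_neg, dotProduct_smul,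
        smul_eq_mul, smul_eq_mul] at this
      linear_combination (-1 / 2 : ℂ) * this - (1 / 2 : ℂ) * (v ⬝ᵥ h *ᵥ w) * e1
    have e3 : (h *ᵥ v) ⬝ᵥ w = 0 := by
      have := dotProduct_mulVec_of_orthogonal (hS g hg) (h *ᵥ v) w
      rw [hw, hgh', hv, Matrix.mulVec_smul, dotProduct_smul, neg_dotProduct, smul_dotProduct,
        smul_eq_mul, smul_eq_mul] at this
      linear_combination (-1 / 2 : ℂ) * this - (1 / 2 : ℂ) * ((h *ᵥ v) ⬝ᵥ w) * e1
    have e4 : (h *ᵥ v) ⬝ᵥ (h *ᵥ w) = v ⬝ᵥ w := dotProduct_mulVec_of_orthogonal (hS h hh) v w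
    have e5 : k * k' = 1 := by
      have := dotProduct_mulVec_of_orthogonal (hS h hh) (h *ᵥ v) (h *ᵥ w)
      rw [hkv, hkw, smul_dotProduct, dotProduct_smul, e4, smul_eq_mul, smul_eq_mul] at this
      refine mul_right_cancel₀ hvw ?_
      linear_combination this
    have e6 : (c * c') * (c * c') = 1 := by
      linear_combination (-(c * c * c' * c')) * e5 + c' * c' * k' * hck + hck'
    have e7 : (cols v (c • h *ᵥ v))ᵀ * cols w (c' • h *ᵥ w) =
        (v ⬝ᵥ w) • !![1, 0; 0, c * c'] := by
      rw [transpose_cols_mul_cols]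
      ext i j
      fin_cases i <;> fin_cases j <;> simp [e2, e3, e4]
      ring
    rcases mul_self_eq_one_iff.mp e6 with h7 | h7
    · exact ⟨0, by rw [e7, h7, formB, ← Matrix.one_fin_two]; rfl⟩
    · exact ⟨1, by rw [e7, h7]; rfl⟩
  have single : ∀ {U : Matrix (Fin 6) (Fin 2) ℂ} {d : ℂ} {b : Fin 3}, d ≠ 0 →
      Uᵀ * U = d • formB b → ∃ s : ℂ, (s • U)ᵀ * (s • U) = formB b := by
    intro U d b hd0 hU
    obtain ⟨s, hs⟩ := IsAlgClosed.exists_eq_mul_self d⁻¹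
    refine ⟨s, ?_⟩
    rw [Matrix.transpose_smul, Matrix.smul_mul, Matrix.mul_smul, hU, smul_smul, smul_smul,
      ← hs, inv_mul_cancel₀ hd0, one_smul]
  have isotropic : ∀ {v : Fin 6 → ℂ} (c : ℂ), v ⬝ᵥ v = 0 →
      (cols v (c • h *ᵥ v))ᵀ * cols v (c • h *ᵥ v) = (c * (v ⬝ᵥ h *ᵥ v)) • formB 2 := by
    intro v c hv
    have e4 : (h *ᵥ v) ⬝ᵥ (h *ᵥ v) = 0 :=
      (dotProduct_mulVec_of_orthogonal (hS h hh) v v).trans hv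
    rw [transpose_cols_mul_cols]
    ext i j
    fin_cases i <;> fin_cases j <;> simp [formB, pauliX, hv, e4, dotProduct_comm (h *ᵥ v)]
  have one : ∀ {v : Fin 6 → ℂ}, Q *ᵥ v = v → v ≠ 0 →
      v ∈ jointEigenvectors (insert g (centralPart S g h)) →
      (v ⬝ᵥ v ≠ 0 ∨ v ⬝ᵥ v = 0 ∧ v ⬝ᵥ h *ᵥ v ≠ 0) →
      ∃ (b : Fin 3) (U U' : Matrix (Fin 6) (Fin 2) ℂ), Q * U = U ∧ Q * U' = U' ∧
        (∀ F ∈ S, ∃ r : ℂ, F * U = r • (U * pauliType g h F)) ∧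
        (∀ F ∈ S, ∃ r : ℂ, F * U' = r • (U' * pauliType g h F)) ∧
        Uᵀ * U' = formB b ∧ (U = U' ∨ Uᵀ * U = 0 ∧ U'ᵀ * U' = 0) := by
    intro v hQv hv0 hv hor
    obtain ⟨a, k, c, ha, hk, hck, hbl⟩ := exists_block hS hpm hmul hg hh hgh hv0 hv
    have : ∃ (b : Fin 3) (s : ℂ),
        (s • cols v (c • h *ᵥ v))ᵀ * (s • cols v (c • h *ᵥ v)) = formB b := by
      rcases hor with hvv | ⟨hvv, hvh⟩
      · obtain ⟨b, hbb⟩ := gram ha ha hk hk hck hck hvv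
        exact ⟨b, single hvv hbb⟩
      · have hc0 : c ≠ 0 := by rintro rfl; simp at hck
        exact ⟨2, single (mul_ne_zero hc0 hvh) (isotropic c hvv)⟩
    obtain ⟨b, s, hbs⟩ := this
    exact ⟨b, _, _, hQc v hQv s c, hQc v hQv s c, hb s _ hbl, hb s _ hbl, hbs, Or.inl rfl⟩
  by_cases hou : u ⬝ᵥ u ≠ 0 ∨ u ⬝ᵥ u = 0 ∧ u ⬝ᵥ h *ᵥ u ≠ 0
  · exact one hQu hu0 hu hou
  by_cases how : w ⬝ᵥ w ≠ 0 ∨ w ⬝ᵥ w = 0 ∧ w ⬝ᵥ h *ᵥ w ≠ 0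
  · exact one hQw hw0 hw how
  have iso : ∀ {v : Fin 6 → ℂ} (c s : ℂ), ¬ (v ⬝ᵥ v ≠ 0 ∨ v ⬝ᵥ v = 0 ∧ v ⬝ᵥ h *ᵥ v ≠ 0) →
      (s • cols v (c • h *ᵥ v))ᵀ * (s • cols v (c • h *ᵥ v)) = 0 := by
    intro v c s hv
    have h1 : v ⬝ᵥ v = 0 := by tauto
    have h2 : v ⬝ᵥ h *ᵥ v = 0 := by tauto
    rw [Matrix.transpose_smul, Matrix.smul_mul, Matrix.mul_smul, isotropic c h1, h2, mul_zero,
      zero_smul, smul_zero, smul_zero]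
  obtain ⟨a, k, c, ha, hk, hck, hbl⟩ := exists_block hS hpm hmul hg hh hgh hu0 hu
  obtain ⟨a', k', c', ha', hk', hck', hbl'⟩ := exists_block hS hpm hmul hg hh hgh hw0 hw
  obtain ⟨b, hbb⟩ := gram ha ha' hk hk' hck hck' huw
  refine ⟨b, _, _, hQc u hQu 1 c, hQc w hQw (u ⬝ᵥ w)⁻¹ c', hb _ _ hbl, hb _ _ hbl', ?_,
    Or.inr ⟨iso c _ hou, iso c' _ how⟩⟩
  rw [one_smul, Matrix.mul_smul, hbb, smul_smul, inv_mul_cancel₀ huw, one_smul]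

end AnticommutingFrame

/-! ### Normalization of frames and the eight types -/

section Moves

variable {n β T : Type*} [Fintype n] [DecidableEq n] [Fintype β] [DecidableEq β]
  {S : Set (Matrix n n ℂ)} {x : Matrix n n ℂ → Matrix β β ℂ} {B : T → Matrix β β ℂ}
  {κ : Type*} [DecidableEq κ] [Fintype κ] {σ : Equiv.Perm κ} {t t' : κ → T} {E : κ → Matrix n β ℂ}

lemma IsFrame.card_eq (h : IsFrame S x B σ t E) (hB : ∀ a, B a * B a = 1)
    (h1 : transfer B σ t E E = 1) : Fintype.card κ * Fintype.card β = Fintype.card n := by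
  have := h.trace_transfer hB
  rw [h1, Matrix.trace_one] at this
  exact_mod_cast this.symm

lemma IsFrame.transfer_eq_one (h : IsFrame S x B σ t E) (hB : ∀ a, B a * B a = 1)
    (hc : Fintype.card κ * Fintype.card β = Fintype.card n) : transfer B σ t E E = 1 := by
  have h1 : IsIdempotentElem (Matrix.toLin' (1 - transfer B σ t E E)) := by
    rw [IsIdempotentElem, Module.End.mul_eq_comp, ← Matrix.toLin'_mul, sub_mul, one_mul, mul_sub,
      mul_one, h.transfer_idem hB, sub_self, sub_zero]
  have h2 := LinearMap.IsIdempotentElem.eq_zero_of_trace_eq_zero h1 (by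
    rw [Matrix.trace_toLin'_eq, Matrix.trace_sub, Matrix.trace_one, h.trace_transfer hB, ← hc]
    push_cast
    ring)
  exact (sub_eq_zero.mp ((LinearEquiv.map_eq_zero_iff _).mp h2)).symm

/-- A change of basis inside each block, subject to the new Gram matrices being of the allowed kind
and the action being y F up to scalars. -/
lemma IsFrame.mul_right (h : IsFrame S x B σ t E) {y : Matrix n n ℂ → Matrix β β ℂ}
    (K : κ → Matrix β β ℂ) (ht : ∀ i, t' (σ i) = t' i)
    (hK : ∀ i, (K i)ᵀ * B (t i) * K (σ i) = B (t' i))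
    (hy : ∀ i, ∀ F ∈ S, ∃ c : ℂ, x F * K i = c • (K i * y F)) :
    IsFrame S y B σ t' fun i => E i * K i where
  invol := h.invol
  label := ht
  gram i j := by
    rw [Matrix.transpose_mul, Matrix.mul_assoc, ← Matrix.mul_assoc (E i)ᵀ, h.gram]
    split_ifs with hij
    · rw [hij, ← Matrix.mul_assoc, hK]
    · rw [Matrix.zero_mul, Matrix.mul_zero]
  block i F hF := by
    obtain ⟨r, hr⟩ := h.block i F hF
    obtain ⟨c, hc⟩ := hy i F hF
    refine ⟨r * c, ?_⟩
    rw [← Matrix.mul_assoc, hr, Matrix.smul_mul, Matrix.mul_assoc, hc, Matrix.mul_smul, smul_smul,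
      Matrix.mul_assoc]

end Moves

section Types

variable {𝒢 ℋ : Set (Sl4 ≃ₗ⁅ℂ⁆ Sl4)}

/-- The lifts have a common eigenbasis, of which `k` pairs are isotropic. -/
def HasEigenframe (k : ℕ) (ℋ : Set (Sl4 ≃ₗ⁅ℂ⁆ Sl4)) : Prop :=
  ∃ (σ : Equiv.Perm (Fin 6)) (E : Fin 6 → Matrix (Fin 6) (Fin 1) ℂ),
    σ.cycleType = Multiset.replicate k 2 ∧
      IsFrame (lifts ℋ) (fun _ => 1) (fun _ : Unit => 1) σ (fun _ => ()) E

/-- The lifts act by Pauli matrices on the blocks of a frame of the given shape. -/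
def HasPauliFrame (σ : Equiv.Perm (Fin 3)) (t : Fin 3 → Fin 3) (ℋ : Set (Sl4 ≃ₗ⁅ℂ⁆ Sl4)) : Prop :=
  ∃ (x : Matrix (Fin 6) (Fin 6) ℂ → Matrix (Fin 2) (Fin 2) ℂ) (E : Fin 3 → Matrix (Fin 6) (Fin 2) ℂ),
    (∀ F, x F ∈ paulis) ∧ IsFrame (lifts ℋ) x formB σ t E

/-- Permutations of equal cycle type are conjugate, so after reindexing both frames have the same
shape. -/
lemma HasEigenframe.conjugate {k : ℕ} (h𝒢 : IsMADGroup 𝒢) (hℋ : IsMADGroup ℋ)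
    (h : HasEigenframe k 𝒢) (h' : HasEigenframe k ℋ) : Conjugate 𝒢 ℋ := by
  obtain ⟨σ, E, hσ, hE⟩ := h
  obtain ⟨σ', E', hσ', hE'⟩ := h'
  obtain ⟨ε, rfl⟩ := isConj_iff.mp (Equiv.Perm.isConj_iff_cycleType_eq.mpr (hσ.trans hσ'.symm))
  have hB : ∀ _ : Unit, (1 : Matrix (Fin 1) (Fin 1) ℂ) * 1 = 1 := fun _ => mul_one 1
  have hE2 := hE.reindex ε
  exact conjugate_of_isFrame h𝒢 hℋ hB (fun _ => Matrix.transpose_one) hE2 hE'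
    (hE2.transfer_eq_one hB (by simp)) (hE'.transfer_eq_one hB (by simp))
    fun _ _ _ _ => Or.inl rfl

lemma HasPauliFrame.conjugate {σ : Equiv.Perm (Fin 3)} {t : Fin 3 → Fin 3} (h𝒢 : IsMADGroup 𝒢)
    (hℋ : IsMADGroup ℋ) (h : HasPauliFrame σ t 𝒢) (h' : HasPauliFrame σ t ℋ) : Conjugate 𝒢 ℋ := by
  obtain ⟨x, E, hx, hE⟩ := h
  obtain ⟨x', E', hx', hE'⟩ := h'
  exact conjugate_of_isFrame h𝒢 hℋ formB_mul_self transpose_formB hE hE'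
    (hE.transfer_eq_one formB_mul_self (by simp)) (hE'.transfer_eq_one formB_mul_self (by simp))
    fun F _ G _ => paulis_commute_or (hx F) (hx' G)

lemma HasPauliFrame.reindex {σ : Equiv.Perm (Fin 3)} {t : Fin 3 → Fin 3} (h : HasPauliFrame σ t ℋ)
    (ε : Equiv.Perm (Fin 3)) : HasPauliFrame (ε * σ * ε⁻¹) (t ∘ ε.symm) ℋ := by
  obtain ⟨x, E, hx, hE⟩ := h
  exact ⟨x, _, hx, hE.reindex ε⟩

/-- For a dual pair of blocks the label carries no information: multiplying one of the two blocks by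
a product of forms changes it, and the Pauli action survives because Pauli matrices commute up to
sign. -/
lemma HasPauliFrame.relabel {σ : Equiv.Perm (Fin 3)} {t t' : Fin 3 → Fin 3}
    (h : HasPauliFrame σ t ℋ) (ht : ∀ i, t' (σ i) = t' i) (hfix : ∀ i, σ i = i → t' i = t i) :
    HasPauliFrame σ t' ℋ := by
  obtain ⟨x, E, hx, hE⟩ := h
  refine ⟨x, _, hx, hE.mul_right (t' := t')
    -- Only the block of larger index in the pair is changed.
    (fun i => if σ i < i then formB (t i) * formB (t' i) else 1) ht (fun i => ?_) fun i F _ => ?_⟩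
  · rw [hE.invol, hE.label, ht]
    rcases lt_trichotomy (σ i) i with hi | hi | hi
    · rw [if_pos hi, if_neg hi.not_gt, Matrix.transpose_mul, transpose_formB, transpose_formB,
        mul_assoc (formB (t' i)), formB_mul_self, mul_one, mul_one]
    · rw [if_neg hi.not_lt, if_neg hi.symm.not_lt, hfix i hi]
      simp
    · rw [if_neg hi.not_gt, if_pos hi, Matrix.transpose_one, one_mul, ← mul_assoc, formB_mul_self,
        one_mul]
  · have hf : ∀ a, formB a ∈ paulis := by
      intro a
      fin_cases a <;> simp [formB, paulis]
    have hpm : ∀ a, ∃ c : ℂ, x F * formB a = c • (formB a * x F) := fun a => by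
      rcases paulis_commute_or (hx F) (hf a) with h | h
      · exact ⟨1, by rw [h, one_smul]⟩
      · exact ⟨-1, by rw [h, neg_one_smul]⟩
    split_ifs
    · obtain ⟨c, hc⟩ := hpm (t i)
      obtain ⟨d, hd⟩ := hpm (t' i)
      refine ⟨c * d, ?_⟩
      rw [← mul_assoc, hc, Matrix.smul_mul, mul_assoc, hd, Matrix.mul_smul, smul_smul, mul_assoc]
    · exact ⟨1, by simp⟩

/-- A Clifford matrix K permutes the Pauli matrices up to scalars by conjugation and the three
symmetric forms by congruence; square roots absorb the factors d. -/
lemma HasPauliFrame.clifford {σ : Equiv.Perm (Fin 3)} {t : Fin 3 → Fin 3} (h : HasPauliFrame σ t ℋ)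
    (π : Fin 3 → Fin 3) (K : Matrix (Fin 2) (Fin 2) ℂ) (d : Fin 3 → ℂ) (hd : ∀ a, d a ≠ 0)
    (hK : ∀ a, Kᵀ * formB a * K = d a • formB (π a))
    (hp : ∀ p ∈ paulis, ∃ q ∈ paulis, ∃ c : ℂ, p * K = c • (K * q)) : HasPauliFrame σ (π ∘ t) ℋ := by
  obtain ⟨x, E, hx, hE⟩ := h
  choose! f hf hf' using hp
  choose s hs using fun a => IsAlgClosed.exists_eq_mul_self (d a)⁻¹
  refine ⟨fun F => f (x F), _, fun F => hf _ (hx F), hE.mul_right (t' := π ∘ t)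
    (fun i => s (t i) • K) (fun i => ?_) (fun i => ?_) fun i F _ => ?_⟩
  · rw [Function.comp_apply, Function.comp_apply, hE.label]
  · rw [hE.label, Matrix.transpose_smul, Matrix.smul_mul, Matrix.smul_mul, Matrix.mul_smul, hK,
      smul_smul, smul_smul, ← hs, inv_mul_cancel₀ (hd _), one_smul]
    rfl
  · obtain ⟨c, hc⟩ := hf' _ (hx F)
    exact ⟨c, by rw [Matrix.mul_smul, hc, Matrix.smul_mul, smul_comm]⟩

lemma HasPauliFrame.swap_zero_one {σ : Equiv.Perm (Fin 3)} {t : Fin 3 → Fin 3}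
    (h : HasPauliFrame σ t ℋ) : HasPauliFrame σ (Equiv.swap 0 1 ∘ t) ℋ := by
  have h2 : (Equiv.swap (0 : Fin 3) 1) 2 = 2 := by decide
  -- The phase gate exchanges the forms 1 and Z.
  refine h.clifford _ !![1, 0; 0, Complex.I] ![1, 1, Complex.I] (fun a => ?_) (fun a => ?_) ?_
  · fin_cases a <;> simp
  · fin_cases a <;> ext i j <;> fin_cases i <;> fin_cases j <;>
      simp [formB, pauliZ, pauliX, Matrix.mul_apply, h2]
  · rintro p (rfl | rfl | rfl | rfl)
    · exact ⟨1, by simp [paulis], 1, by simp⟩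
    · exact ⟨pauliZ, by simp [paulis], 1, by simp [pauliZ]⟩
    · exact ⟨pauliX * pauliZ, by simp [paulis], -Complex.I, by simp [pauliZ, pauliX]⟩
    · exact ⟨pauliX, by simp [paulis], -Complex.I, by simp [pauliZ, pauliX]⟩

lemma HasPauliFrame.swap_one_two {σ : Equiv.Perm (Fin 3)} {t : Fin 3 → Fin 3}
    (h : HasPauliFrame σ t ℋ) : HasPauliFrame σ (Equiv.swap 1 2 ∘ t) ℋ := by
  -- The unnormalized Hadamard gate exchanges Z and X.
  refine h.clifford _ !![1, 1; 1, -1] ![2, 2, 2] (fun a => ?_) (fun a => ?_) ?_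
  · fin_cases a <;> simp
  · have : (Equiv.swap (1 : Fin 3) 2) 0 = 0 := by decide
    fin_cases a <;> ext i j <;> fin_cases i <;> fin_cases j <;>
      simp [formB, pauliZ, pauliX, Matrix.mul_apply, this] <;> norm_num
  · rintro p (rfl | rfl | rfl | rfl)
    · exact ⟨1, by simp [paulis], 1, by simp⟩
    · exact ⟨pauliX, by simp [paulis], 1, by simp [pauliZ, pauliX]⟩
    · exact ⟨pauliZ, by simp [paulis], 1, by simp [pauliZ, pauliX]⟩
    · exact ⟨pauliX * pauliZ, by simp [paulis], -1, by simp [pauliZ, pauliX]⟩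

lemma HasPauliFrame.perm {σ : Equiv.Perm (Fin 3)} {t : Fin 3 → Fin 3}
    (h : HasPauliFrame σ t ℋ) (π : Equiv.Perm (Fin 3)) : HasPauliFrame σ (π ∘ t) ℋ := by
  have hπ : ∀ π : Equiv.Perm (Fin 3), π = 1 ∨ π = Equiv.swap 0 1 ∨ π = Equiv.swap 1 2 ∨
      π = Equiv.swap 0 1 * Equiv.swap 1 2 ∨ π = Equiv.swap 1 2 * Equiv.swap 0 1 ∨
      π = Equiv.swap 0 1 * (Equiv.swap 1 2 * Equiv.swap 0 1) := by decide
  rcases hπ π with rfl | rfl | rfl | rfl | rfl | rfl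
  · exact h
  · exact h.swap_zero_one
  · exact h.swap_one_two
  · exact h.swap_one_two.swap_zero_one
  · exact h.swap_zero_one.swap_one_two
  · exact h.swap_zero_one.swap_one_two.swap_zero_one

/-- The eight kinds of maximal abelian groups of diagonalizable automorphisms. -/
def madType : Fin 8 → Set (Sl4 ≃ₗ⁅ℂ⁆ Sl4) → Prop :=
  ![HasEigenframe 0, HasEigenframe 1, HasEigenframe 2, HasEigenframe 3, HasPauliFrame 1 ![0, 0, 0],
    HasPauliFrame 1 ![0, 0, 1], HasPauliFrame 1 ![0, 1, 2], HasPauliFrame (Equiv.swap 0 1) ![0, 0, 0]]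

theorem conjugate_of_madType {k : Fin 8} (h𝒢 : IsMADGroup 𝒢) (hℋ : IsMADGroup ℋ)
    (h : madType k 𝒢) (h' : madType k ℋ) : Conjugate 𝒢 ℋ := by
  fin_cases k
  iterate 4 exact HasEigenframe.conjugate h𝒢 hℋ h h'
  all_goals exact HasPauliFrame.conjugate h𝒢 hℋ h h'

/-- Up to permutations of blocks and of labels, three unpaired blocks are determined by the number
of distinct labels. If two blocks are paired, their label is free and is chosen equal to that of the
third. -/
lemma HasPauliFrame.exists_madType {σ : Equiv.Perm (Fin 3)} {t : Fin 3 → Fin 3}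
    (h : HasPauliFrame σ t ℋ) (hσ : σ * σ = 1) : ∃ k, madType k ℋ := by
  by_cases h1 : σ = 1
  · subst h1
    have key : ∀ a b c : Fin 3, ∃ ε π : Equiv.Perm (Fin 3),
        ⇑π ∘ ![a, b, c] ∘ ε.symm = ![0, 0, 0] ∨ ⇑π ∘ ![a, b, c] ∘ ε.symm = ![0, 0, 1] ∨
          ⇑π ∘ ![a, b, c] ∘ ε.symm = ![0, 1, 2] := by decide
    obtain ⟨ε, π, h2⟩ := key (t 0) (t 1) (t 2)
    have h3 := (h.reindex ε).perm π
    have ht : t = ![t 0, t 1, t 2] := by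
      funext i
      fin_cases i <;> rfl
    rw [mul_one, mul_inv_cancel, ht] at h3
    rcases h2 with h2 | h2 | h2 <;> rw [h2] at h3
    · exact ⟨4, h3⟩
    · exact ⟨5, h3⟩
    · exact ⟨6, h3⟩
  · have key : ∀ σ : Equiv.Perm (Fin 3), σ * σ = 1 → σ ≠ 1 → ∃ i : Fin 3,
        (∀ j, σ j = j → j = i) ∧ ∃ ε : Equiv.Perm (Fin 3), ε * σ * ε⁻¹ = Equiv.swap 0 1 := by decide
    obtain ⟨i, hi, ε, hε⟩ := key σ hσ h1
    have h2 := ((h.relabel (t' := fun _ => t i) (fun _ => rfl)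
      (fun j hj => by rw [hi j hj])).reindex ε).perm (Equiv.swap (t i) 0)
    have ht : ⇑(Equiv.swap (t i) 0) ∘ (fun _ => t i) ∘ ε.symm = (![0, 0, 0] : Fin 3 → Fin 3) := by
      funext j
      fin_cases j <;> simp
    rw [hε, ht] at h2
    exact ⟨7, h2⟩

theorem IsMADGroup.exists_madType (hℋ : IsMADGroup ℋ) : ∃ k, madType k ℋ := by
  by_cases hc : ∀ F ∈ lifts ℋ, ∀ G ∈ lifts ℋ, F * G = G * F
  · obtain ⟨κ, _, _, σ, t, E, hE, h1⟩ := exists_isFrame_of_commute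
      (fun F hF => orthogonal_of_mem_lifts hF) (fun F hF => hℋ.iSup_eigenspace_of_mem_lifts hF) hc
    have hcard : Fintype.card κ = 6 := by simpa using hE.card_eq (fun _ => mul_one 1) h1
    have hE2 := hE.reindex (Fintype.equivFinOfCardEq hcard)
    set τ : Equiv.Perm (Fin 6) := ((Fintype.equivFinOfCardEq hcard).symm.trans σ).trans
      (Fintype.equivFinOfCardEq hcard)
    have hτ : τ ^ 2 = 1 := Equiv.ext fun i => by rw [pow_two]; exact hE2.invol i
    -- An involution has only cycles of length two, at most three of them on six points.
    have hct : τ.cycleType = Multiset.replicate (Multiset.card τ.cycleType) 2 := by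
      refine Multiset.eq_replicate_card.mpr fun m hm => ?_
      have h2 := (Equiv.Perm.dvd_of_mem_cycleType hm).trans (orderOf_dvd_of_pow_eq_one hτ)
      have h3 := Equiv.Perm.two_le_of_mem_cycleType hm
      have := Nat.le_of_dvd (by norm_num) h2
      omega
    have hle : Multiset.card τ.cycleType < 4 := by
      have h2 := τ.sum_cycleType
      rw [hct, Multiset.sum_replicate, smul_eq_mul] at h2
      have h3 := τ.support.card_le_univ
      rw [Fintype.card_fin] at h3
      omega
    have hk : HasEigenframe (Multiset.card τ.cycleType) ℋ := ⟨τ, _, hct, hE2⟩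
    interval_cases Multiset.card τ.cycleType
    · exact ⟨0, hk⟩
    · exact ⟨1, hk⟩
    · exact ⟨2, hk⟩
    · exact ⟨3, hk⟩
  · push Not at hc
    obtain ⟨g, hg, h, hh, hgh⟩ := hc
    obtain ⟨κ, _, _, σ, t, E, hE, h1⟩ := exists_isFrame_of_anticommute
      (fun F hF => orthogonal_of_mem_lifts hF) (fun F hF => hℋ.iSup_eigenspace_of_mem_lifts hF)
      (fun F hF G hG => hℋ.commute_or_of_mem_lifts hF hG) (fun F hF G hG => hℋ.mul_mem_lifts hF hG)
      hg hh ((hℋ.commute_or_of_mem_lifts hg hh).resolve_left hgh)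
    have hcard : Fintype.card κ = 3 := by
      have := hE.card_eq formB_mul_self h1
      rw [Fintype.card_fin, Fintype.card_fin] at this
      omega
    have hE2 := hE.reindex (Fintype.equivFinOfCardEq hcard)
    exact HasPauliFrame.exists_madType ⟨_, _, pauliType_mem g h, hE2⟩
      (Equiv.ext fun i => hE2.invol i)

/-- Pigeonhole: equal types imply conjugacy, so eight nonconjugate MAD-groups realize all eight
types. -/
theorem IsCompleteMADList.of_not_conjugate {𝒢 : Fin 8 → Set (Sl4 ≃ₗ⁅ℂ⁆ Sl4)}
    (h𝒢 : ∀ i, IsMADGroup (𝒢 i)) (hc : ∀ i j, i ≠ j → ¬ Conjugate (𝒢 i) (𝒢 j)) :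
    IsCompleteMADList 𝒢 := by
  choose k hk using fun i => (h𝒢 i).exists_madType
  have hinj : Function.Injective k := fun i j hij => by
    by_contra hne
    exact hc i j hne (conjugate_of_madType (h𝒢 i) (h𝒢 j) (hk i) (hij ▸ hk j))
  refine ⟨h𝒢, hc, fun ℋ hℋ => ?_⟩
  obtain ⟨l, hl⟩ := hℋ.exists_madType
  obtain ⟨i, rfl⟩ := Finite.surjective_of_injective hinj l
  exact ⟨i, conjugate_of_madType hℋ (h𝒢 i) hl (hk i)⟩

end Types

/-! ### A criterion for fineness and two invariants of gradings -/

section Fine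

variable {L : Type*} [LieRing L] [LieAlgebra ℂ L] [FiniteDimensional ℂ L]

/-- A refinement can only split U₀. If two of its pieces inside U₀ both act nontrivially from a line
V to a line W, then both have degree deg W / deg V and so coincide. -/
lemma isFineGroupGrading_of_lines {Γ : Set (Submodule ℂ L)} (hΓ : IsGroupGrading Γ)
    {U₀ : Submodule ℂ L} (h₀ : U₀ ∈ Γ) (hline : ∀ U ∈ Γ, U ≠ U₀ → Module.finrank ℂ U = 1)
    (htest : ∀ u ∈ U₀, ∀ u' ∈ U₀, u ≠ 0 → u' ≠ 0 → Module.finrank ℂ U₀ = 1 ∨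
      ∃ V ∈ Γ, V ≠ U₀ ∧ ∃ W ∈ Γ, W ≠ U₀ ∧ BracketLE U₀ V W ∧ ∃ x ∈ V, ⁅u, x⁆ ≠ 0 ∧ ⁅u', x⁆ ≠ 0) :
    IsFineGroupGrading Γ := by
  refine ⟨hΓ, fun Δ hΔ hr => ?_⟩
  have exists_le : ∀ U ∈ Γ, ∃ V ∈ Δ, V ≤ U := by
    intro U hU
    by_contra hcon
    push Not at hcon
    have h1 : {V ∈ Δ | V ≤ U} = ∅ := Set.eq_empty_of_forall_notMem fun V hV => hcon V hV.1 hV.2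
    have h2 := hr.2 U hU
    rw [h1, sSup_empty] at h2
    exact hΓ.1.ne_bot U hU h2.symm
  have mem_of_line : ∀ U ∈ Γ, Module.finrank ℂ U = 1 → U ∈ Δ := by
    intro U hU h1
    obtain ⟨V, hV, hVU⟩ := exists_le U hU
    have h2 : Module.finrank ℂ V ≠ 0 := fun h => hΔ.1.ne_bot V hV (Submodule.finrank_eq_zero.mp h)
    have h3 := Submodule.eq_of_le_of_finrank_le hVU (by omega)
    exact h3 ▸ hV
  refine (eq_of_subset_of_sSupIndep (fun U hU => ?_) hΓ.1.sSup_eq_top hΔ.1.indep hΔ.1.ne_bot).symm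
  by_cases hU0 : U ≠ U₀
  · exact mem_of_line U hU (hline U hU hU0)
  push Not at hU0
  subst hU0
  obtain ⟨V, hV, hVU⟩ := exists_le U hU
  by_cases hVeq : V = U
  · exact hVeq ▸ hV
  obtain ⟨V', hV', hVU', hne⟩ : ∃ V' ∈ Δ, V' ≤ U ∧ V' ≠ V := by
    by_contra hcon
    push Not at hcon
    refine hVeq (le_antisymm hVU ?_)
    have := hr.2 U hU
    rw [← this]
    exact sSup_le fun W hW => (hcon W hW.1 hW.2).le
  obtain ⟨v, hv, hv0⟩ := Submodule.exists_mem_ne_zero_of_ne_bot (hΔ.1.ne_bot V hV)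
  obtain ⟨v', hv', hv0'⟩ := Submodule.exists_mem_ne_zero_of_ne_bot (hΔ.1.ne_bot V' hV')
  rcases htest v (hVU hv) v' (hVU' hv') hv0 hv0' with h1 | ⟨M, hM, hMU, N, hN, hNU, hb, x, hx, hvx, hvx'⟩
  · exact mem_of_line U hU h1
  obtain ⟨G, _, deg, hinj, hdeg⟩ := hΔ.2
  have hMΔ := mem_of_line M hM (hline M hM hMU)
  have hNΔ := mem_of_line N hN (hline N hN hNU)
  have key : ∀ W ∈ Δ, W ≤ U → ∀ w ∈ W, ⁅w, x⁆ ≠ 0 → deg N = deg W * deg M := by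
    intro W hW hWU w hw hwx
    obtain ⟨N', hN', hd, hb'⟩ := hdeg W hW M hMΔ fun h => hwx (by simpa using h w hw x hx)
    rw [← hd, eq_of_mem_of_sSupIndep hΔ.1.indep hNΔ hN' hwx (hb w (hWU hw) x hx) (hb' w hw x hx)]
  have h1 := key V hV hVU v hv hvx
  have h2 := key V' hV' hVU' v' hv' hvx'
  exact absurd (hinj hV' hV (mul_right_cancel (h2.symm.trans h1))) hne

/-- Some member of dimension `d` acts nontrivially on a member that it stabilizes. -/
def HasActingPiece (d : ℕ) (Γ : Set (Submodule ℂ L)) : Prop :=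
  ∃ U ∈ Γ, Module.finrank ℂ U = d ∧ ∃ V ∈ Γ, BracketLE U V V ∧ ¬ BracketLE U V ⊥

/-- Double brackets with elements of any member stabilize all members. -/
def IsSquareStable (Γ : Set (Submodule ℂ L)) : Prop :=
  ∀ U ∈ Γ, ∀ V ∈ Γ, ∀ u ∈ U, ∀ u' ∈ U, ∀ v ∈ V, ⁅u, ⁅u', v⁆⁆ ∈ V

lemma Equivalent.symm {Γ Δ : Set (Submodule ℂ L)} (h : Equivalent Γ Δ) : Equivalent Δ Γ := by
  obtain ⟨h, rfl⟩ := h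
  refine ⟨h.symm, ?_⟩
  unfold image
  rw [Set.image_image, Set.image_congr (g := id) fun U _ => ?_, Set.image_id]
  rw [← Submodule.map_comp]
  exact (congrArg (fun k => Submodule.map k U)
    (LinearMap.ext fun x => h.symm_apply_apply x : _ = LinearMap.id)).trans U.map_id

lemma HasDims.equivalent {Γ Δ : Set (Submodule ℂ L)} {m m' : Multiset ℕ} (h : Equivalent Γ Δ)
    (hΓ : HasDims Γ m) (hΔ : HasDims Δ m') : m = m' := by
  obtain ⟨f, rfl⟩ := h
  have := hΓ.image f
  ext d
  exact_mod_cast (this d).symm.trans (hΔ d)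

lemma HasActingPiece.equivalent {d : ℕ} {Γ Δ : Set (Submodule ℂ L)} (h : Equivalent Γ Δ)
    (hΓ : HasActingPiece d Γ) : HasActingPiece d Δ := by
  obtain ⟨f, rfl⟩ := h
  obtain ⟨U, hU, hd, V, hV, hb, hb'⟩ := hΓ
  refine ⟨_, ⟨U, hU, rfl⟩, ?_, _, ⟨V, hV, rfl⟩, ?_, fun h => hb' fun u hu v hv => ?_⟩
  · exact (LinearEquiv.finrank_map_eq f.toLinearEquiv U).trans hd
  · rintro _ ⟨u, hu, rfl⟩ _ ⟨v, hv, rfl⟩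
    exact ⟨⁅u, v⁆, hb u hu v hv, f.map_lie u v⟩
  · have := h _ ⟨u, hu, rfl⟩ _ ⟨v, hv, rfl⟩
    change ⁅f u, f v⁆ = 0 at this
    rw [← f.map_lie] at this
    change ⁅u, v⁆ = 0
    rw [← f.symm_apply_apply ⁅u, v⁆, this, map_zero]

lemma IsSquareStable.equivalent {Γ Δ : Set (Submodule ℂ L)} (h : Equivalent Γ Δ)
    (hΓ : IsSquareStable Γ) : IsSquareStable Δ := by
  obtain ⟨f, rfl⟩ := h
  rintro _ ⟨U, hU, rfl⟩ _ ⟨V, hV, rfl⟩ _ ⟨u, hu, rfl⟩ _ ⟨u', hu', rfl⟩ _ ⟨v, hv, rfl⟩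
  refine ⟨_, hΓ U hU V hV u hu u' hu' v hv, ?_⟩
  change f _ = ⁅f u, ⁅f u', f v⁆⁆
  rw [f.map_lie, f.map_lie]

end Fine

/-! ### Gradings defined by homogeneous bases -/

/-- A basis of homogeneous elements, of which exactly the first `d` have a common degree. -/
structure GradedBasis (L : Type*) [LieRing L] [LieAlgebra ℂ L] (G : Type) [CommGroup G]
    (n d : ℕ) where
  /-- The basis. -/
  basis : Module.Basis (Fin n) ℂ L
  /-- The degrees of the elements of the basis. -/
  deg : Fin n → G
  deg_eq_iff : ∀ i j, deg i = deg j ↔ i = j ∨ i.val < d ∧ j.val < d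
  lie_mem : ∀ i j, ⁅basis i, basis j⁆ ∈
    Submodule.span ℂ (basis '' {k | deg k = deg i * deg j})

namespace GradedBasis

variable {L : Type*} [LieRing L] [LieAlgebra ℂ L] {G : Type} [CommGroup G] {n d : ℕ}
  (b : GradedBasis L G n d)

/-- The homogeneous component of the given degree. -/
def piece (γ : G) : Submodule ℂ L := Submodule.span ℂ (b.basis '' {k | b.deg k = γ})

/-- The set of nonzero homogeneous components. -/
def grading : Set (Submodule ℂ L) := Set.range fun i => b.piece (b.deg i)

lemma basis_mem_piece {k : Fin n} {γ : G} : b.basis k ∈ b.piece γ ↔ b.deg k = γ :=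
  b.basis.self_mem_span_image

lemma piece_mem (i : Fin n) : b.piece (b.deg i) ∈ b.grading := ⟨i, rfl⟩

lemma piece_deg_inj {i j : Fin n} (h : b.piece (b.deg i) = b.piece (b.deg j)) : b.deg i = b.deg j :=
  b.basis_mem_piece.mp (h ▸ b.basis_mem_piece.mpr rfl)

lemma exists_of_piece_ne_bot {γ : G} (h : b.piece γ ≠ ⊥) : ∃ i, b.deg i = γ := by
  by_contra hcon
  push Not at hcon
  apply h
  rw [piece, Set.eq_empty_of_forall_notMem (s := {k | b.deg k = γ}) hcon, Set.image_empty,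
    Submodule.span_empty]

lemma lie_mem_piece (γ δ : G) : BracketLE (b.piece γ) (b.piece δ) (b.piece (γ * δ)) := by
  intro u hu v hv
  induction hu using Submodule.span_induction with
  | mem u hu =>
    induction hv using Submodule.span_induction with
    | mem v hv =>
      obtain ⟨i, rfl, rfl⟩ := hu
      obtain ⟨j, rfl, rfl⟩ := hv
      exact b.lie_mem i j
    | zero => rw [lie_zero]; exact Submodule.zero_mem _
    | add v w _ _ h h' => rw [lie_add]; exact Submodule.add_mem _ h h'
    | smul c v _ h => rw [lie_smul]; exact Submodule.smul_mem _ _ h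
  | zero => rw [zero_lie]; exact Submodule.zero_mem _
  | add v w _ _ h h' => rw [add_lie]; exact Submodule.add_mem _ h h'
  | smul c v _ h => rw [smul_lie]; exact Submodule.smul_mem _ _ h

lemma exists_deg_of_not_bracketLE {i j : Fin n}
    (h : ¬ BracketLE (b.piece (b.deg i)) (b.piece (b.deg j)) ⊥) :
    ∃ k, b.deg k = b.deg i * b.deg j := by
  refine b.exists_of_piece_ne_bot fun h0 => h ?_
  rw [← h0]
  exact b.lie_mem_piece _ _

lemma isGrading : IsGrading b.grading where
  ne_bot := by
    rintro _ ⟨i, rfl⟩ h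
    refine b.basis.ne_zero i ?_
    rw [← Submodule.mem_bot ℂ, ← h]
    exact b.basis_mem_piece.mpr rfl
  indep := by
    rintro _ ⟨i, rfl⟩
    refine (b.basis.linearIndependent.disjoint_span_image (s := {k | b.deg k = b.deg i})
      (t := {k | b.deg k ≠ b.deg i}) ?_).mono_right (sSup_le ?_)
    · rw [Set.disjoint_left]
      exact fun k hk hk' => hk' hk
    · rintro _ ⟨⟨j, rfl⟩, hj⟩
      refine Submodule.span_mono (Set.image_mono fun k hk h => hj ?_)
      have : b.deg j = b.deg i := (show b.deg k = b.deg j from hk).symm.trans h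
      simp [this]
  sSup_eq_top := by
    rw [eq_top_iff, ← b.basis.span_eq, Submodule.span_le]
    rintro _ ⟨i, rfl⟩
    exact le_sSup (b.piece_mem i) (b.basis_mem_piece.mpr rfl)
  bracket := by
    rintro _ ⟨i, rfl⟩ _ ⟨j, rfl⟩
    by_cases h : BracketLE (b.piece (b.deg i)) (b.piece (b.deg j)) ⊥
    · exact ⟨_, b.piece_mem i, fun u hu v hv => bot_le (a := b.piece (b.deg i)) (h u hu v hv)⟩
    · obtain ⟨k, hk⟩ := b.exists_deg_of_not_bracketLE h
      exact ⟨_, b.piece_mem k, hk ▸ b.lie_mem_piece _ _⟩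

theorem isGroupGrading : IsGroupGrading b.grading := by
  classical
  refine ⟨b.isGrading, G, inferInstance, fun U => if h : ∃ i, b.piece (b.deg i) = U then
    b.deg h.choose else 1, ?_⟩
  have hdeg : ∀ i, (if h : ∃ j, b.piece (b.deg j) = b.piece (b.deg i) then
      b.deg h.choose else 1) = b.deg i := by
    intro i
    have h : ∃ j, b.piece (b.deg j) = b.piece (b.deg i) := ⟨i, rfl⟩
    rw [dif_pos h]
    exact b.piece_deg_inj h.choose_spec
  constructor
  · rintro _ ⟨i, rfl⟩ _ ⟨j, rfl⟩ hij
    dsimp only at hij ⊢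
    rw [hdeg, hdeg] at hij
    rw [hij]
  · rintro _ ⟨i, rfl⟩ _ ⟨j, rfl⟩ h
    obtain ⟨k, hk⟩ := b.exists_deg_of_not_bracketLE h
    refine ⟨_, b.piece_mem k, ?_, hk ▸ b.lie_mem_piece _ _⟩
    dsimp only
    rw [hdeg, hdeg, hdeg, hk]

lemma finrank_piece (hd : d ≤ n) (i : Fin n) :
    Module.finrank ℂ (b.piece (b.deg i)) = if i.val < d then d else 1 := by
  rw [piece]
  have h1 : Module.finrank ℂ (Submodule.span ℂ (b.basis '' {k | b.deg k = b.deg i})) =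
      Nat.card {k | b.deg k = b.deg i} := by
    classical
    have := finrank_span_eq_card (b.basis.linearIndependent.comp
      (Subtype.val : {k // b.deg k = b.deg i} → Fin n) Subtype.val_injective)
    rw [Set.range_comp, Subtype.range_val_subtype] at this
    rw [this, Nat.card_eq_fintype_card]
    rfl
  rw [h1]
  simp_rw [b.deg_eq_iff]
  split_ifs with hi
  · have : {k : Fin n | k = i ∨ k.val < d ∧ i.val < d} = Set.range (Fin.castLE hd) := by
      ext k
      simp only [Set.mem_ofPred_eq, Set.mem_range]
      constructor
      · rintro (rfl | hk)
        · exact ⟨⟨k, hi⟩, rfl⟩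
        · exact ⟨⟨k, hk.1⟩, rfl⟩
      · rintro ⟨j, rfl⟩
        exact Or.inr ⟨j.2, hi⟩
    rw [this, Nat.card_range_of_injective (Fin.castLE_injective hd), Nat.card_fin]
  · have : {k : Fin n | k = i ∨ k.val < d ∧ i.val < d} = {i} := by
      ext k
      simp [hi]
    rw [this]
    simp

lemma piece_eq_iff {i j : Fin n} :
    b.piece (b.deg i) = b.piece (b.deg j) ↔ i = j ∨ i.val < d ∧ j.val < d := by
  rw [← b.deg_eq_iff]
  exact ⟨b.piece_deg_inj, fun h => by rw [h]⟩

/-- The index 0 represents the piece of dimension d, and each index from d on a line. -/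
theorem hasDims (hd : d ≤ n) (hd0 : 0 < d) : HasDims b.grading
    ((Finset.univ.filter fun i : Fin n => i.val = 0 ∨ d ≤ i.val).val.map
      fun i => if i.val < d then d else 1) := by
  intro e
  rw [Multiset.count_map]
  set s := Finset.univ.filter fun i : Fin n => i.val = 0 ∨ d ≤ i.val with hs
  have h1 : {U ∈ b.grading | Module.finrank ℂ U = e} = (fun i => b.piece (b.deg i)) ''
      (s.filter fun i : Fin n => e = if i.val < d then d else 1 : Finset (Fin n)) := by
    ext U
    constructor
    · rintro ⟨⟨i, rfl⟩, hU⟩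
      dsimp only at hU ⊢
      rw [b.finrank_piece hd] at hU
      by_cases hi : i.val < d
      · refine ⟨⟨0, by omega⟩, ?_, ?_⟩
        · rw [if_pos hi] at hU
          simp [hs, hU]
          omega
        · exact b.piece_eq_iff.mpr (Or.inr ⟨hd0, hi⟩)
      · refine ⟨i, ?_, rfl⟩
        rw [if_neg hi] at hU
        simp [hs, hi, hU, not_lt.mp hi]
    · rintro ⟨i, hi, rfl⟩
      refine ⟨b.piece_mem i, ?_⟩
      rw [Finset.mem_coe, Finset.mem_filter] at hi
      rw [b.finrank_piece hd, ← hi.2]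
  have h2 : Set.InjOn (fun i => b.piece (b.deg i))
      (s.filter fun i : Fin n => e = if i.val < d then d else 1 : Finset (Fin n)) := by
    intro i hi j hj hij
    rw [Finset.mem_coe, Finset.mem_filter, hs, Finset.mem_filter] at hi hj
    rcases b.piece_eq_iff.mp hij with h | h
    · exact h
    · apply Fin.ext
      have h3 := hi.1.2
      have h4 := hj.1.2
      omega
  rw [h1, h2.encard_image, Set.encard_coe_eq_coe_finsetCard]
  rfl

lemma hasActingPiece (hd : d ≤ n) {i j : Fin n} (hi : b.deg i = 1)
    (h : ⁅b.basis i, b.basis j⁆ ≠ 0) : HasActingPiece (if i.val < d then d else 1) b.grading := by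
  refine ⟨_, b.piece_mem i, b.finrank_piece hd i, _, b.piece_mem j, ?_, fun h0 => h ?_⟩
  · have := b.lie_mem_piece (b.deg i) (b.deg j)
    rwa [hi, one_mul, ← hi] at this
  · exact h0 _ (b.basis_mem_piece.mpr rfl) _ (b.basis_mem_piece.mpr rfl)

/-- A piece that acts nontrivially within another piece must have degree 1. -/
lemma not_hasActingPiece (hd : d ≤ n) {e : ℕ}
    (h : ∀ i : Fin n, (if i.val < d then d else 1) = e → b.deg i ≠ 1) :
    ¬ HasActingPiece e b.grading := by
  rintro ⟨_, ⟨i, rfl⟩, he, _, ⟨j, rfl⟩, hb, hb'⟩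
  rw [b.finrank_piece hd] at he
  refine h i he ?_
  have : ∃ u ∈ b.piece (b.deg i), ∃ v ∈ b.piece (b.deg j), ⁅u, v⁆ ≠ 0 := by
    by_contra hcon
    push Not at hcon
    exact hb' fun u hu v hv => hcon u hu v hv
  obtain ⟨u, hu, v, hv, huv⟩ := this
  obtain ⟨k, hk⟩ := b.exists_deg_of_not_bracketLE hb'
  have h1 := b.lie_mem_piece _ _ u hu v hv
  rw [← hk] at h1
  have h2 := eq_of_mem_of_sSupIndep b.isGrading.indep (b.piece_mem j) (b.piece_mem k) huv
    (hb u hu v hv) h1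
  have h3 := b.piece_deg_inj h2
  rw [hk] at h3
  exact mul_eq_right.mp h3.symm

lemma isSquareStable (h : ∀ i, b.deg i * b.deg i = 1) : IsSquareStable b.grading := by
  rintro _ ⟨i, rfl⟩ _ ⟨j, rfl⟩ u hu u' hu' v hv
  have := b.lie_mem_piece _ _ u hu _ (b.lie_mem_piece _ _ u' hu' v hv)
  rwa [← mul_assoc, h, one_mul] at this

/-- The condition deg j ≠ 1 ensures that bracketing the jth line with the first piece does not lead
back into the first piece. -/
theorem isFineGroupGrading [FiniteDimensional ℂ L] (hd : d ≤ n) (hd0 : 0 < d)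
    (h : ∀ u ∈ Submodule.span ℂ (b.basis '' {k | k.val < d}),
      ∀ u' ∈ Submodule.span ℂ (b.basis '' {k | k.val < d}), u ≠ 0 → u' ≠ 0 →
      d = 1 ∨ ∃ j : Fin n, d ≤ j.val ∧ b.deg j ≠ 1 ∧ ⁅u, b.basis j⁆ ≠ 0 ∧ ⁅u', b.basis j⁆ ≠ 0) :
    IsFineGroupGrading b.grading := by
  set z : Fin n := ⟨0, by omega⟩ with hz
  have hset : {k | b.deg k = b.deg z} = {k : Fin n | k.val < d} := by
    ext k
    rw [Set.mem_ofPred_eq, b.deg_eq_iff]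
    constructor
    · rintro (rfl | hk)
      · exact hd0
      · exact hk.1
    · exact fun hk => Or.inr ⟨hk, hd0⟩
  have hne : ∀ j : Fin n, b.piece (b.deg j) ≠ b.piece (b.deg z) ↔ d ≤ j.val := by
    intro j
    rw [Ne, b.piece_eq_iff]
    constructor
    · intro hj
      by_contra hlt
      exact hj (Or.inr ⟨by omega, hd0⟩)
    · rintro hj (rfl | hlt)
      · simp [hz] at hj; omega
      · omega
  refine isFineGroupGrading_of_lines b.isGroupGrading (b.piece_mem z) ?_ ?_
  · rintro _ ⟨j, rfl⟩ hj
    rw [b.finrank_piece hd, if_neg ((hne j).mp hj).not_gt]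
  · intro u hu u' hu' hu0 hu0'
    rw [b.finrank_piece hd, if_pos (show z.val < d from hd0)]
    rw [piece, hset] at hu hu'
    refine (h u hu u' hu' hu0 hu0').imp_right ?_
    rintro ⟨j, hj, hj1, hx, hx'⟩
    have hu2 : u ∈ b.piece (b.deg z) := by rwa [piece, hset]
    have hb : ¬ BracketLE (b.piece (b.deg z)) (b.piece (b.deg j)) ⊥ := fun h0 =>
      hx (h0 u hu2 _ (b.basis_mem_piece.mpr rfl))
    obtain ⟨k, hk⟩ := b.exists_deg_of_not_bracketLE hb
    refine ⟨_, b.piece_mem j, (hne j).mpr hj, _, b.piece_mem k, fun hkz => hj1 ?_,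
      hk ▸ b.lie_mem_piece _ _, _, b.basis_mem_piece.mpr rfl, hx, hx'⟩
    have := b.piece_deg_inj hkz
    rw [hk] at this
    exact mul_eq_left.mp this

end GradedBasis

/-! ### The eight gradings as data over the Gaussian integers -/

/-- Matrices over the Gaussian integers that are simultaneous eigenvectors, for the eigenvalues
`p s i / q s i`, of automorphisms `X ↦ A * X * A⁻¹` or `X ↦ -A * Xᵀ * A⁻¹`. -/
structure EigenData (m : ℕ) where
  /-- The eigenvectors. -/
  b : Fin 15 → Matrix (Fin 4) (Fin 4) GaussianInt
  /-- The automorphisms involving the transposition. -/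
  outer : Fin m → Bool
  /-- The conjugating matrices. -/
  A : Fin m → Matrix (Fin 4) (Fin 4) GaussianInt
  /-- The inverses up to scalars. -/
  A' : Fin m → Matrix (Fin 4) (Fin 4) GaussianInt
  /-- The scalars. -/
  c : Fin m → GaussianInt
  /-- The numerators of the eigenvalues. -/
  p : Fin m → Fin 15 → GaussianInt
  /-- The denominators of the eigenvalues. -/
  q : Fin m → Fin 15 → GaussianInt

/-- The conditions on the data, of which exactly the first `d` eigenvectors have equal eigenvalues. -/
structure EigenData.IsValid {m : ℕ} (D : EigenData m) (d : ℕ) : Prop where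
  trace : ∀ i, (D.b i).trace = 0
  orthogonal : ∀ i j, ((D.b i)ᴴ * D.b j).trace = 0 ↔ i ≠ j
  inverse : ∀ s, D.A s * D.A' s = D.c s • 1 ∧ D.c s ≠ 0
  ne_zero : ∀ s i, D.p s i ≠ 0 ∧ D.q s i ≠ 0
  eigen : ∀ s i, if D.outer s then
      D.q s i • (D.A s * (D.b i)ᵀ) = -(D.p s i • (D.b i * D.A s))
    else D.q s i • (D.A s * D.b i) = D.p s i • (D.b i * D.A s)
  eq_iff : ∀ i j, (∀ s, D.p s i * D.q s j = D.p s j * D.q s i) ↔ i = j ∨ i.val < d ∧ j.val < d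

/-- The matrix units. -/
abbrev matUnit (k l : Fin 4) : Matrix (Fin 4) (Fin 4) GaussianInt := Matrix.single k l 1

/-- The imaginary unit. -/
abbrev gaussI : GaussianInt := ⟨0, 1⟩

/-- The data of the Cartan grading. -/
def cartanData : EigenData 1 where
  b := ![matUnit 0 0 - matUnit 1 1, matUnit 0 0 + matUnit 1 1 - 2 • matUnit 2 2,
    matUnit 0 0 + matUnit 1 1 + matUnit 2 2 - 3 • matUnit 3 3,
    matUnit 0 1, matUnit 0 2, matUnit 0 3, matUnit 1 0, matUnit 1 2, matUnit 1 3,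
    matUnit 2 0, matUnit 2 1, matUnit 2 3, matUnit 3 0, matUnit 3 1, matUnit 3 2]
  outer := ![false]
  -- The exponents 0, 1, 4, 6 of two have pairwise distinct differences, so this one automorphism
  -- separates all roots.
  A := ![Matrix.diagonal ![1, 2, 16, 64]]
  A' := ![Matrix.diagonal ![64, 32, 4, 1]]
  c := ![64]
  p := ![![1, 1, 1, 1, 1, 1, 2, 2, 2, 16, 16, 16, 64, 64, 64]]
  q := ![![1, 1, 1, 2, 16, 64, 1, 16, 64, 1, 2, 64, 1, 2, 16]]

/-- The clock matrix. -/
abbrev clock : Matrix (Fin 4) (Fin 4) GaussianInt := Matrix.diagonal ![1, gaussI, -1, -gaussI]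

/-- The shift matrix. -/
abbrev shift : Matrix (Fin 4) (Fin 4) GaussianInt :=
  matUnit 0 1 + matUnit 1 2 + matUnit 2 3 + matUnit 3 0

/-- The data of the Pauli grading. -/
def pauliData : EigenData 2 where
  b i := shift ^ ((i.val + 1) / 4) * clock ^ ((i.val + 1) % 4)
  outer := ![false, false]
  A := ![clock, shift]
  A' := ![clock ^ 3, shift ^ 3]
  c := ![1, 1]
  p := ![fun i => (-gaussI) ^ ((i.val + 1) / 4), fun i => gaussI ^ ((i.val + 1) % 4)]
  q _ _ := 1

/-- The data of the orthogonal grading. -/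
def orthogonalData : EigenData 4 where
  b := ![matUnit 0 0 - matUnit 1 1, matUnit 0 0 + matUnit 1 1 - 2 • matUnit 2 2,
    matUnit 0 0 + matUnit 1 1 + matUnit 2 2 - 3 • matUnit 3 3,
    matUnit 0 1 + matUnit 1 0, matUnit 0 2 + matUnit 2 0, matUnit 0 3 + matUnit 3 0,
    matUnit 1 2 + matUnit 2 1, matUnit 1 3 + matUnit 3 1, matUnit 2 3 + matUnit 3 2,
    matUnit 0 1 - matUnit 1 0, matUnit 0 2 - matUnit 2 0, matUnit 0 3 - matUnit 3 0,
    matUnit 1 2 - matUnit 2 1, matUnit 1 3 - matUnit 3 1, matUnit 2 3 - matUnit 3 2]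
  outer := ![true, false, false, false]
  A := ![1, Matrix.diagonal ![-1, 1, 1, 1], Matrix.diagonal ![1, -1, 1, 1],
    Matrix.diagonal ![1, 1, -1, 1]]
  A' := ![1, Matrix.diagonal ![-1, 1, 1, 1], Matrix.diagonal ![1, -1, 1, 1],
    Matrix.diagonal ![1, 1, -1, 1]]
  c _ := 1
  p := ![![-1, -1, -1, -1, -1, -1, -1, -1, -1, 1, 1, 1, 1, 1, 1],
    ![1, 1, 1, -1, -1, -1, 1, 1, 1, -1, -1, -1, 1, 1, 1],
    ![1, 1, 1, -1, 1, 1, -1, -1, 1, -1, 1, 1, -1, -1, 1],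
    ![1, 1, 1, 1, -1, 1, -1, 1, -1, 1, -1, 1, -1, 1, -1]]
  q _ _ := 1

/-- The data of the grading with a torus of rank two and an outer automorphism. -/
def torusTwoData : EigenData 2 where
  b := ![matUnit 0 0 - matUnit 1 1, matUnit 2 2 - matUnit 3 3,
    matUnit 0 0 + matUnit 1 1 - matUnit 2 2 - matUnit 3 3,
    matUnit 0 1, matUnit 1 0, matUnit 2 3, matUnit 3 2,
    matUnit 0 2 + matUnit 3 1, matUnit 0 2 - matUnit 3 1,
    matUnit 2 0 + matUnit 1 3, matUnit 2 0 - matUnit 1 3,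
    matUnit 0 3 + matUnit 2 1, matUnit 0 3 - matUnit 2 1,
    matUnit 3 0 + matUnit 1 2, matUnit 3 0 - matUnit 1 2]
  outer := ![true, false]
  -- The diagonal matrix commutes with the outer automorphism because 32 · 8 = 256 · 1; it stands
  -- for a torus of rank two.
  A := ![matUnit 0 1 + matUnit 1 0 + matUnit 2 3 + matUnit 3 2, Matrix.diagonal ![32, 8, 256, 1]]
  A' := ![matUnit 0 1 + matUnit 1 0 + matUnit 2 3 + matUnit 3 2, Matrix.diagonal ![8, 32, 1, 256]]
  c := ![1, 256]
  p := ![![1, 1, -1, -1, -1, -1, -1, -1, 1, -1, 1, -1, 1, -1, 1],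
    ![1, 1, 1, 32, 8, 256, 1, 32, 32, 256, 256, 32, 32, 1, 1]]
  q := ![fun _ => 1, ![1, 1, 1, 8, 32, 1, 256, 256, 256, 32, 32, 1, 1, 32, 32]]

/-- The data of the grading with a torus of rank one, signs and an outer automorphism. -/
def torusOneData : EigenData 4 where
  b := ![matUnit 0 0 - matUnit 1 1, matUnit 0 0 + matUnit 1 1 - matUnit 2 2 - matUnit 3 3,
    matUnit 2 2 - matUnit 3 3, matUnit 0 1 + matUnit 1 0, matUnit 0 1 - matUnit 1 0,
    matUnit 2 3, matUnit 3 2,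
    matUnit 0 2 + matUnit 3 0, matUnit 0 2 - matUnit 3 0,
    matUnit 0 3 + matUnit 2 0, matUnit 0 3 - matUnit 2 0,
    matUnit 1 2 + matUnit 3 1, matUnit 1 2 - matUnit 3 1,
    matUnit 1 3 + matUnit 2 1, matUnit 1 3 - matUnit 2 1]
  outer := ![true, false, false, false]
  -- Compatibility with the outer automorphism requires 2 · 2 = 4 · 1.
  A := ![matUnit 0 0 + matUnit 1 1 + matUnit 2 3 + matUnit 3 2, Matrix.diagonal ![2, 2, 4, 1],
    Matrix.diagonal ![-1, 1, 1, 1], Matrix.diagonal ![1, -1, 1, 1]]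
  A' := ![matUnit 0 0 + matUnit 1 1 + matUnit 2 3 + matUnit 3 2, Matrix.diagonal ![2, 2, 1, 4],
    Matrix.diagonal ![-1, 1, 1, 1], Matrix.diagonal ![1, -1, 1, 1]]
  c := ![1, 4, 1, 1]
  p := ![![-1, -1, 1, -1, 1, -1, -1, -1, 1, -1, 1, -1, 1, -1, 1],
    ![1, 1, 1, 1, 1, 4, 1, 2, 2, 2, 2, 2, 2, 2, 2],
    ![1, 1, 1, -1, -1, 1, 1, -1, -1, -1, -1, 1, 1, 1, 1],
    ![1, 1, 1, -1, -1, 1, 1, 1, 1, 1, 1, -1, -1, -1, -1]]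
  q := ![fun _ => 1, ![1, 1, 1, 1, 1, 1, 4, 4, 4, 1, 1, 4, 4, 1, 1], fun _ => 1, fun _ => 1]

/-- The data of the grading with a torus of rank one and Pauli matrices. -/
def torusPauliData : EigenData 4 where
  b := ![matUnit 0 2 + matUnit 1 3, matUnit 0 2 - matUnit 1 3, matUnit 0 3 + matUnit 1 2,
    matUnit 1 2 - matUnit 0 3, matUnit 2 0 + matUnit 3 1, matUnit 2 0 - matUnit 3 1,
    matUnit 2 1 + matUnit 3 0, matUnit 3 0 - matUnit 2 1,
    matUnit 0 0 - matUnit 1 1 + matUnit 2 2 - matUnit 3 3,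
    matUnit 0 1 + matUnit 1 0 + matUnit 2 3 + matUnit 3 2,
    matUnit 1 0 - matUnit 0 1 + matUnit 3 2 - matUnit 2 3,
    matUnit 0 0 + matUnit 1 1 - matUnit 2 2 - matUnit 3 3,
    matUnit 0 0 - matUnit 1 1 - matUnit 2 2 + matUnit 3 3,
    matUnit 0 1 + matUnit 1 0 - matUnit 2 3 - matUnit 3 2,
    matUnit 1 0 - matUnit 0 1 - matUnit 3 2 + matUnit 2 3]
  outer := ![true, false, false, false]
  A := ![matUnit 0 2 + matUnit 1 3 + matUnit 2 0 + matUnit 3 1, Matrix.diagonal ![2, 2, 1, 1],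
    Matrix.diagonal ![1, -1, 1, -1], matUnit 0 1 + matUnit 1 0 + matUnit 2 3 + matUnit 3 2]
  A' := ![matUnit 0 2 + matUnit 1 3 + matUnit 2 0 + matUnit 3 1, Matrix.diagonal ![1, 1, 2, 2],
    Matrix.diagonal ![1, -1, 1, -1], matUnit 0 1 + matUnit 1 0 + matUnit 2 3 + matUnit 3 2]
  c := ![1, 2, 1, 1]
  p := ![![-1, -1, -1, 1, -1, -1, -1, 1, -1, -1, 1, 1, 1, 1, -1],
    ![2, 2, 2, 2, 1, 1, 1, 1, 1, 1, 1, 1, 1, 1, 1],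
    ![1, 1, -1, -1, 1, 1, -1, -1, 1, -1, -1, 1, 1, -1, -1],
    ![1, -1, 1, -1, 1, -1, 1, -1, -1, 1, -1, 1, -1, 1, -1]]
  q := ![fun _ => 1, ![1, 1, 1, 1, 2, 2, 2, 2, 1, 1, 1, 1, 1, 1, 1], fun _ => 1, fun _ => 1]

/-- The generators of the group of tensor products of two Pauli matrices. -/
abbrev pauliGen : Fin 4 → Matrix (Fin 4) (Fin 4) GaussianInt :=
  ![Matrix.diagonal ![1, -1, 1, -1], matUnit 0 1 + matUnit 1 0 + matUnit 2 3 + matUnit 3 2,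
    Matrix.diagonal ![1, 1, -1, -1], matUnit 0 2 + matUnit 1 3 + matUnit 2 0 + matUnit 3 1]

/-- The data of the grading by tensor products of two Pauli matrices. -/
def pauliPauliData : EigenData 4 where
  b i := pauliGen 0 ^ ((i.val + 1) % 2) * pauliGen 1 ^ ((i.val + 1) / 2 % 2) *
    pauliGen 2 ^ ((i.val + 1) / 4 % 2) * pauliGen 3 ^ ((i.val + 1) / 8)
  outer _ := false
  A := pauliGen
  A' := pauliGen
  c _ := 1
  p := ![fun i => (-1) ^ ((i.val + 1) / 2 % 2), fun i => (-1) ^ ((i.val + 1) % 2),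
    fun i => (-1) ^ ((i.val + 1) / 8), fun i => (-1) ^ ((i.val + 1) / 4 % 2)]
  q _ _ := 1

/-- The data of the grading by two Pauli matrices on the blocks and four on the outer blocks. -/
def blockData : EigenData 4 where
  b := ![matUnit 0 0 - matUnit 1 1, matUnit 2 2 - matUnit 3 3,
    matUnit 0 0 + matUnit 1 1 - matUnit 2 2 - matUnit 3 3,
    matUnit 0 1 + matUnit 1 0, matUnit 2 3 + matUnit 3 2,
    matUnit 1 0 - matUnit 0 1, matUnit 3 2 - matUnit 2 3,
    matUnit 0 2 + matUnit 1 3 + (matUnit 2 0 - matUnit 3 1),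
    matUnit 0 2 + matUnit 1 3 - (matUnit 2 0 - matUnit 3 1),
    matUnit 0 2 - matUnit 1 3 + (matUnit 2 0 + matUnit 3 1),
    matUnit 0 2 - matUnit 1 3 - (matUnit 2 0 + matUnit 3 1),
    matUnit 0 3 + matUnit 1 2 + (matUnit 2 1 - matUnit 3 0),
    matUnit 0 3 + matUnit 1 2 - (matUnit 2 1 - matUnit 3 0),
    matUnit 1 2 - matUnit 0 3 + (matUnit 2 1 + matUnit 3 0),
    matUnit 1 2 - matUnit 0 3 - (matUnit 2 1 + matUnit 3 0)]
  outer := ![true, false, false, false]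
  A := ![Matrix.diagonal ![1, 1, 1, -1],
    matUnit 0 1 + matUnit 1 0 + gaussI • (matUnit 2 3 + matUnit 3 2),
    Matrix.diagonal ![1, -1, 1, -1], Matrix.diagonal ![1, 1, -1, -1]]
  A' := ![Matrix.diagonal ![1, 1, 1, -1],
    matUnit 0 1 + matUnit 1 0 - gaussI • (matUnit 2 3 + matUnit 3 2),
    Matrix.diagonal ![1, -1, 1, -1], Matrix.diagonal ![1, 1, -1, -1]]
  c _ := 1
  p := ![![-1, -1, -1, -1, 1, 1, -1, -1, 1, -1, 1, -1, 1, -1, 1],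
    ![-1, -1, 1, 1, 1, -1, -1, -gaussI, -gaussI, gaussI, gaussI, -gaussI, -gaussI, gaussI, gaussI],
    ![1, 1, 1, -1, -1, -1, -1, 1, 1, 1, 1, -1, -1, -1, -1],
    ![1, 1, 1, 1, 1, 1, 1, -1, -1, -1, -1, -1, -1, -1, -1]]
  q _ _ := 1

/-- Storing eigenvalues as fractions and inverses up to scalars leaves finitely many relations
between Gaussian integers, which evaluation decides. -/
lemma cartanData_isValid : cartanData.IsValid 3 where
  trace := by decide +kernel
  orthogonal := by decide +kernel
  inverse := by decide +kernel
  ne_zero := by decide +kernel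
  eigen := by decide +kernel
  eq_iff := by decide +kernel

lemma pauliData_isValid : pauliData.IsValid 1 where
  trace := by decide +kernel
  orthogonal := by decide +kernel
  inverse := by decide +kernel
  ne_zero := by decide +kernel
  eigen := by decide +kernel
  eq_iff := by decide +kernel

lemma orthogonalData_isValid : orthogonalData.IsValid 3 where
  trace := by decide +kernel
  orthogonal := by decide +kernel
  inverse := by decide +kernel
  ne_zero := by decide +kernel
  eigen := by decide +kernel
  eq_iff := by decide +kernel

lemma torusTwoData_isValid : torusTwoData.IsValid 2 where
  trace := by decide +kernel
  orthogonal := by decide +kernel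
  inverse := by decide +kernel
  ne_zero := by decide +kernel
  eigen := by decide +kernel
  eq_iff := by decide +kernel

lemma torusOneData_isValid : torusOneData.IsValid 2 where
  trace := by decide +kernel
  orthogonal := by decide +kernel
  inverse := by decide +kernel
  ne_zero := by decide +kernel
  eigen := by decide +kernel
  eq_iff := by decide +kernel

lemma torusPauliData_isValid : torusPauliData.IsValid 1 where
  trace := by decide +kernel
  orthogonal := by decide +kernel
  inverse := by decide +kernel
  ne_zero := by decide +kernel
  eigen := by decide +kernel
  eq_iff := by decide +kernel

lemma pauliPauliData_isValid : pauliPauliData.IsValid 1 where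
  trace := by decide +kernel
  orthogonal := by decide +kernel
  inverse := by decide +kernel
  ne_zero := by decide +kernel
  eigen := by decide +kernel
  eq_iff := by decide +kernel

lemma blockData_isValid : blockData.IsValid 2 where
  trace := by decide +kernel
  orthogonal := by decide +kernel
  inverse := by decide +kernel
  ne_zero := by decide +kernel
  eigen := by decide +kernel
  eq_iff := by decide +kernel

/-! ### From Gaussian data to gradings of sl(4) -/

section Gradings

attribute [local instance] LieRing.ofAssociativeRing

lemma finrank_sl4 : Module.finrank ℂ Sl4 = 15 := by
  have h1 := (Matrix.traceLinearMap (Fin 4) ℂ ℂ).finrank_range_add_finrank_ker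
  have h2 : LinearMap.range (Matrix.traceLinearMap (Fin 4) ℂ ℂ) = ⊤ := by
    rw [LinearMap.range_eq_top]
    exact fun c => ⟨Matrix.single 0 0 c, by simp [Matrix.trace_single_eq_same]⟩
  rw [h2, finrank_top, Module.finrank_self, Module.finrank_matrix, Module.finrank_self,
    Fintype.card_fin] at h1
  have h3 : Module.finrank ℂ Sl4 =
      Module.finrank ℂ (LinearMap.ker (Matrix.traceLinearMap (Fin 4) ℂ ℂ)) := rfl
  omega

namespace EigenData

/-- The complex matrix with the given Gaussian entries. -/
noncomputable def toMat (M : Matrix (Fin 4) (Fin 4) GaussianInt) : Matrix (Fin 4) (Fin 4) ℂ :=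
  GaussianInt.toComplex.mapMatrix M

lemma toMat_mul (M N : Matrix (Fin 4) (Fin 4) GaussianInt) : toMat (M * N) = toMat M * toMat N :=
  map_mul _ M N

lemma toMat_add (M N : Matrix (Fin 4) (Fin 4) GaussianInt) : toMat (M + N) = toMat M + toMat N :=
  map_add _ M N

lemma toMat_sub (M N : Matrix (Fin 4) (Fin 4) GaussianInt) : toMat (M - N) = toMat M - toMat N :=
  map_sub _ M N

lemma toMat_neg (M : Matrix (Fin 4) (Fin 4) GaussianInt) : toMat (-M) = -toMat M := map_neg _ M

lemma toMat_one : toMat 1 = 1 := map_one _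

lemma toMat_smul (c : GaussianInt) (M : Matrix (Fin 4) (Fin 4) GaussianInt) :
    toMat (c • M) = c.toComplex • toMat M := by
  ext i j
  simp [toMat]

lemma toMat_transpose (M : Matrix (Fin 4) (Fin 4) GaussianInt) : toMat Mᵀ = (toMat M)ᵀ := rfl

lemma toMat_apply (M : Matrix (Fin 4) (Fin 4) GaussianInt) (i j : Fin 4) :
    toMat M i j = (M i j).toComplex := rfl

lemma toMat_conjTranspose (M : Matrix (Fin 4) (Fin 4) GaussianInt) : toMat Mᴴ = (toMat M)ᴴ := by
  ext i j
  simp [toMat_apply, Matrix.conjTranspose_apply, GaussianInt.toComplex_star]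

lemma trace_toMat (M : Matrix (Fin 4) (Fin 4) GaussianInt) :
    (toMat M).trace = M.trace.toComplex := by
  rw [Matrix.trace, Matrix.trace, map_sum]
  rfl

variable {m d : ℕ} {D : EigenData m} (h : D.IsValid d)

/-- The eigenvectors in the Lie algebra. -/
noncomputable def vec (i : Fin 15) : Sl4 :=
  ⟨toMat (D.b i), by
    change (toMat (D.b i)).trace = 0
    rw [trace_toMat, h.trace, map_zero]⟩

/-- The vectors are pairwise orthogonal for the Hermitian trace form and have nonzero norm. -/
lemma linearIndependent_vec : LinearIndependent ℂ (vec h) := by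
  rw [Fintype.linearIndependent_iff]
  intro g hg j
  have h1 : ∑ i, g i • toMat (D.b i) = 0 := by
    have := congrArg (Sl4.toSubmodule.subtype) hg
    rw [map_sum, map_zero] at this
    simpa [vec] using this
  have h2 : ∑ i, g i * ((toMat (D.b j))ᴴ * toMat (D.b i)).trace = 0 := by
    have := congrArg (fun X => ((toMat (D.b j))ᴴ * X).trace) h1
    simpa [Matrix.mul_sum, Matrix.trace_sum] using this
  have h3 : ∀ i, ((toMat (D.b j))ᴴ * toMat (D.b i)).trace =
      (((D.b j)ᴴ * D.b i).trace).toComplex := fun i => by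
    rw [← toMat_conjTranspose, ← toMat_mul, trace_toMat]
  rw [Finset.sum_eq_single j (fun i _ hij => by
    rw [h3, (h.orthogonal j i).mpr hij.symm, map_zero, mul_zero]) (by simp)] at h2
  refine (mul_eq_zero.mp h2).resolve_right ?_
  rw [h3, GaussianInt.toComplex_eq_zero, h.orthogonal]
  simp

/-- The eigenvalues. -/
noncomputable def eigval (s : Fin m) (i : Fin 15) : ℂ :=
  (D.p s i).toComplex / (D.q s i).toComplex

lemma eigval_ne_zero (h : D.IsValid d) (s : Fin m) (i : Fin 15) : D.eigval s i ≠ 0 :=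
  div_ne_zero (by rw [Ne, GaussianInt.toComplex_eq_zero]; exact (h.ne_zero s i).1)
    (by rw [Ne, GaussianInt.toComplex_eq_zero]; exact (h.ne_zero s i).2)

/-- The condition to be an eigenvector for the automorphism with index `s`. -/
def IsEigen (D : EigenData m) (s : Fin m) (χ : ℂ) (X : Matrix (Fin 4) (Fin 4) ℂ) : Prop :=
  toMat (D.A s) * (if D.outer s then Xᵀ else X) =
    χ • ((if D.outer s then -X else X) * toMat (D.A s))

lemma isEigen_vec (s : Fin m) (i : Fin 15) : D.IsEigen s (D.eigval s i) (vec h i).1 := by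
  have h1 := h.eigen s i
  have hq : (D.q s i).toComplex ≠ 0 := by
    rw [Ne, GaussianInt.toComplex_eq_zero]
    exact (h.ne_zero s i).2
  change toMat (D.A s) * (if D.outer s then (toMat (D.b i))ᵀ else toMat (D.b i)) =
    D.eigval s i • ((if D.outer s then -toMat (D.b i) else toMat (D.b i)) * toMat (D.A s))
  rw [eigval, div_eq_inv_mul, ← smul_smul, eq_inv_smul_iff₀ hq]
  split_ifs at h1 ⊢
  · have := congrArg toMat h1
    rwa [toMat_smul, toMat_mul, toMat_transpose, toMat_neg, toMat_smul, toMat_mul, ← smul_neg,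
      ← neg_mul] at this
  · have := congrArg toMat h1
    rwa [toMat_smul, toMat_mul, toMat_smul, toMat_mul] at this

lemma IsEigen.lie {s : Fin m} {χ ψ : ℂ} {X Y : Matrix (Fin 4) (Fin 4) ℂ} (hX : D.IsEigen s χ X)
    (hY : D.IsEigen s ψ Y) : D.IsEigen s (χ * ψ) (X * Y - Y * X) := by
  unfold IsEigen at *
  set A := toMat (D.A s)
  split_ifs at * with ho
  · have e1 : A * (Xᵀ * Yᵀ) = (χ * ψ) • (X * Y * A) := by
      rw [← mul_assoc, hX, Matrix.smul_mul, mul_assoc, hY, Matrix.mul_smul, smul_smul, neg_mul,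
        neg_mul, mul_neg, neg_neg, mul_assoc]
    have e2 : A * (Yᵀ * Xᵀ) = (χ * ψ) • (Y * X * A) := by
      rw [← mul_assoc, hY, Matrix.smul_mul, mul_assoc, hX, Matrix.mul_smul, smul_smul, neg_mul,
        neg_mul, mul_neg, neg_neg, mul_assoc, mul_comm ψ]
    rw [Matrix.transpose_sub, Matrix.transpose_mul, Matrix.transpose_mul, mul_sub, e1, e2,
      ← smul_sub]
    congr 1
    noncomm_ring
  · have e1 : A * (X * Y) = (χ * ψ) • (X * Y * A) := by
      rw [← mul_assoc, hX, Matrix.smul_mul, mul_assoc, hY, Matrix.mul_smul, smul_smul, mul_assoc]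
    have e2 : A * (Y * X) = (χ * ψ) • (Y * X * A) := by
      rw [← mul_assoc, hY, Matrix.smul_mul, mul_assoc, hX, Matrix.mul_smul, smul_smul, mul_assoc,
        mul_comm ψ]
    rw [mul_sub, e1, e2, ← smul_sub, sub_mul]

/-- The basis of eigenvectors. -/
noncomputable def vecBasis : Module.Basis (Fin 15) ℂ Sl4 :=
  basisOfLinearIndependentOfCardEqFinrank (linearIndependent_vec h) (by simp [finrank_sl4])

lemma vecBasis_apply (i : Fin 15) : vecBasis h i = vec h i := by
  simp [vecBasis]

/-- Expanding Y and cancelling the invertible matrix A gives a linear relation with coefficients c k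
(eigval k - χ). This places brackets of basis vectors in the piece of the product degree. -/
lemma eigval_eq_of_isEigen {s : Fin m} {χ : ℂ} {Y : Sl4} (hY : D.IsEigen s χ Y.1) {k : Fin 15}
    (hk : (vecBasis h).repr Y k ≠ 0) : D.eigval s k = χ := by
  set c := (vecBasis h).repr Y with hc
  have hYs : Y.1 = ∑ k, c k • toMat (D.b k) := by
    have := congrArg (Sl4.toSubmodule.subtype) ((vecBasis h).sum_repr Y)
    rw [map_sum] at this
    simp only [map_smul, vecBasis_apply] at this
    exact this.symm
  have h1 : ∑ k, (c k * (D.eigval s k - χ)) •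
      ((if D.outer s then -toMat (D.b k) else toMat (D.b k)) * toMat (D.A s)) = 0 := by
    unfold IsEigen at hY
    have h2 := fun k => isEigen_vec h s k
    unfold IsEigen at h2
    have h3 : ∀ k, (vec h k).1 = toMat (D.b k) := fun _ => rfl
    simp only [h3] at h2
    split_ifs at * with ho
    · rw [hYs, Matrix.transpose_sum, Matrix.mul_sum, neg_mul, Matrix.sum_mul, smul_neg,
        Finset.smul_sum] at hY
      simp only [Matrix.transpose_smul, Matrix.mul_smul, Matrix.smul_mul, h2] at hY
      rw [← sub_eq_zero, sub_neg_eq_add, ← Finset.sum_add_distrib] at hY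
      rw [← hY]
      refine Finset.sum_congr rfl fun k _ => ?_
      rw [neg_mul]
      module
    · rw [hYs, Matrix.mul_sum, Matrix.sum_mul, Finset.smul_sum] at hY
      simp only [Matrix.mul_smul, Matrix.smul_mul, h2] at hY
      rw [← sub_eq_zero, ← Finset.sum_sub_distrib] at hY
      rw [← hY]
      refine Finset.sum_congr rfl fun k _ => ?_
      module
  obtain ⟨hA, hA0⟩ := h.inverse s
  have hA' : toMat (D.A s) * toMat (D.A' s) = (D.c s).toComplex • 1 := by
    rw [← toMat_mul, hA, toMat_smul, toMat_one]
  have hc0 : (D.c s).toComplex ≠ 0 := by rwa [Ne, GaussianInt.toComplex_eq_zero]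
  have h4 : ∑ k, (c k * (D.eigval s k - χ)) • toMat (D.b k) = 0 := by
    have h5 := congrArg (fun X => X * toMat (D.A' s)) h1
    simp only [Matrix.sum_mul, zero_mul, Matrix.smul_mul, mul_assoc, hA', Matrix.mul_smul,
      mul_one] at h5
    simp only [smul_comm _ (D.c s).toComplex] at h5
    rw [← Finset.smul_sum, smul_eq_zero_iff_right hc0] at h5
    split_ifs at h5
    · simpa only [smul_neg, Finset.sum_neg_distrib, neg_eq_zero] using h5
    · exact h5
  have h6 : ∑ k, (c k * (D.eigval s k - χ)) • vec h k = 0 := by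
    refine Subtype.ext ?_
    have : Sl4.toSubmodule.subtype (∑ k, (c k * (D.eigval s k - χ)) • vec h k) =
        ∑ k, (c k * (D.eigval s k - χ)) • toMat (D.b k) := by
      rw [map_sum]
      rfl
    exact this.trans h4
  have h7 := Fintype.linearIndependent_iff.mp (linearIndependent_vec h) _ h6 k
  exact sub_eq_zero.mp ((mul_eq_zero.mp h7).resolve_left hk)

/-- The basis of eigenvectors, graded by the eigenvalues. -/
noncomputable def gradedBasis : GradedBasis Sl4 (Fin m → ℂˣ) 15 d where
  basis := vecBasis h
  deg i s := Units.mk0 (D.eigval s i) (eigval_ne_zero h s i)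
  deg_eq_iff i j := by
    rw [← h.eq_iff, funext_iff]
    refine forall_congr' fun s => ?_
    rw [Units.mk0_inj, eigval, eigval, div_eq_div_iff
      (by rw [Ne, GaussianInt.toComplex_eq_zero]; exact (h.ne_zero s i).2)
      (by rw [Ne, GaussianInt.toComplex_eq_zero]; exact (h.ne_zero s j).2), ← map_mul, ← map_mul,
      GaussianInt.toComplex_inj]
  lie_mem i j := by
    rw [Module.Basis.mem_span_image]
    intro k hk
    rw [Finset.mem_coe, Finsupp.mem_support_iff] at hk
    refine funext fun s => Units.ext ?_
    refine eigval_eq_of_isEigen h ?_ hk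
    rw [vecBasis_apply, vecBasis_apply, val_lie]
    exact (isEigen_vec h s i).lie (isEigen_vec h s j)

lemma gradedBasis_basis (i : Fin 15) : ((gradedBasis h).basis i).1 = toMat (D.b i) := by
  change (vecBasis h i).1 = _
  rw [vecBasis_apply]
  rfl

lemma deg_ne_one {i : Fin 15} {s : Fin m} (hs : D.p s i ≠ D.q s i) : (gradedBasis h).deg i ≠ 1 := by
  intro h1
  have h2 : D.eigval s i = 1 := congrArg Units.val (congrFun h1 s)
  rw [eigval, div_eq_one_iff_eq (by rw [Ne, GaussianInt.toComplex_eq_zero]; exact (h.ne_zero s i).2),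
    GaussianInt.toComplex_inj] at h2
  exact hs h2

lemma deg_eq_one {i : Fin 15} (hs : ∀ s, D.p s i = D.q s i) : (gradedBasis h).deg i = 1 := by
  refine funext fun s => Units.ext ?_
  change D.eigval s i = 1
  rw [eigval, hs, div_self (by rw [Ne, GaussianInt.toComplex_eq_zero]; exact (h.ne_zero s i).2)]

lemma deg_mul_self {i : Fin 15} (hs : ∀ s, D.p s i * D.p s i = D.q s i * D.q s i) :
    (gradedBasis h).deg i * (gradedBasis h).deg i = 1 := by
  refine funext fun s => Units.ext ?_
  change D.eigval s i * D.eigval s i = 1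
  rw [eigval, div_mul_div_comm, ← map_mul, ← map_mul, hs, div_self]
  rw [Ne, GaussianInt.toComplex_eq_zero]
  exact mul_ne_zero (h.ne_zero s i).2 (h.ne_zero s i).2

end EigenData

namespace GradedBasis

variable {L : Type*} [LieRing L] [LieAlgebra ℂ L] {G : Type} [CommGroup G] {n d : ℕ}
  (b : GradedBasis L G n d)

lemma not_isSquareStable {i j : Fin n} (h : ⁅b.basis i, ⁅b.basis i, b.basis j⁆⁆ ≠ 0)
    (hdeg : b.deg i * b.deg i ≠ 1) : ¬ IsSquareStable b.grading := by
  intro hs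
  have hi : b.basis i ∈ b.piece (b.deg i) := b.basis_mem_piece.mpr rfl
  have hj : b.basis j ∈ b.piece (b.deg j) := b.basis_mem_piece.mpr rfl
  have h1 := hs _ (b.piece_mem i) _ (b.piece_mem j) _ hi _ hi _ hj
  have h2 := b.lie_mem_piece _ _ _ hi _ (b.lie_mem_piece _ _ _ hi _ hj)
  obtain ⟨k, hk⟩ := b.exists_of_piece_ne_bot fun h0 => h (by rw [h0] at h2; exact h2)
  rw [← hk] at h2
  have h3 := b.piece_deg_inj (eq_of_mem_of_sSupIndep b.isGrading.indep (b.piece_mem j)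
    (b.piece_mem k) h h1 h2)
  rw [hk, ← mul_assoc] at h3
  exact hdeg (mul_eq_right.mp h3.symm)

end GradedBasis

namespace EigenData

variable {m d : ℕ} {D : EigenData m} (h : D.IsValid d)

lemma toMat_injective : Function.Injective toMat := fun M N hMN =>
  Matrix.ext fun i j => GaussianInt.toComplex_inj.mp (congrFun (congrFun hMN i) j)

lemma lie_ne_zero {i j : Fin 15} (hij : D.b i * D.b j ≠ D.b j * D.b i) :
    ⁅(gradedBasis h).basis i, (gradedBasis h).basis j⁆ ≠ 0 := by
  intro h0
  have h1 := congrArg Subtype.val h0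
  rw [val_lie, gradedBasis_basis, gradedBasis_basis, ← toMat_mul, ← toMat_mul] at h1
  exact hij (toMat_injective (sub_eq_zero.mp h1))

lemma lie_lie_ne_zero {i j : Fin 15} (hij : D.b i * (D.b i * D.b j - D.b j * D.b i) ≠
    (D.b i * D.b j - D.b j * D.b i) * D.b i) :
    ⁅(gradedBasis h).basis i, ⁅(gradedBasis h).basis i, (gradedBasis h).basis j⁆⁆ ≠ 0 := by
  intro h0
  have h1 := congrArg Subtype.val h0
  rw [val_lie, val_lie, gradedBasis_basis, gradedBasis_basis, ← toMat_mul, ← toMat_mul,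
    ← toMat_sub, ← toMat_mul, ← toMat_mul] at h1
  exact hij (toMat_injective (sub_eq_zero.mp h1))

/-- The large piece consists of traceless diagonal matrices satisfying the further relation w. Such
a u commutes with a basis vector having a nonzero (k, l) entry only if its entries at k and l agree.
So if no line separates u and u', each test in T is met by one of them, and `hcomb` makes one of
them zero. -/
lemma isFineGroupGrading_of_tests (hd : d ≤ 15) (hd0 : 0 < d) (w : Fin 4 → GaussianInt)
    (T : Finset (Fin 4 × Fin 4))
    (hdiag : ∀ i : Fin 15, i.val < d → Matrix.diagonal (D.b i).diag = D.b i)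
    (hw : ∀ i : Fin 15, i.val < d → ∑ k, w k * D.b i k k = 0)
    (hT : ∀ t ∈ T, t.1 ≠ t.2 ∧ ∃ j : Fin 15, d ≤ j.val ∧ (∃ s, D.p s j ≠ D.q s j) ∧
      D.b j t.1 t.2 ≠ 0)
    (hcomb : ∀ f f' : Fin 4 → ℂ, ∑ k, f k = 0 → ∑ k, (w k).toComplex * f k = 0 →
      ∑ k, f' k = 0 → ∑ k, (w k).toComplex * f' k = 0 →
      (∀ t ∈ T, f t.1 = f t.2 ∨ f' t.1 = f' t.2) → f = 0 ∨ f' = 0) :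
    IsFineGroupGrading (gradedBasis h).grading := by
  have hoff : ∀ u ∈ Submodule.span ℂ ((gradedBasis h).basis '' {k | k.val < d}), ∀ k l, k ≠ l →
      u.1 k l = 0 := by
    intro u hu k l hkl
    induction hu using Submodule.span_induction with
    | mem u hu =>
      obtain ⟨i, hi, rfl⟩ := hu
      rw [gradedBasis_basis, toMat_apply, ← hdiag i hi, Matrix.diagonal_apply_ne _ hkl, map_zero]
    | zero => rfl
    | add u v _ _ hu hv => rw [val_add, Matrix.add_apply, hu, hv, add_zero]
    | smul c u _ hu => rw [val_smul, Matrix.smul_apply, hu, smul_zero]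
  have hwu : ∀ u ∈ Submodule.span ℂ ((gradedBasis h).basis '' {k | k.val < d}),
      ∑ k, (w k).toComplex * u.1 k k = 0 := by
    intro u hu
    induction hu using Submodule.span_induction with
    | mem u hu =>
      obtain ⟨i, hi, rfl⟩ := hu
      rw [gradedBasis_basis]
      simp_rw [toMat_apply, ← map_mul]
      rw [← map_sum, hw i hi, map_zero]
    | zero => exact Finset.sum_eq_zero fun k _ => mul_zero _
    | add u v _ _ hu hv =>
      simp_rw [val_add, Matrix.add_apply, mul_add]
      rw [Finset.sum_add_distrib, hu, hv, add_zero]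
    | smul c u _ hu =>
      simp_rw [val_smul, Matrix.smul_apply, smul_eq_mul, mul_left_comm _ c]
      rw [← Finset.mul_sum, hu, mul_zero]
  have hzero : ∀ u ∈ Submodule.span ℂ ((gradedBasis h).basis '' {k | k.val < d}),
      (fun k => u.1 k k) = 0 → u = 0 := by
    intro u hu h0
    refine Subtype.ext (Matrix.ext fun k l => ?_)
    by_cases hkl : k = l
    · subst hkl
      exact congrFun h0 k
    · exact hoff u hu k l hkl
  have hlie : ∀ u ∈ Submodule.span ℂ ((gradedBasis h).basis '' {k | k.val < d}), ∀ j k l,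
      D.b j k l ≠ 0 → ⁅u, (gradedBasis h).basis j⁆ = 0 → u.1 k k = u.1 l l := by
    intro u hu j k l hjkl h0
    have h1 := congrFun (congrFun (congrArg Subtype.val h0) k) l
    rw [val_lie, gradedBasis_basis, Matrix.sub_apply, Matrix.mul_apply, Matrix.mul_apply,
      Finset.sum_eq_single k (fun i _ hi => by rw [hoff u hu k i hi.symm, zero_mul]) (by simp),
      Finset.sum_eq_single l (fun i _ hi => by rw [hoff u hu i l hi, mul_zero]) (by simp)] at h1
    have h2 : toMat (D.b j) k l ≠ 0 := by
      rwa [toMat_apply, Ne, GaussianInt.toComplex_eq_zero]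
    have h3 : (u.1 k k - u.1 l l) * toMat (D.b j) k l = 0 := by
      rw [sub_mul, mul_comm (u.1 l l)]
      exact h1
    exact sub_eq_zero.mp ((mul_eq_zero.mp h3).resolve_right h2)
  refine (gradedBasis h).isFineGroupGrading hd hd0 fun u hu u' hu' hu0 hu0' => ?_
  by_contra hcon
  push Not at hcon
  have htests : ∀ t ∈ T, u.1 t.1 t.1 = u.1 t.2 t.2 ∨ u'.1 t.1 t.1 = u'.1 t.2 t.2 := by
    intro t ht
    obtain ⟨-, j, hj, ⟨s, hs⟩, hbj⟩ := hT t ht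
    by_cases hx : ⁅u, (gradedBasis h).basis j⁆ = 0
    · exact Or.inl (hlie u hu j _ _ hbj hx)
    · exact Or.inr (hlie u' hu' j _ _ hbj (hcon.2 j hj (deg_ne_one h hs) hx))
  rcases hcomb (fun k => u.1 k k) (fun k => u'.1 k k) u.2 (hwu u hu) u'.2 (hwu u' hu') htests
    with h0 | h0
  · exact hu0 (hzero u hu h0)
  · exact hu0' (hzero u' hu' h0)

end EigenData

/-! ### Coincidences among diagonal entries -/

section Combinatorics

/-- The pairs on which f agrees and those on which f' agrees cover the complete graph on four
vertices. One of two graphs covering it is connected, so f or f' is constant, hence zero. -/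
lemma eq_zero_of_six_tests (w : Fin 4 → GaussianInt) (f f' : Fin 4 → ℂ) (h0 : ∑ k, f k = 0)
    (_ : ∑ k, (w k).toComplex * f k = 0) (h0' : ∑ k, f' k = 0)
    (_ : ∑ k, (w k).toComplex * f' k = 0)
    (h : ∀ t ∈ ({(0, 1), (0, 2), (0, 3), (1, 2), (1, 3), (2, 3)} : Finset (Fin 4 × Fin 4)),
      f t.1 = f t.2 ∨ f' t.1 = f' t.2) : f = 0 ∨ f' = 0 := by
  have key : ∀ g : Fin 4 → ℂ, ∑ k, g k = 0 → g 0 = g 1 → g 0 = g 2 → g 0 = g 3 → g = 0 := by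
    intro g hg h1 h2 h3
    rw [Fin.sum_univ_four, ← h1, ← h2, ← h3] at hg
    have h4 : g 0 = 0 := by linear_combination (1 / 4 : ℂ) * hg
    funext i
    fin_cases i
    · exact h4
    · exact h1.symm.trans h4
    · exact h2.symm.trans h4
    · exact h3.symm.trans h4
  have h01 := h (0, 1) (by simp)
  have h02 := h (0, 2) (by simp)
  have h03 := h (0, 3) (by simp)
  have h12 := h (1, 2) (by simp)
  have h13 := h (1, 3) (by simp)
  have h23 := h (2, 3) (by simp)
  have : (f 0 = f 1 ∧ f 0 = f 2 ∧ f 0 = f 3) ∨ (f' 0 = f' 1 ∧ f' 0 = f' 2 ∧ f' 0 = f' 3) := by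
    dsimp only at h01 h02 h03 h12 h13 h23
    clear key h h0 h0'
    grind
  rcases this with ⟨h1, h2, h3⟩ | ⟨h1, h2, h3⟩
  · exact Or.inl (key f h0 h1 h2 h3)
  · exact Or.inr (key f' h0' h1 h2 h3)

/-- One of f, f' satisfies at least two of the three tests. -/
lemma eq_zero_of_three_tests {w : Fin 4 → GaussianInt} {T : Finset (Fin 4 × Fin 4)}
    {a b c : Fin 4 × Fin 4} (ha : a ∈ T) (hb : b ∈ T) (hc : c ∈ T)
    (key : ∀ g : Fin 4 → ℂ, ∑ k, g k = 0 → ∑ k, (w k).toComplex * g k = 0 →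
      (g a.1 = g a.2 ∧ g b.1 = g b.2 ∨ g a.1 = g a.2 ∧ g c.1 = g c.2 ∨
        g b.1 = g b.2 ∧ g c.1 = g c.2) → g = 0) (f f' : Fin 4 → ℂ) (h0 : ∑ k, f k = 0)
    (h1 : ∑ k, (w k).toComplex * f k = 0) (h0' : ∑ k, f' k = 0)
    (h1' : ∑ k, (w k).toComplex * f' k = 0)
    (h : ∀ t ∈ T, f t.1 = f t.2 ∨ f' t.1 = f' t.2) : f = 0 ∨ f' = 0 := by
  have h2 := h a ha
  have h3 := h b hb
  have h4 := h c hc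
  have h5 := key f h0 h1
  have h6 := key f' h0' h1'
  tauto

end Combinatorics

/-! ### Dimensions, fineness and inequivalence of the eight gradings -/

open EigenData

/-- The eight fine group gradings. -/
noncomputable def fineGradings : Fin 8 → Set (Submodule ℂ Sl4) :=
  ![(gradedBasis cartanData_isValid).grading, (gradedBasis pauliData_isValid).grading,
    (gradedBasis orthogonalData_isValid).grading, (gradedBasis torusTwoData_isValid).grading,
    (gradedBasis torusOneData_isValid).grading, (gradedBasis torusPauliData_isValid).grading,
    (gradedBasis pauliPauliData_isValid).grading, (gradedBasis blockData_isValid).grading]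

lemma hasDims_fineGradings (i : Fin 8) : HasDims (fineGradings i) (dims i) := by
  fin_cases i
  · exact (gradedBasis cartanData_isValid).hasDims (by norm_num) (by norm_num)
  · exact (gradedBasis pauliData_isValid).hasDims (by norm_num) (by norm_num)
  · exact (gradedBasis orthogonalData_isValid).hasDims (by norm_num) (by norm_num)
  · exact (gradedBasis torusTwoData_isValid).hasDims (by norm_num) (by norm_num)
  · exact (gradedBasis torusOneData_isValid).hasDims (by norm_num) (by norm_num)
  · exact (gradedBasis torusPauliData_isValid).hasDims (by norm_num) (by norm_num)
  · exact (gradedBasis pauliPauliData_isValid).hasDims (by norm_num) (by norm_num)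
  · exact (gradedBasis blockData_isValid).hasDims (by norm_num) (by norm_num)

lemma isFineGroupGrading_of_one {m : ℕ} {D : EigenData m} (h : D.IsValid 1) :
    IsFineGroupGrading (gradedBasis h).grading :=
  (gradedBasis h).isFineGroupGrading (by norm_num) one_pos fun _ _ _ _ _ _ => Or.inl rfl

lemma isFineGroupGrading_of_three {m : ℕ} {D : EigenData m} (h : D.IsValid 3)
    (hdiag : ∀ i : Fin 15, i.val < 3 → Matrix.diagonal (D.b i).diag = D.b i)
    (hT : ∀ t ∈ ({(0, 1), (0, 2), (0, 3), (1, 2), (1, 3), (2, 3)} : Finset (Fin 4 × Fin 4)),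
      t.1 ≠ t.2 ∧ ∃ j : Fin 15, 3 ≤ j.val ∧ (∃ s, D.p s j ≠ D.q s j) ∧ D.b j t.1 t.2 ≠ 0) :
    IsFineGroupGrading (gradedBasis h).grading :=
  isFineGroupGrading_of_tests h (by norm_num) (by norm_num) 0 _ hdiag (by simp) hT
    (eq_zero_of_six_tests 0)

lemma isFineGroupGrading_of_two {m : ℕ} {D : EigenData m} (h : D.IsValid 2)
    (hdiag : ∀ i : Fin 15, i.val < 2 → Matrix.diagonal (D.b i).diag = D.b i)
    (hw : ∀ i : Fin 15, i.val < 2 → D.b i 0 0 + D.b i 1 1 = 0)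
    (hT : ∀ t ∈ ({(0, 1), (2, 3), (0, 2)} : Finset (Fin 4 × Fin 4)),
      t.1 ≠ t.2 ∧ ∃ j : Fin 15, 2 ≤ j.val ∧ (∃ s, D.p s j ≠ D.q s j) ∧ D.b j t.1 t.2 ≠ 0) :
    IsFineGroupGrading (gradedBasis h).grading := by
  -- The diagonal matrices in question have the form diag(a, -a, b, -b).
  refine isFineGroupGrading_of_tests h (by norm_num) (by norm_num) ![1, 1, 0, 0] _ hdiag
    (fun i hi => ?_) hT (eq_zero_of_three_tests (a := (0, 1)) (b := (2, 3)) (c := (0, 2)) (by simp)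
      (by simp) (by simp) fun g h0 h1 h2 => ?_)
  · simpa [Fin.sum_univ_four] using hw i hi
  · simp [Fin.sum_univ_four] at h0 h1 h2
    have h3 : g 0 = 0 ∧ g 2 = 0 := by
      rcases h2 with ⟨e, e'⟩ | ⟨e, e'⟩ | ⟨e, e'⟩
      · exact ⟨by linear_combination (1 / 2 : ℂ) * h1 + (1 / 2 : ℂ) * e,
          by linear_combination (1 / 2 : ℂ) * h0 - (1 / 2 : ℂ) * h1 + (1 / 2 : ℂ) * e'⟩
      · have : g 0 = 0 := by linear_combination (1 / 2 : ℂ) * h1 + (1 / 2 : ℂ) * e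
        exact ⟨this, e'.symm.trans this⟩
      · have : g 2 = 0 := by
          linear_combination (1 / 2 : ℂ) * h0 - (1 / 2 : ℂ) * h1 + (1 / 2 : ℂ) * e
        exact ⟨e'.trans this, this⟩
    funext i
    fin_cases i
    · exact h3.1
    · change g 1 = 0
      linear_combination h1 - h3.1
    · exact h3.2
    · change g 3 = 0
      linear_combination h0 - h1 - h3.2

lemma isFineGroupGrading_torusOne : IsFineGroupGrading (gradedBasis torusOneData_isValid).grading := by
  -- Here the last two diagonal entries agree, and by tracelessness the first three determine the
  -- matrix.
  refine isFineGroupGrading_of_tests _ (by norm_num) (by norm_num) ![0, 0, 1, -1]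
    {(0, 1), (0, 2), (1, 2)} (by decide +kernel) (by decide +kernel) (by decide +kernel)
    (eq_zero_of_three_tests (a := (0, 1)) (b := (0, 2)) (c := (1, 2)) (by simp)
      (by simp) (by simp) fun g h0 h1 h2 => ?_)
  simp [Fin.sum_univ_four] at h0 h1 h2
  have h3 : g 0 = g 1 ∧ g 0 = g 2 := by
    rcases h2 with ⟨e, e'⟩ | ⟨e, e'⟩ | ⟨e, e'⟩
    · exact ⟨e, e'⟩
    · exact ⟨e, e.trans e'⟩
    · exact ⟨e.trans e'.symm, e⟩
  have h4 : g 0 = 0 := by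
    linear_combination (1 / 4 : ℂ) * h0 + (1 / 4 : ℂ) * h1 + (1 / 4 : ℂ) * h3.1 + (1 / 2 : ℂ) * h3.2
  funext i
  fin_cases i
  · exact h4
  · exact h3.1.symm.trans h4
  · exact h3.2.symm.trans h4
  · change g 3 = 0
    linear_combination h4 - h3.2 - h1

theorem isFineGroupGrading_fineGradings (i : Fin 8) : IsFineGroupGrading (fineGradings i) := by
  fin_cases i
  · exact isFineGroupGrading_of_three cartanData_isValid (by decide +kernel) (by decide +kernel)
  · exact isFineGroupGrading_of_one pauliData_isValid
  · exact isFineGroupGrading_of_three orthogonalData_isValid (by decide +kernel) (by decide +kernel)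
  · exact isFineGroupGrading_of_two torusTwoData_isValid (by decide +kernel) (by decide +kernel)
      (by decide +kernel)
  · exact isFineGroupGrading_torusOne
  · exact isFineGroupGrading_of_one torusPauliData_isValid
  · exact isFineGroupGrading_of_one pauliPauliData_isValid
  · exact isFineGroupGrading_of_two blockData_isValid (by decide +kernel) (by decide +kernel)
      (by decide +kernel)

lemma hasActingPiece_of_data {m d : ℕ} {D : EigenData m} (h : D.IsValid d) (hd : d ≤ 15) {e : ℕ}
    (i j : Fin 15) (he : (if i.val < d then d else 1) = e) (hi : ∀ s, D.p s i = D.q s i)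
    (hij : D.b i * D.b j ≠ D.b j * D.b i) : HasActingPiece e (gradedBasis h).grading :=
  he ▸ (gradedBasis h).hasActingPiece hd (deg_eq_one h hi) (lie_ne_zero h hij)

lemma not_hasActingPiece_of_data {m d : ℕ} {D : EigenData m} (h : D.IsValid d) (hd : d ≤ 15) {e : ℕ}
    (hi : ∀ i : Fin 15, (if i.val < d then d else 1) = e → ∃ s, D.p s i ≠ D.q s i) :
    ¬ HasActingPiece e (gradedBasis h).grading :=
  (gradedBasis h).not_hasActingPiece hd fun i he => by
    obtain ⟨s, hs⟩ := hi i he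
    exact deg_ne_one h hs

/-- The dimensions leave seven pairs. Six are separated by whether a piece of suitable dimension has
degree 1 and acts nontrivially, as part of a torus does. The Pauli grading and its two-qubit
analogue are separated by square stability: all degrees of the latter have square 1. -/
theorem not_equivalent_fineGradings {i j : Fin 8} (hij : i ≠ j) :
    ¬ Equivalent (fineGradings i) (fineGradings j) := by
  have key : ∀ {i j : Fin 8}, i < j → ¬ Equivalent (fineGradings i) (fineGradings j) := by
    intro i j hlt he
    have hd := HasDims.equivalent he (hasDims_fineGradings i) (hasDims_fineGradings j)
    have hlist : ∀ i j : Fin 8, i < j → dims i = dims j → i = 0 ∧ j = 2 ∨ i = 1 ∧ j = 5 ∨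
        i = 1 ∧ j = 6 ∨ i = 5 ∧ j = 6 ∨ i = 3 ∧ j = 4 ∨ i = 3 ∧ j = 7 ∨ i = 4 ∧ j = 7 := by
      decide +kernel
    rcases hlist i j hlt hd with ⟨rfl, rfl⟩ | ⟨rfl, rfl⟩ | ⟨rfl, rfl⟩ | ⟨rfl, rfl⟩ | ⟨rfl, rfl⟩ |
      ⟨rfl, rfl⟩ | ⟨rfl, rfl⟩
    · exact not_hasActingPiece_of_data (e := 3) orthogonalData_isValid (by norm_num)
        (by decide +kernel) (HasActingPiece.equivalent he (hasActingPiece_of_data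
          cartanData_isValid (by norm_num) 0 3 rfl (by decide +kernel) (by decide +kernel)))
    · exact not_hasActingPiece_of_data (e := 1) pauliData_isValid (by norm_num)
        (by decide +kernel) (HasActingPiece.equivalent he.symm (hasActingPiece_of_data
          torusPauliData_isValid (by norm_num) 11 0 rfl (by decide +kernel) (by decide +kernel)))
    · exact (gradedBasis pauliData_isValid).not_isSquareStable
        -- Index 3 is the shift and index 0 the clock; the degree of the shift does not have order
        -- two.
        (lie_lie_ne_zero (i := 3) (j := 0) pauliData_isValid (by decide +kernel))
        (fun h1 => by
          have h2 := congrArg Units.val (congrFun h1 0)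
          change (_ / _ : ℂ) * (_ / _) = 1 at h2
          rw [div_mul_div_comm, ← map_mul, ← map_mul] at h2
          simp [pauliData] at h2
          rw [← map_mul, ← map_one GaussianInt.toComplex, GaussianInt.toComplex_inj] at h2
          exact absurd h2 (by decide +kernel))
        (IsSquareStable.equivalent he.symm ((gradedBasis pauliPauliData_isValid).isSquareStable
          fun i => deg_mul_self pauliPauliData_isValid
            ((by decide +kernel : ∀ i s, pauliPauliData.p s i * pauliPauliData.p s i =
              pauliPauliData.q s i * pauliPauliData.q s i) i)))
    · exact not_hasActingPiece_of_data (e := 1) pauliPauliData_isValid (by norm_num)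
        (by decide +kernel) (HasActingPiece.equivalent he (hasActingPiece_of_data
          torusPauliData_isValid (by norm_num) 11 0 rfl (by decide +kernel) (by decide +kernel)))
    · exact not_hasActingPiece_of_data (e := 2) torusOneData_isValid (by norm_num)
        (by decide +kernel) (HasActingPiece.equivalent he (hasActingPiece_of_data
          torusTwoData_isValid (by norm_num) 0 3 rfl (by decide +kernel) (by decide +kernel)))
    · exact not_hasActingPiece_of_data (e := 2) blockData_isValid (by norm_num)
        (by decide +kernel) (HasActingPiece.equivalent he (hasActingPiece_of_data
          torusTwoData_isValid (by norm_num) 0 3 rfl (by decide +kernel) (by decide +kernel)))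
    · exact not_hasActingPiece_of_data (e := 1) blockData_isValid (by norm_num)
        (by decide +kernel) (HasActingPiece.equivalent he (hasActingPiece_of_data
          torusOneData_isValid (by norm_num) 2 5 rfl (by decide +kernel) (by decide +kernel)))
  rcases lt_or_gt_of_ne hij with hlt | hlt
  · exact key hlt
  · exact fun he => key hlt he.symm

/-! ### Identification of the Pauli and orthogonal gradings -/

lemma span_eq_inSl (S : Set Sl4) :
    Submodule.span ℂ S = inSl (Submodule.span ℂ (Subtype.val '' S)) := by
  have h := Submodule.map_span (Sl4.incl : Sl4 →ₗ[ℂ] Matrix (Fin 4) (Fin 4) ℂ) S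
  have h2 := Submodule.comap_map_eq_of_injective
    (f := (Sl4.incl : Sl4 →ₗ[ℂ] Matrix (Fin 4) (Fin 4) ℂ)) Subtype.val_injective
    (Submodule.span ℂ S)
  rw [h] at h2
  exact h2.symm

namespace EigenData

variable {m d : ℕ} {D : EigenData m} (h : D.IsValid d)

lemma piece_eq_inSl (i : Fin 15) : (gradedBasis h).piece ((gradedBasis h).deg i) =
    inSl (Submodule.span ℂ ((fun k => toMat (D.b k)) '' {k | k = i ∨ k.val < d ∧ i.val < d})) := by
  rw [GradedBasis.piece, span_eq_inSl, Set.image_image]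
  simp_rw [gradedBasis_basis, (gradedBasis h).deg_eq_iff]

lemma piece_eq_inSl_singleton {i : Fin 15} (hi : d ≤ i.val ∨ d = 1) :
    (gradedBasis h).piece ((gradedBasis h).deg i) = inSl (Submodule.span ℂ {toMat (D.b i)}) := by
  have : {k : Fin 15 | k = i ∨ k.val < d ∧ i.val < d} = {i} := by
    ext k
    rw [Set.mem_ofPred_eq, Set.mem_singleton_iff]
    constructor
    · rintro (hk | hk)
      · exact hk
      · exact Fin.ext (by omega)
    · exact Or.inl
  rw [piece_eq_inSl, this, Set.image_singleton]

lemma isPairwiseOrthogonal : IsPairwiseOrthogonal (gradedBasis h).grading := by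
  rintro _ ⟨i, rfl⟩ _ ⟨j, rfl⟩ hij A hA B hB
  induction hA using Submodule.span_induction with
  | mem A hA =>
    induction hB using Submodule.span_induction with
    | mem B hB =>
      obtain ⟨k, hk, rfl⟩ := hA
      obtain ⟨l, hl, rfl⟩ := hB
      have hkl : k ≠ l := by
        rintro rfl
        exact hij (congrArg _ ((show _ = _ from hk).symm.trans hl))
      rw [gradedBasis_basis, gradedBasis_basis, Matrix.trace_mul_comm, ← toMat_conjTranspose,
        ← toMat_mul, trace_toMat, (h.orthogonal l k).mpr hkl.symm, map_zero]
    | zero =>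
      change (A.1 * (0 : Matrix (Fin 4) (Fin 4) ℂ)ᴴ).trace = 0
      simp
    | add B B' _ _ hB hB' =>
      rw [val_add, Matrix.conjTranspose_add, mul_add, Matrix.trace_add, hB, hB', add_zero]
    | smul c B _ hB => rw [val_smul, Matrix.conjTranspose_smul, Matrix.mul_smul, Matrix.trace_smul,
        hB, smul_zero]
  | zero =>
    change ((0 : Matrix (Fin 4) (Fin 4) ℂ) * B.1ᴴ).trace = 0
    simp
  | add A A' _ _ hA hA' => rw [val_add, add_mul, Matrix.trace_add, hA, hA', add_zero]
  | smul c A _ hA => rw [val_smul, Matrix.smul_mul, Matrix.trace_smul, hA, smul_zero]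

lemma toMat_pow (M : Matrix (Fin 4) (Fin 4) GaussianInt) (n : ℕ) :
    toMat (M ^ n) = toMat M ^ n := map_pow _ M n

lemma toMat_matUnit (k l : Fin 4) : toMat (matUnit k l) = Matrix.single k l 1 := by
  ext i j
  rw [toMat_apply, matUnit, Matrix.single_apply, Matrix.single_apply]
  split_ifs <;> simp

lemma toMat_shift : toMat shift = pauliQ 4 := by
  ext i j
  rw [toMat_apply]
  fin_cases i <;> fin_cases j <;> simp [shift, matUnit, pauliQ]

lemma toMat_clock : toMat clock = pauliP 4 := by
  have hexp : Complex.exp (2 * Real.pi * Complex.I / (4 : ℕ)) = Complex.I := by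
    have : (2 * Real.pi * Complex.I / (4 : ℕ) : ℂ) = Real.pi / 2 * Complex.I := by
      push_cast
      ring
    rw [this, Complex.exp_pi_div_two_mul_I]
  have hI : gaussI.toComplex = Complex.I := by
    rw [GaussianInt.toComplex_def]
    simp
  ext i j
  rw [toMat_apply, pauliP, hexp, clock, Matrix.diagonal_apply, Matrix.diagonal_apply]
  fin_cases i <;> fin_cases j <;> simp [hI, pow_succ]

end EigenData

lemma fineGradings_one : fineGradings 1 = pauliGrading 4 := by
  have hb : ∀ i, toMat (pauliData.b i) =
      pauliQ 4 ^ ((i.val + 1) / 4) * pauliP 4 ^ ((i.val + 1) % 4) := fun i => by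
    rw [← toMat_shift, ← toMat_clock, ← toMat_pow, ← toMat_pow, ← toMat_mul]
    rfl
  change (gradedBasis pauliData_isValid).grading = _
  ext V
  constructor
  · rintro ⟨i, rfl⟩
    refine ⟨(i.val + 1) / 4, (i.val + 1) % 4, by omega, by omega, ?_, ?_⟩
    · rw [Ne, Prod.mk.injEq]
      omega
    · dsimp only
      rw [piece_eq_inSl_singleton _ (Or.inr rfl), hb]
  · rintro ⟨a, b, ha, hb', hab, rfl⟩
    rw [Ne, Prod.mk.injEq] at hab
    -- The exponents (a, b) are enumerated by 4 a + b, shifted by one because (0, 0) is left out.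
    refine ⟨⟨4 * a + b - 1, by omega⟩, ?_⟩
    dsimp only
    rw [piece_eq_inSl_singleton _ (Or.inr rfl), hb]
    have h1 : (4 * a + b - 1 + 1) / 4 = a := by omega
    have h2 : (4 * a + b - 1 + 1) % 4 = b := by omega
    dsimp only
    rw [h1, h2]

/-- A basis of the traceless diagonal matrices. -/
lemma inSl_span_diagonal {m : ℕ} {D : EigenData m} (h0 : D.b 0 = matUnit 0 0 - matUnit 1 1)
    (h1 : D.b 1 = matUnit 0 0 + matUnit 1 1 - 2 • matUnit 2 2)
    (h2 : D.b 2 = matUnit 0 0 + matUnit 1 1 + matUnit 2 2 - 3 • matUnit 3 3) :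
    inSl (Submodule.span ℂ ((fun k => toMat (D.b k)) '' {k : Fin 15 | k.val < 3})) =
      inSl (Submodule.span ℂ (Set.range fun i : Fin 4 => Matrix.single i i (1 : ℂ))) := by
  have e0 : toMat (D.b 0) = Matrix.single 0 0 1 - Matrix.single 1 1 1 := by
    rw [h0, toMat_sub, toMat_matUnit, toMat_matUnit]
  have e1 : toMat (D.b 1) =
      Matrix.single 0 0 1 + Matrix.single 1 1 1 - (2 : ℂ) • Matrix.single 2 2 1 := by
    rw [h1, two_smul, toMat_sub, toMat_add, toMat_add, two_smul, toMat_matUnit, toMat_matUnit,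
      toMat_matUnit]
  have e2 : toMat (D.b 2) = Matrix.single 0 0 1 + Matrix.single 1 1 1 + Matrix.single 2 2 1 -
      (3 : ℂ) • Matrix.single 3 3 1 := by
    have : (3 : ℂ) • (Matrix.single 3 3 1 : Matrix (Fin 4) (Fin 4) ℂ) = 3 • Matrix.single 3 3 1 :=
      by module
    rw [h2, this, toMat_sub, toMat_add, toMat_add, ← toMat_matUnit, ← toMat_matUnit,
      ← toMat_matUnit, ← toMat_matUnit]
    congr 1
    exact map_nsmul (GaussianInt.toComplex.mapMatrix) 3 _
  have hE : ∀ i : Fin 4, Matrix.single i i (1 : ℂ) ∈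
      Submodule.span ℂ (Set.range fun i : Fin 4 => Matrix.single i i (1 : ℂ)) := fun i =>
    Submodule.subset_span ⟨i, rfl⟩
  apply le_antisymm
  · refine Submodule.comap_mono (Submodule.span_le.mpr ?_)
    rintro _ ⟨k, hk, rfl⟩
    rw [Set.mem_ofPred_eq] at hk
    have : k = 0 ∨ k = 1 ∨ k = 2 := by
      simp only [Fin.ext_iff]
      change k.val = 0 ∨ k.val = 1 ∨ k.val = 2
      omega
    rcases this with rfl | rfl | rfl
    · dsimp only
      rw [e0]
      exact sub_mem (hE 0) (hE 1)
    · dsimp only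
      rw [e1]
      exact sub_mem (add_mem (hE 0) (hE 1)) (Submodule.smul_mem _ _ (hE 2))
    · dsimp only
      rw [e2]
      exact sub_mem (add_mem (add_mem (hE 0) (hE 1)) (hE 2)) (Submodule.smul_mem _ _ (hE 3))
  · intro X hX
    change X.1 ∈ Submodule.span ℂ _ at hX
    change X.1 ∈ Submodule.span ℂ _
    obtain ⟨c, hc⟩ := (Submodule.mem_span_range_iff_exists_fun ℂ).mp hX
    have htr : c 0 + c 1 + c 2 + c 3 = 0 := by
      have : X.1.trace = 0 := X.2
      rw [← hc, Matrix.trace_sum, Fin.sum_univ_four] at this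
      simpa using this
    have hB : ∀ k : Fin 15, k.val < 3 → toMat (D.b k) ∈
        Submodule.span ℂ ((fun k => toMat (D.b k)) '' {k : Fin 15 | k.val < 3}) := fun k hk =>
      Submodule.subset_span ⟨k, hk, rfl⟩
    -- The coefficients solve a triangular system from the last diagonal entry upward.
    have hX2 : X.1 = ((c 0 - c 1) / 2) • toMat (D.b 0) +
        ((c 0 + c 1) / 2 + c 3 / 3) • toMat (D.b 1) + (-(c 3) / 3) • toMat (D.b 2) := by
      have h2 : c 2 = -c 0 - c 1 - c 3 := by linear_combination htr
      rw [← hc, Fin.sum_univ_four, h2, e0, e1, e2]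
      module
    rw [hX2]
    exact add_mem (add_mem (Submodule.smul_mem _ _ (hB 0 (by norm_num)))
      (Submodule.smul_mem _ _ (hB 1 (by norm_num)))) (Submodule.smul_mem _ _ (hB 2 (by decide)))

lemma piece_zero {m : ℕ} {D : EigenData m} (h : D.IsValid 3)
    (h0 : D.b 0 = matUnit 0 0 - matUnit 1 1)
    (h1 : D.b 1 = matUnit 0 0 + matUnit 1 1 - 2 • matUnit 2 2)
    (h2 : D.b 2 = matUnit 0 0 + matUnit 1 1 + matUnit 2 2 - 3 • matUnit 3 3) {i : Fin 15}
    (hi : i.val < 3) : (gradedBasis h).piece ((gradedBasis h).deg i) =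
      inSl (Submodule.span ℂ (Set.range fun i : Fin 4 => Matrix.single i i (1 : ℂ))) := by
  rw [← inSl_span_diagonal h0 h1 h2, piece_eq_inSl]
  congr 4
  ext k
  exact ⟨fun hk => hk.elim (fun hk => hk ▸ hi) And.left, fun hk => Or.inr ⟨hk, hi⟩⟩

lemma fineGradings_two : fineGradings 2 = orthogonalGrading 4 := by
  change (gradedBasis orthogonalData_isValid).grading = _
  have hs : ∀ i : Fin 15, 3 ≤ i.val → ∃ k l : Fin 4, k < l ∧
      (orthogonalData.b i = matUnit k l + matUnit l k ∨
        orthogonalData.b i = matUnit k l - matUnit l k) := by decide +kernel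
  have ha : ∀ k l : Fin 4, k < l → ∃ i : Fin 15, 3 ≤ i.val ∧
      orthogonalData.b i = matUnit k l + matUnit l k := by decide +kernel
  have hm : ∀ k l : Fin 4, k < l → ∃ i : Fin 15, 3 ≤ i.val ∧
      orthogonalData.b i = matUnit k l - matUnit l k := by decide +kernel
  ext V
  constructor
  · rintro ⟨i, rfl⟩
    by_cases hi : i.val < 3
    · exact Or.inl (piece_zero _ rfl rfl rfl hi)
    · push Not at hi
      obtain ⟨k, l, hkl, hb⟩ := hs i hi
      refine Or.inr ⟨k, l, hkl, ?_⟩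
      dsimp only
      rw [piece_eq_inSl_singleton _ (Or.inl hi)]
      rcases hb with hb | hb
      · rw [hb, toMat_add, toMat_matUnit, toMat_matUnit]
        exact Or.inl rfl
      · rw [hb, toMat_sub, toMat_matUnit, toMat_matUnit]
        exact Or.inr rfl
  · rintro (rfl | ⟨k, l, hkl, rfl | rfl⟩)
    · exact ⟨0, piece_zero _ rfl rfl rfl (by norm_num)⟩
    · obtain ⟨i, hi, hb⟩ := ha k l hkl
      refine ⟨i, ?_⟩
      dsimp only
      rw [piece_eq_inSl_singleton _ (Or.inl hi), hb, toMat_add, toMat_matUnit, toMat_matUnit]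
    · obtain ⟨i, hi, hb⟩ := hm k l hkl
      refine ⟨i, ?_⟩
      dsimp only
      rw [piece_eq_inSl_singleton _ (Or.inl hi), hb, toMat_sub, toMat_matUnit, toMat_matUnit]

/-! ### The Cartan grading -/

/-- Spanning subspaces U k inside independent subspaces f (a k) leave no room: no nonzero f x is
missed, and none is larger than its U k. Applied to root spaces, it suffices to exhibit enough root
vectors. -/
lemma eq_of_le_of_iSupIndep {V : Type*} [AddCommGroup V] [Module ℂ V] {ι κ : Type*}
    {f : ι → Submodule ℂ V} (hf : iSupIndep f) {U : κ → Submodule ℂ V} (hU : ⨆ k, U k = ⊤)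
    (a : κ → ι) (hle : ∀ k, U k ≤ f (a k)) (hinj : ∀ k l, a k = a l → U k = U l) {x : ι}
    (hx : f x ≠ ⊥) : ∃ k, x = a k ∧ f x = U k := by
  have hdisj : Disjoint (f x) (⨆ (k) (_ : a k ≠ x), U k) := (hf x).mono_right <|
    iSup₂_le fun k hk => (hle k).trans (le_iSup₂_of_le (a k) hk le_rfl)
  obtain ⟨k, hk⟩ : ∃ k, a k = x := by
    by_contra hcon
    push Not at hcon
    refine hx (le_bot_iff.mp (hdisj le_rfl ?_))
    rw [show (⨆ (k) (_ : a k ≠ x), U k) = ⊤ from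
      eq_top_iff.mpr (hU ▸ iSup_le fun k => le_iSup₂_of_le k (hcon k) le_rfl)]
    exact le_top
  subst hk
  refine ⟨k, rfl, le_antisymm (fun y hy => ?_) (hle k)⟩
  have htop : U k ⊔ (⨆ (l) (_ : a l ≠ a k), U l) = ⊤ := by
    rw [eq_top_iff, ← hU]
    refine iSup_le fun l => ?_
    by_cases hl : a l = a k
    · exact (hinj l k hl).le.trans le_sup_left
    · exact (le_iSup₂_of_le (f := fun (l : κ) (_ : a l ≠ a k) => U l) l hl le_rfl).trans le_sup_right
  obtain ⟨u, hu, v, hv, rfl⟩ := Submodule.mem_sup.mp (htop ▸ Submodule.mem_top : y ∈ _)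
  have hv' : v ∈ f (a k) := by
    have := sub_mem hy (hle k hu)
    rwa [add_sub_cancel_left] at this
  have hv0 : v = 0 := by
    rw [← Submodule.mem_bot ℂ]
    exact Submodule.disjoint_def.mp hdisj v hv' hv ▸ Submodule.zero_mem _
  rw [hv0, add_zero]
  exact hu

/-- The Cartan subalgebra of diagonal matrices. -/
def diagSl4 : LieSubalgebra ℂ Sl4 where
  carrier := {X | ∀ k l, k ≠ l → X.1 k l = 0}
  zero_mem' _ _ _ := rfl
  add_mem' hX hY k l hkl := by rw [val_add, Matrix.add_apply, hX k l hkl, hY k l hkl, add_zero]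
  smul_mem' c X hX k l hkl := by rw [val_smul, Matrix.smul_apply, hX k l hkl, smul_zero]
  lie_mem' {X Y} hX hY k l hkl := by
    rw [val_lie, Matrix.sub_apply, Matrix.mul_apply, Matrix.mul_apply,
      Finset.sum_eq_zero fun i _ => ?_, Finset.sum_eq_zero fun i _ => ?_, sub_zero]
    · by_cases h : k = i
      · rw [hX i l (h ▸ hkl), mul_zero]
      · rw [hY k i h, zero_mul]
    · by_cases h : k = i
      · rw [hY i l (h ▸ hkl), mul_zero]
      · rw [hX k i h, zero_mul]

lemma diagSl4_lie_apply {X : Sl4} (hX : X ∈ diagSl4) (Y : Sl4) (k l : Fin 4) :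
    (⁅X, Y⁆ : Sl4).1 k l = (X.1 k k - X.1 l l) * Y.1 k l := by
  rw [val_lie, Matrix.sub_apply, Matrix.mul_apply, Matrix.mul_apply,
    Finset.sum_eq_single k (fun i _ hi => by rw [hX k i hi.symm, zero_mul]) (by simp),
    Finset.sum_eq_single l (fun i _ hi => by rw [hX i l hi, mul_zero]) (by simp)]
  ring

/-- A diagonal matrix with pairwise distinct differences of entries. -/
noncomputable def regularSl4 : Sl4 :=
  -- The entries are -11 + 4 · (0, 1, 3, 7), shifted to have trace zero.
  ⟨Matrix.diagonal ![-11, -7, 1, 17], by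
    change (Matrix.diagonal ![-11, -7, 1, 17] : Matrix (Fin 4) (Fin 4) ℂ).trace = 0
    rw [Matrix.trace_diagonal, Fin.sum_univ_four]
    simp
    norm_num⟩

lemma regularSl4_mem : regularSl4 ∈ diagSl4 := fun _ _ hkl => Matrix.diagonal_apply_ne _ hkl

lemma regularSl4_apply (k : Fin 4) :
    regularSl4.1 k k = ((![-11, -7, 1, 17] : Fin 4 → ℤ) k : ℂ) := by
  change Matrix.diagonal ![-11, -7, 1, 17] k k = _
  rw [Matrix.diagonal_apply_eq]
  fin_cases k <;> simp

instance : diagSl4.IsCartanSubalgebra where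
  nilpotent := by
    have : IsLieAbelian diagSl4 := ⟨fun X Y => Subtype.ext <| Subtype.ext <| Matrix.ext fun k l => by
      refine (diagSl4_lie_apply X.2 Y.1 k l).trans ?_
      by_cases hkl : k = l
      · rw [hkl, sub_self, zero_mul]
        rfl
      · rw [Y.2 k l hkl, mul_zero]
        rfl⟩
    infer_instance
  self_normalizing := by
    refine le_antisymm (fun X hX => ?_) (LieSubalgebra.le_normalizer _)
    rw [LieSubalgebra.mem_normalizer_iff] at hX
    intro k l hkl
    -- Bracketing with the regular element multiplies the (k, l) entry of X by a nonzero difference.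
    have h1 := hX _ regularSl4_mem k l hkl
    rw [← lie_skew] at h1
    change -(⁅regularSl4, X⁆ : Sl4).1 k l = 0 at h1
    rw [diagSl4_lie_apply regularSl4_mem, neg_eq_zero, regularSl4_apply, regularSl4_apply] at h1
    refine (mul_eq_zero.mp h1).resolve_left fun h2 => ?_
    rw [← Int.cast_sub, Int.cast_eq_zero] at h2
    have : ∀ k l : Fin 4, k ≠ l → (![-11, -7, 1, 17] : Fin 4 → ℤ) k - ![-11, -7, 1, 17] l ≠ 0 := by
      decide +kernel
    exact this k l hkl h2

/-- The positions of the entries of the root vectors. -/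
def rootPos : Fin 15 → Fin 4 × Fin 4 :=
  ![(0, 0), (0, 0), (0, 0), (0, 1), (0, 2), (0, 3), (1, 0), (1, 2), (1, 3), (2, 0), (2, 1), (2, 3),
    (3, 0), (3, 1), (3, 2)]

/-- The roots. -/
def root (i : Fin 15) (X : diagSl4) : ℂ :=
  X.1.1 (rootPos i).1 (rootPos i).1 - X.1.1 (rootPos i).2 (rootPos i).2

lemma basis_mem_rootSpace (i : Fin 15) : (gradedBasis cartanData_isValid).basis i ∈
    LieAlgebra.rootSpace diagSl4 (root i) := by
  refine LieModule.weightSpace_le_genWeightSpace _ _ ?_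
  rw [LieModule.mem_weightSpace]
  intro X
  refine Subtype.ext (Matrix.ext fun k l => (diagSl4_lie_apply X.2 _ k l).trans ?_)
  rw [val_smul, Matrix.smul_apply, gradedBasis_basis, toMat_apply, smul_eq_mul]
  by_cases h0 : cartanData.b i k l = 0
  · rw [h0, map_zero, mul_zero, mul_zero]
  have hpos : ∀ i : Fin 15, ∀ t : Fin 4 × Fin 4, cartanData.b i t.1 t.2 ≠ 0 →
      t.1 = t.2 ∧ (rootPos i).1 = (rootPos i).2 ∨ t = rootPos i := by decide +kernel
  rcases hpos i (k, l) h0 with ⟨hkl, hp⟩ | hp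
  · rw [root, show k = l from hkl, hp, sub_self, sub_self]
  · rw [root, ← hp]

/-- The value at the regular element already distinguishes the roots. -/
lemma deg_eq_of_root_eq {i j : Fin 15} (h : root i = root j) :
    (gradedBasis cartanData_isValid).deg i = (gradedBasis cartanData_isValid).deg j := by
  rw [(gradedBasis cartanData_isValid).deg_eq_iff]
  have h1 := congrFun h ⟨regularSl4, regularSl4_mem⟩
  unfold root at h1
  dsimp only at h1
  simp only [regularSl4_apply, ← Int.cast_sub, Int.cast_inj] at h1
  revert i j
  have : ∀ i j : Fin 15, (![-11, -7, 1, 17] : Fin 4 → ℤ) (rootPos i).1 -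
      (![-11, -7, 1, 17] : Fin 4 → ℤ) (rootPos i).2 = (![-11, -7, 1, 17] : Fin 4 → ℤ) (rootPos j).1 -
      (![-11, -7, 1, 17] : Fin 4 → ℤ) (rootPos j).2 → i = j ∨ i.val < 3 ∧ j.val < 3 := by
    decide +kernel
  exact fun {i j} _ => this i j

theorem isCartanGrading_fineGradings : IsCartanGrading (fineGradings 0) := by
  refine ⟨diagSl4, inferInstance, ?_⟩
  change (gradedBasis cartanData_isValid).grading = _
  set b := gradedBasis cartanData_isValid
  have hind : iSupIndep fun χ : diagSl4 → ℂ => (LieAlgebra.rootSpace diagSl4 χ).toSubmodule := by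
    rw [LieSubmodule.iSupIndep_toSubmodule]
    exact LieModule.iSupIndep_genWeightSpace ℂ diagSl4 Sl4
  have hle : ∀ i, b.piece (b.deg i) ≤ (LieAlgebra.rootSpace diagSl4 (root i)).toSubmodule := by
    intro i
    rw [GradedBasis.piece, Submodule.span_le]
    rintro _ ⟨k, hk, rfl⟩
    have hroot : root k = root i := by
      rcases (b.deg_eq_iff k i).mp hk with rfl | ⟨h1, h2⟩
      · rfl
      · have : ∀ i : Fin 15, i.val < 3 → (rootPos i).1 = (rootPos i).2 := by decide +kernel
        funext X
        rw [root, root, this i h2, this k h1, sub_self, sub_self]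
    exact hroot ▸ basis_mem_rootSpace k
  have htop : ⨆ i, b.piece (b.deg i) = ⊤ := by
    rw [← sSup_range]
    exact b.isGrading.sSup_eq_top
  have key := fun χ hχ => eq_of_le_of_iSupIndep hind htop root hle
    (fun i j hij => by rw [deg_eq_of_root_eq hij]) (x := χ) hχ
  ext V
  constructor
  · rintro ⟨i, rfl⟩
    have hne := b.isGrading.ne_bot _ (b.piece_mem i)
    refine ⟨hne, root i, ?_⟩
    obtain ⟨k, hk, hk'⟩ := key (root i) fun h0 => hne (le_bot_iff.mp (h0 ▸ hle i))
    rw [hk']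
    exact congrArg b.piece (deg_eq_of_root_eq hk)
  · rintro ⟨hne, χ, rfl⟩
    obtain ⟨k, -, hk⟩ := key χ hne
    rw [hk]
    exact b.piece_mem k

end Gradings

end LieGrading

theorem mainTheorem6 :
    Nonempty (LieAlgebra.SpecialLinear.sl (Fin 4) ℂ ≃ₗ⁅ℂ⁆
      LieAlgebra.Orthogonal.so (Fin 6) ℂ) ∧
    ∃ 𝒢 : Fin 8 → Set (LieAlgebra.SpecialLinear.sl (Fin 4) ℂ ≃ₗ⁅ℂ⁆
        LieAlgebra.SpecialLinear.sl (Fin 4) ℂ),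
      LieGrading.IsClassification 𝒢 ∧
      LieGrading.Gr (𝒢 1) = LieGrading.pauliGrading 4 ∧
      LieGrading.Gr (𝒢 2) = LieGrading.orthogonalGrading 4 ∧
      LieGrading.IsPairwiseOrthogonal (LieGrading.Gr (𝒢 2)) ∧
      ∀ f : LieAlgebra.SpecialLinear.sl (Fin 4) ℂ ≃ₗ⁅ℂ⁆ LieAlgebra.Orthogonal.so (Fin 6) ℂ,
        LieGrading.IsClassification fun i => LieGrading.conj f (𝒢 i) := by
  have hmad : ∀ i, LieGrading.IsMADGroup (LieGrading.diagGroup (LieGrading.fineGradings i)) :=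
    fun i => (LieGrading.isFineGroupGrading_fineGradings i).isMADGroup
  have hGr : ∀ i, LieGrading.Gr (LieGrading.diagGroup (LieGrading.fineGradings i)) =
      LieGrading.fineGradings i := fun i =>
    LieGrading.Gr_diagGroup (LieGrading.isFineGroupGrading_fineGradings i).1
  -- A conjugation between two of the groups would carry the eigenspaces of one to those of the
  -- other, which are the inequivalent gradings themselves.
  have hlist : LieGrading.IsCompleteMADList
      fun i => LieGrading.diagGroup (LieGrading.fineGradings i) := by
    refine LieGrading.IsCompleteMADList.of_not_conjugate hmad fun i j hij => ?_
    rintro ⟨h, hh⟩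
    refine LieGrading.not_equivalent_fineGradings hij ⟨h, ?_⟩
    rw [← hGr i, ← LieGrading.Gr_conj, hh, hGr j]
  have hclass : LieGrading.IsClassification
      fun i => LieGrading.diagGroup (LieGrading.fineGradings i) := by
    refine ⟨hlist, hlist.isCompleteFineList, ?_, fun i => ?_⟩
    · rw [hGr]
      exact LieGrading.isCartanGrading_fineGradings
    · rw [hGr]
      exact LieGrading.hasDims_fineGradings i
  refine ⟨⟨LieGrading.slEquivSo⟩, _, hclass, ?_, ?_, ?_, fun f => hclass.conj f⟩
  · rw [hGr, LieGrading.fineGradings_one]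
  · rw [hGr, LieGrading.fineGradings_two]
  · rw [hGr]
    exact LieGrading.EigenData.isPairwiseOrthogonal LieGrading.orthogonalData_isValid
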